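/- Graphs are finite and may have parallel edges. Let $P_{10}$ be the Petersen graph and let $P:=P_{10}-z$ for a vertex $z$ of $P_{10}$; $P$ has exactly three vertices of degree 2. The $P$-inflation of a cubic graph at a vertex $v_0$ deletes $v_0$, adds a copy of $P$, and joins the three former neighbours of $v_0$ to the three distinct 2-valent vertices of this copy. Let $P_{10}^0:=P_{10}$ and, for $k\ge 1$, let $P_{10}^k$ be the graph obtained from $P_{10}^{k-1}$ by applying the $P$-inflation at every vertex of $P_{10}^{k-1}$. A circuit is a connected 2-regular graph (two parallel edges form a circuit of length 2); it is even if it has an even number of vertices. A frame of a graph $G$ is a graph $F$ every component of which is an even circuit or a 2-connected cubic graph, such that $G$ has a spanning subgraph $F'$ which is a subdivision of $F$ and every component of which has an even number of vertices. For a 2-connected graph $G$ put $$l(G):=\min_{C}\ \max_{v\in V(G)} d_G(C,v),$$ where $C$ runs over all circuits of $G$ and $d_G(C,v)$ is the length of a shortest path in $G$ from a vertex of $C$ to $v$. Theorem. Let $k\ge 0$ be an integer and let $\mathcal F(k)$ be the set of frames of $P_{10}^k$. Then (1) every frame $G\in\mathcal F(k)$ is cubic and 2-connected, and (2) $$\min_{G\in\mathcal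 F(k)} l(G)=\begin{cases} k & \text{if } k\in\{0,1\},\\ 2^{2k-3} & \text{if } k\ge 2.\end{cases}$$ -/

import Mathlib

open scoped Graph

/-! ### Multigraphs: degree, connectivity, components, circuits, the parameter `l` -/

namespace Graph

/-- The degree of a vertex in a multigraph; loops count twice. -/
noncomputable def vertexDegree {α β : Type*} (G : Graph α β) (v : α) : ℕ∞ :=
  (G.incidenceSet v).encard + (G.loopSet v).encard

/-- Every vertex has degree `d`. -/
def IsRegularOfDeg {α β : Type*} (G : Graph α β) (d : ℕ∞) : Prop :=
  ∀ v ∈ V(G), G.vertexDegree v = d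

/-- A multigraph is connected if it is nonempty and any two vertices are joined by a path. -/
def IsConnected {α β : Type*} (G : Graph α β) : Prop :=
  G.toSimpleGraph.Connected

/-- A component: a connected subgraph closed under incidence, i.e. a maximal connected subgraph. -/
def IsComponentOf {α β : Type*} (K G : Graph α β) : Prop :=
  K ≤c G ∧ K.IsConnected

/-- A circuit: a finite connected 2-regular multigraph. Two parallel edges form a circuit of
length 2. -/
def IsCircuitGraph {α β : Type*} (C : Graph α β) : Prop :=
  V(C).Finite ∧ C.IsConnected ∧ C.IsRegularOfDeg 2

/-- A cubic multigraph. -/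
def IsCubic {α β : Type*} (G : Graph α β) : Prop :=
  G.IsRegularOfDeg 3

/-- A 2-connected multigraph: it is connected, has at least two vertices, and stays connected when
any vertex or any edge is removed. (If there are at least three vertices, the condition on edges
follows from the one on vertices; if there are exactly two vertices, it says that they are joined by
at least two parallel edges. In both cases any two distinct vertices are joined by two internally
disjoint paths.) -/
def IsTwoConnected {α β : Type*} (G : Graph α β) : Prop :=
  G.IsConnected ∧ V(G).Nontrivial ∧
    (∀ v ∈ V(G), (G.deleteVerts {v}).IsConnected) ∧
    ∀ e ∈ E(G), (G.deleteEdges {e}).IsConnected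

/-- The distance in `G` between a subgraph `C` and a vertex `v`: the least length of a path
that joins a vertex of `C` to `v`. -/
noncomputable def distFrom {α β : Type*} (G C : Graph α β) (v : V(G)) : ℕ∞ :=
  ⨅ c : V(G), ⨅ _ : (c : α) ∈ V(C), G.toSimpleGraph.edist c v

/-- `l(G)`: the minimum over all circuits `C` of `G` of the maximum over all vertices `v` of `G` of
the distance between `C` and `v`. -/
noncomputable def ell {α β : Type*} (G : Graph α β) : ℕ∞ :=
  ⨅ C : Graph α β, ⨅ _ : C ≤ G ∧ C.IsCircuitGraph, ⨆ v : V(G), G.distFrom C v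

end Graph

/-! ### Subdivisions and frames -/

/-- A presentation of the simple graph `H` as a subdivision of the multigraph `F`: the vertices of
`F` are vertices of `H`, each edge of `F` is replaced by a path of `H` between its ends (a
cycle, if the edge is a loop), these paths meet only in common ends, and they make up all of `H`. -/
structure Subdivision {V α β : Type*} (H : SimpleGraph V) (F : Graph α β) where
  /-- the vertex of `H` that corresponds to a vertex of `F` -/
  branch : V(F) → V
  branch_injective : Function.Injective branch
  /-- one end of an edge of `F` -/
  src : E(F) → V(F)
  /-- the other end of an edge of `F` -/
  tgt : E(F) → V(F)
  isLink : ∀ e : E(F), F.IsLink e (src e) (tgt e)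
  /-- the path that replaces an edge of `F` -/
  walk : ∀ e : E(F), H.Walk (branch (src e)) (branch (tgt e))
  isPath : ∀ e, src e ≠ tgt e → (walk e).IsPath
  isCycle : ∀ e, (src e = tgt e) →
    ∃ h : branch (tgt e) = branch (src e), ((walk e).copy rfl h).IsCycle
  branch_mem_support : ∀ e x, branch x ∈ (walk e).support → x = src e ∨ x = tgt e
  support_inter : ∀ e e', e ≠ e' → ∀ v, v ∈ (walk e).support → v ∈ (walk e').support →
    v ∈ Set.range branch
  edges_disjoint : ∀ e e', e ≠ e' → List.Disjoint (walk e).edges (walk e').edges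
  cover_vertices : ∀ v, v ∈ Set.range branch ∨ ∃ e, v ∈ (walk e).support
  cover_edges : ∀ a ∈ H.edgeSet, ∃ e, a ∈ (walk e).edges

/-- `F` is a frame of the graph `G`: every component of `F` is an even circuit or a 2-connected
cubic graph, and `G` has a spanning subgraph `H` that is a subdivision of `F` and all of whose
components have an even number of vertices. -/
def IsFrame {V α β : Type*} (F : Graph α β) (G : SimpleGraph V) : Prop :=
  (∀ K : Graph α β, K.IsComponentOf F →
    (K.IsCircuitGraph ∧ Even V(K).ncard) ∨ (K.IsTwoConnected ∧ K.IsCubic)) ∧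
  ∃ H : SimpleGraph V, H ≤ G ∧ Nonempty (Subdivision H F) ∧
    ∀ c : H.ConnectedComponent, c.supp.Finite ∧ Even c.supp.ncard

/-! ### The iterated Petersen graph -/

/-- The Petersen graph: an outer pentagon `0 1 2 3 4`, an inner pentagram `5 7 9 6 8`, and spokes. -/
def petersen : SimpleGraph (Fin 10) :=
  SimpleGraph.fromRel fun i j => (i, j) ∈
    ([(0, 1), (1, 2), (2, 3), (3, 4), (4, 0),
      (5, 7), (7, 9), (9, 6), (6, 8), (8, 5),
      (0, 5), (1, 6), (2, 7), (3, 8), (4, 9)] : List (Fin 10 × Fin 10))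

instance : DecidableRel petersen.Adj := fun i j => by
  unfold petersen
  rw [SimpleGraph.fromRel_adj]
  infer_instance

/-- The vertices of `P`, the Petersen graph minus the vertex `0`. -/
abbrev PVert : Type := {x : Fin 10 // x ≠ 0}

/-- The graph `P`, the Petersen graph minus the vertex `0`. -/
def petersenMinus : SimpleGraph PVert := petersen.comap Subtype.val

/-- `t` assigns to each neighbour `u` of each vertex `v` of `G` a 2-valent vertex `t v u` of `P`
(that is, a neighbour of the removed vertex `0`), distinct ones to distinct neighbours of `v`. -/
def IsAttachment {V : Type*} (G : SimpleGraph V) (t : V → V → PVert) : Prop :=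
  ∀ v, (∀ u, G.Adj v u → petersen.Adj 0 (t v u)) ∧ Set.InjOn (t v) (G.neighborSet v)

/-- The graph that results from `G` by `P`-inflation at every vertex: each vertex `v` is replaced by
a copy `{v} × P` of `P`, and an edge `v u` of `G` by an edge between the vertex `t v u` of the copy
of `v` and the vertex `t u v` of the copy of `u`. -/
def inflate {V : Type*} (G : SimpleGraph V) (t : V → V → PVert) : SimpleGraph (V × PVert) where
  Adj x y := (x.1 = y.1 ∧ petersenMinus.Adj x.2 y.2) ∨
    (G.Adj x.1 y.1 ∧ x.2 = t x.1 y.1 ∧ y.2 = t y.1 x.1)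
  symm := ⟨by
    rintro x y (⟨h1, h2⟩ | ⟨h1, h2, h3⟩)
    · exact Or.inl ⟨h1.symm, h2.symm⟩
    · exact Or.inr ⟨h1.symm, h3, h2⟩⟩
  loopless := ⟨by
    rintro x (⟨_, h⟩ | ⟨h, _⟩)
    · exact h.ne rfl
    · exact h.ne rfl⟩

/-- The vertices of the `k`-th iterated Petersen graph. -/
def IterVert : ℕ → Type
  | 0 => Fin 10
  | k + 1 => IterVert k × PVert

/-- `Q` is (a copy of) the graph `P₁₀ᵏ`: it results from the Petersen graph by inflating all
vertices, `k` times. (The attachments may be chosen freely in each step.) -/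
def IsIteratedPetersen : (k : ℕ) → SimpleGraph (IterVert k) → Prop
  | 0, Q => Q = petersen
  | k + 1, Q => ∃ (G : SimpleGraph (IterVert k)) (t : IterVert k → IterVert k → PVert),
      IsIteratedPetersen k G ∧ IsAttachment G t ∧ Q = inflate G t

/-- Every `P₁₀ᵏ` exists, because all degrees are at most 3. -/
theorem exists_isIteratedPetersen (k : ℕ) : ∃ Q, IsIteratedPetersen k Q := by
  have h3 : ∀ a : Fin 10, (petersen.neighborSet a).encard = 3 := by
    intro a
    rw [← SimpleGraph.coe_neighborFinset, Set.encard_coe_eq_coe_finsetCard]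
    have : ∀ a : Fin 10, (petersen.neighborFinset a).card = 3 := by decide
    rw [this a]; rfl
  have hle : ∀ k, ∃ Q, IsIteratedPetersen k Q ∧ ∀ v, (Q.neighborSet v).encard ≤ 3 := by
    intro k
    induction k with
    | zero => exact ⟨petersen, rfl, fun v => (h3 v).le⟩
    | succ k ih =>
      obtain ⟨G, hG, hd⟩ := ih
      have hf : ∀ v, ∃ f : IterVert k → Fin 10,
          (G.neighborSet v ⊆ f ⁻¹' petersen.neighborSet 0) ∧ Set.InjOn f (G.neighborSet v) := by
        intro v
        exact (Set.finite_of_encard_le_coe (hd v)).exists_injOn_of_encard_le ((hd v).trans (h3 0).ge)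
      choose f hf1 hf2 using hf
      classical
      let t : IterVert k → IterVert k → PVert := fun v u =>
        if h : f v u ≠ 0 then ⟨f v u, h⟩ else ⟨1, by decide⟩
      have ht : ∀ v u, G.Adj v u → (t v u : Fin 10) = f v u := by
        intro v u h
        have : f v u ≠ 0 := fun h0 => by
          have := hf1 v h
          simp [h0] at this
        simp [t, this]
      have hat : IsAttachment G t := by
        intro v
        refine ⟨fun u hu => ?_, fun u hu u' hu' h => hf2 v hu hu' ?_⟩
        · rw [ht v u hu]; exact hf1 v hu
        · rw [← ht v u hu, ← ht v u' hu', h]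
      refine ⟨inflate G t, ⟨G, t, hG, hat, rfl⟩, ?_⟩
      rintro ⟨v, a⟩
      let g : IterVert k × PVert → Fin 10 := fun x => if x.1 = v then x.2 else 0
      have hinj : Set.InjOn g ((inflate G t).neighborSet (v, a)) := by
        rintro ⟨u, b⟩ hb ⟨u', b'⟩ hb' h
        rcases hb with ⟨rfl, hb⟩ | ⟨hu, hb1, hb2⟩ <;> rcases hb' with ⟨h1, hb'⟩ | ⟨hu', hb1', hb2'⟩
        · simp only at h1; subst h1; simp [g] at h; simp [Subtype.ext h]
        · have := hu'.ne'; simp only at this; simp [g, this] at h; exact absurd h b.2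
        · simp only at h1; subst h1; have := hu.ne'; simp only at this
          simp [g, this] at h; exact absurd h.symm b'.2
        · simp only at hu hu' hb1 hb1' hb2 hb2'
          obtain rfl := (hat v).2 hu hu' (hb1.symm.trans hb1')
          rw [hb2, hb2']
      have hmap : g '' ((inflate G t).neighborSet (v, a)) ⊆ petersen.neighborSet a := by
        rintro _ ⟨⟨u, b⟩, hb, rfl⟩
        rcases hb with ⟨rfl, hb⟩ | ⟨hu, hb1, hb2⟩
        · simpa [g, petersenMinus] using hb
        · have h0 := hu.ne'; simp only at h0 hu hb1
          have h1 := ((hat v).1 u hu).symm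
          rw [← hb1] at h1
          simpa [g, h0] using h1
      exact hinj.encard_image.symm.le.trans ((Set.encard_le_encard hmap).trans (h3 a).le)
  obtain ⟨Q, hQ, _⟩ := hle k
  exact ⟨Q, hQ⟩

universe u v

/-! Call the 2-valent vertices of `P` its ports. Let `H` be a spanning subgraph of `P₁₀ᵏ` that
subdivides a frame `F`, with all components even. Then `H` is solid: it has no one-edge cut, and
every union of components has even order (`Subdivision.isSolid`). Solidity survives two
contractions: shrinking every copy of `P` to a point (nine vertices, an odd number), and shrinking
everything outside one copy to the vertex `0` of the Petersen graph.

Two facts on the Petersen graph drive the proof. A solid spanning subgraph is connected, since by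
girth 5 each component has at least five vertices, and five plus five is excluded by parity. A
connected spanning subgraph with even degrees would be a Hamiltonian circuit, and there is none.
Hence `H` is connected and is not a circuit, so `F` is cubic and 2-connected. Moreover every copy of
`P` contains a vertex of odd degree in `H`, that is, a branch vertex
(`exists_odd_neighborSet_of_isSolid`).

Lower bound: a path of `H` that replaces an edge of `F` cannot swallow a whole copy of `P`, so for
`k ≥ 1` the map from `F` to `P₁₀ᵏ⁻¹` sends adjacent vertices to equal or adjacent ones
(`Subdivision.fst_branch_eq_or_adj`). A circuit of `F` yields an even subgraph whose image in the
Petersen graph is not spanning, so the circuit has no vertex over some root vertex `z`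
(`Subdivision.exists_rootVertex_ne`). Some vertex over `z` is far from everything outside: at
distance at least 1 in `P₁₀⁰`, at least 2 in `P₁₀¹`, and four times as far after each further
inflation, because ports of `P` are at mutual distance 3 and the edge between two copies adds 1
(`exists_potential`).

Upper bound: `P` has a spanning subdivided claw with the ports as leaves, so `P₁₀ᵏ⁻¹` is a frame of
`P₁₀ᵏ` (`isFrame_liftGraph`). Lifting a 9-circuit of the Petersen graph through the inflations gives
a circuit of matching eccentricity (`IsIteratedPetersen.exists_isCircuit_coversWithin`). For `k = 0`
the frame with two vertices and three parallel edges has `l = 0`. -/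

open SimpleGraph

/-! ### Edge cuts, parity, and solid subgraphs. -/

namespace SimpleGraph

variable {V : Type*}

/-- The darts of `H` that leave the vertex set `S`, as ordered pairs. -/
def outDarts (H : SimpleGraph V) (S : Set V) : Set (V × V) :=
  {p | H.Adj p.1 p.2 ∧ p.1 ∈ S ∧ p.2 ∉ S}

lemma ncard_outDarts_compl (H : SimpleGraph V) (S : Set V) :
    (H.outDarts Sᶜ).ncard = (H.outDarts S).ncard := by
  rw [← Set.ncard_image_of_injective (H.outDarts S) Prod.swap_injective]
  congr 1
  ext ⟨a, b⟩
  simp only [outDarts, Set.mem_ofPred_eq, Set.mem_image, Prod.exists, Prod.swap_prod_mk,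
    Prod.mk.injEq, Set.mem_compl_iff, not_not]
  constructor
  · rintro ⟨h, ha, hb⟩
    exact ⟨b, a, ⟨h.symm, hb, ha⟩, rfl, rfl⟩
  · rintro ⟨_, _, ⟨h, ha, hb⟩, rfl, rfl⟩
    exact ⟨h.symm, hb, ha⟩

lemma outDarts_eq_empty_iff {H : SimpleGraph V} {S : Set V} :
    H.outDarts S = ∅ ↔ ∀ x y, H.Adj x y → x ∈ S → y ∈ S := by
  simp only [Set.eq_empty_iff_forall_notMem, outDarts, Set.mem_ofPred_eq, Prod.forall, not_and,
    not_not]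

lemma outDarts_compl_eq_empty {H : SimpleGraph V} {S : Set V} (h : H.outDarts S = ∅) :
    H.outDarts Sᶜ = ∅ := by
  rw [outDarts_eq_empty_iff] at h ⊢
  exact fun x y hxy hx hy => hx (h y x hxy.symm hy)

lemma ncard_outDarts_singleton (H : SimpleGraph V) (v : V) :
    (H.outDarts {v}).ncard = (H.neighborSet v).ncard := by
  rw [← Set.ncard_image_of_injective (H.neighborSet v) (Prod.mk_right_injective v)]
  congr 1
  ext ⟨a, b⟩
  simp only [outDarts, Set.mem_ofPred_eq, Set.mem_image, mem_neighborSet, Prod.mk.injEq,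
    Set.mem_singleton_iff]
  constructor
  · rintro ⟨h, rfl, hb⟩
    exact ⟨b, h, rfl, rfl⟩
  · rintro ⟨_, h, rfl, rfl⟩
    exact ⟨h, rfl, h.ne'⟩

/-- The darts that start in `S` are even in number by the degree condition. Those that also end in
`S` are paired by reversal, so the remaining ones, which leave `S`, are even in number too. -/
lemma even_ncard_outDarts [Finite V] (H : SimpleGraph V) (S : Set V)
    (h : ∀ v ∈ S, Even (H.neighborSet v).ncard) : Even (H.outDarts S).ncard := by
  classical
  have := Fintype.ofFinite V
  set A : Finset (V × V) := Finset.univ.filter fun p => H.Adj p.1 p.2 ∧ p.1 ∈ S with hA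
  have hAe : Even A.card := by
    rw [Finset.card_eq_sum_card_fiberwise (f := Prod.fst) (t := Finset.univ) (by simp)]
    refine Finset.even_sum _ fun v _ => ?_
    by_cases hv : v ∈ S
    · have h' := h v hv
      rw [Set.ncard_eq_toFinset_card',
        ← Finset.card_image_of_injective _ (Prod.mk_right_injective v)] at h'
      refine (congrArg (fun s : Finset (V × V) => Even s.card) ?_).mpr h'
      ext ⟨a, b⟩
      simp only [hA, Finset.mem_filter, Finset.mem_univ, true_and, Finset.mem_image,
        Set.mem_toFinset, mem_neighborSet, Prod.mk.injEq]
      constructor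
      · rintro ⟨⟨h, _⟩, rfl⟩
        exact ⟨b, h, rfl, rfl⟩
      · rintro ⟨_, h, rfl, rfl⟩
        exact ⟨⟨h, hv⟩, rfl⟩
    · convert Even.zero
      rw [Finset.card_eq_zero, Finset.filter_eq_empty_iff]
      rintro ⟨a, b⟩ hab rfl
      simp only [hA, Finset.mem_filter] at hab
      exact hv hab.2.2
  have hBe : Even (A.filter fun p => p.2 ∈ S).card := by
    rw [← ZMod.natCast_eq_zero_iff_even]
    have := Finset.sum_involution (s := A.filter fun p => p.2 ∈ S) (f := fun _ => (1 : ZMod 2))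
      (fun p _ => p.swap) (fun p _ => by decide)
      (fun p hp _ h => by
        simp only [hA, Finset.mem_filter] at hp
        have h2 := congrArg Prod.fst h
        exact hp.1.2.1.ne h2.symm)
      (fun p hp => by
        simp only [hA, Finset.mem_filter, Finset.mem_univ, true_and, Prod.fst_swap,
          Prod.snd_swap] at hp ⊢
        exact ⟨⟨hp.1.1.symm, hp.2⟩, hp.1.2⟩)
      (fun p hp => Prod.swap_swap p)
    simpa using this
  have hC : (H.outDarts S).ncard = (A.filter fun p => ¬ p.2 ∈ S).card := by
    rw [← Set.ncard_coe_finset]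
    congr 1
    ext p
    simp [hA, outDarts, and_assoc]
  have := Finset.card_filter_add_card_filter_not (s := A) (fun p => p.2 ∈ S)
  rw [hC]
  rw [← this] at hAe
  exact (Nat.even_add.1 hAe).1 hBe

/-- `H` is solid if no edge cut consists of one edge and all unions of components are even. -/
def IsSolid (H : SimpleGraph V) : Prop :=
  ∀ S : Set V, (H.outDarts S).ncard ≠ 1 ∧ (H.outDarts S = ∅ → Even S.ncard)

/-- Connectedness in terms of edge cuts. -/
def CutConnected (H : SimpleGraph V) : Prop :=
  ∀ S : Set V, H.outDarts S = ∅ → S = ∅ ∨ S = Set.univ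

/-- Degree 1 would make the cut around `v` a one-edge cut; degree 0 would make `{v}` an odd union of
components. -/
lemma IsSolid.two_le_ncard_neighborSet [Finite V] {H : SimpleGraph V} (h : H.IsSolid) (v : V) :
    2 ≤ (H.neighborSet v).ncard := by
  obtain ⟨h1, h2⟩ := h {v}
  rw [ncard_outDarts_singleton] at h1
  have h3 : (H.neighborSet v).ncard ≠ 0 := by
    intro h0
    rw [← ncard_outDarts_singleton, Set.ncard_eq_zero] at h0
    simpa using h2 h0
  omega

end SimpleGraph

/-! ### The Petersen graph -/

lemma petersen_neighborSet_ncard (v : Fin 10) : (petersen.neighborSet v).ncard = 3 := by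
  rw [Set.ncard_eq_toFinset_card']
  revert v
  decide

/-- Girth 5: at most four vertices induce a forest. -/
lemma petersen_exists_le_one_neighbor :
    ∀ S : Finset (Fin 10), S.Nonempty → S.card ≤ 4 →
      ∃ v ∈ S, (S.filter (petersen.Adj v)).card ≤ 1 := by
  decide +kernel

/-- A nonempty union of components has minimum degree at least 2 and therefore at least five
vertices. The same holds for its complement, and a split into five and five contradicts evenness. -/
lemma SimpleGraph.IsSolid.cutConnected_of_le_petersen {H : SimpleGraph (Fin 10)}
    (h : H.IsSolid) (hle : H ≤ petersen) : H.CutConnected := by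
  classical
  have key : ∀ S : Set (Fin 10), H.outDarts S = ∅ → S.ncard ≤ 4 → S = ∅ := by
    intro S hS hc
    by_contra hne
    obtain ⟨v, hv, hv1⟩ := petersen_exists_le_one_neighbor S.toFinset
      (by simpa [Set.nonempty_iff_ne_empty] using hne) (by rwa [← Set.ncard_eq_toFinset_card'])
    have h2 := h.two_le_ncard_neighborSet v
    rw [Set.ncard_eq_toFinset_card'] at h2
    have hsub : (H.neighborSet v).toFinset ⊆ S.toFinset.filter (petersen.Adj v) := by
      intro w hw
      simp only [Set.mem_toFinset, SimpleGraph.mem_neighborSet, Finset.mem_filter] at hw hv ⊢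
      exact ⟨SimpleGraph.outDarts_eq_empty_iff.1 hS v w hw hv, hle hw⟩
    have := Finset.card_le_card hsub
    omega
  intro S hS
  have hs := (h S).2 hS
  have hadd := Set.ncard_add_ncard_compl S
  rw [Nat.card_eq_fintype_card, Fintype.card_fin] at hadd
  by_cases hc : S.ncard ≤ 4
  · exact Or.inl (key S hS hc)
  · refine Or.inr (Set.compl_empty_iff.1 (key Sᶜ (SimpleGraph.outDarts_compl_eq_empty hS) ?_))
    obtain ⟨m, hm⟩ := hs
    omega

/-- Exactly two of three Booleans are true. -/
def exactlyTwo (a b c : Bool) : Bool :=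
  (a && b && !c) || (a && !b && c) || (!a && b && c)

set_option synthInstance.maxSize 4096 in
-- The variable `eij` tells whether the edge `ij` belongs to a 2-factor. The complement of a
-- 2-factor is a perfect matching, and the six alternatives are the six perfect matchings. Each
-- degree condition is stated as soon as its three edges are introduced, which prunes the
-- enumeration.
lemma petersen_two_factor_cut :
    ∀ e01 e04 e05 : Bool, exactlyTwo e01 e04 e05 = true →
    ∀ e12 e16 : Bool, exactlyTwo e01 e12 e16 = true →
    ∀ e23 e27 : Bool, exactlyTwo e12 e23 e27 = true →
    ∀ e34 e38 : Bool, exactlyTwo e23 e34 e38 = true →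
    ∀ e49 : Bool, exactlyTwo e04 e34 e49 = true →
    ∀ e57 e58 : Bool, exactlyTwo e05 e57 e58 = true →
    ∀ e68 e69 : Bool, exactlyTwo e16 e68 e69 = true →
    ∀ e79 : Bool, exactlyTwo e27 e57 e79 = true →
    exactlyTwo e38 e58 e68 = true →
    exactlyTwo e49 e69 e79 = true →
      (e01 = false ∧ e23 = false ∧ e57 = false ∧ e68 = false ∧ e49 = false) ∨
      (e01 = false ∧ e34 = false ∧ e69 = false ∧ e58 = false ∧ e27 = false) ∨
      (e12 = false ∧ e34 = false ∧ e79 = false ∧ e68 = false ∧ e05 = false) ∨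
      (e12 = false ∧ e04 = false ∧ e57 = false ∧ e69 = false ∧ e38 = false) ∨
      (e23 = false ∧ e04 = false ∧ e79 = false ∧ e58 = false ∧ e16 = false) ∨
      (e05 = false ∧ e16 = false ∧ e27 = false ∧ e38 = false ∧ e49 = false) := by
  decide +kernel

lemma petersen_neighborSet_eq (H : SimpleGraph (Fin 10)) [DecidableRel H.Adj] (hle : H ≤ petersen)
    (v a b c : Fin 10) (hN : petersen.neighborFinset v = {a, b, c}) (hab : a ≠ b) (hac : a ≠ c)
    (hbc : b ≠ c) (h2 : (H.neighborSet v).ncard = 2) :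
    exactlyTwo (decide (H.Adj v a)) (decide (H.Adj v b)) (decide (H.Adj v c)) = true := by
  have h : (({a, b, c} : Finset (Fin 10)).filter (H.Adj v)).card = 2 := by
    rw [← h2, Set.ncard_eq_toFinset_card']
    congr 1
    ext w
    rw [← hN]
    simp only [Finset.mem_filter, SimpleGraph.mem_neighborFinset, Set.mem_toFinset,
      SimpleGraph.mem_neighborSet, and_iff_right_iff_imp]
    exact fun hw => hle hw
  by_cases ha : H.Adj v a <;> by_cases hb : H.Adj v b <;> by_cases hc : H.Adj v c <;>
    simp_all [exactlyTwo, Finset.filter_insert, Finset.filter_singleton]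

/-- Degrees are even, at most 3, and nonzero by connectedness, hence all equal to 2. The omitted
edges then form a perfect matching, whose removal leaves two disjoint pentagons. -/
lemma petersen_not_even_of_cutConnected {H : SimpleGraph (Fin 10)} (hle : H ≤ petersen)
    (he : ∀ v, Even (H.neighborSet v).ncard) (hc : H.CutConnected) : False := by
  classical
  have hd : ∀ v, (H.neighborSet v).ncard = 2 := by
    intro v
    have h0 : (H.neighborSet v).ncard ≠ 0 := by
      intro h0
      rw [← SimpleGraph.ncard_outDarts_singleton, Set.ncard_eq_zero] at h0
      rcases hc _ h0 with h | h
      · simp at h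
      · have := congrArg Set.ncard h
        simp [Set.ncard_univ] at this
    have h3 : (H.neighborSet v).ncard ≤ 3 := by
      rw [← petersen_neighborSet_ncard v]
      exact Set.ncard_le_ncard (fun w hw => hle hw)
    obtain ⟨m, hm⟩ := he v
    omega
  have hcut : ∀ S : Finset (Fin 10), S ≠ ∅ → S ≠ Finset.univ →
      (∀ x ∈ S, ∀ y ∉ S, petersen.Adj x y → ¬ H.Adj x y) → False := by
    intro S h0 h1 h
    have : H.outDarts S = ∅ := by
      rw [SimpleGraph.outDarts_eq_empty_iff]
      intro x y hxy hx
      by_contra hy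
      exact h x hx y hy (hle hxy) hxy
    rcases hc _ this with h' | h'
    · exact h0 (by simpa using h')
    · exact h1 (by simpa using h')
  have key := petersen_neighborSet_eq H hle
  have h0 := key 0 1 4 5 (by decide) (by decide) (by decide) (by decide) (hd 0)
  have h1 := key 1 0 2 6 (by decide) (by decide) (by decide) (by decide) (hd 1)
  rw [H.adj_comm 1 0] at h1
  have h2 := key 2 1 3 7 (by decide) (by decide) (by decide) (by decide) (hd 2)
  rw [H.adj_comm 2 1] at h2
  have h3 := key 3 2 4 8 (by decide) (by decide) (by decide) (by decide) (hd 3)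
  rw [H.adj_comm 3 2] at h3
  have h4 := key 4 0 3 9 (by decide) (by decide) (by decide) (by decide) (hd 4)
  rw [H.adj_comm 4 0] at h4
  rw [H.adj_comm 4 3] at h4
  have h5 := key 5 0 7 8 (by decide) (by decide) (by decide) (by decide) (hd 5)
  rw [H.adj_comm 5 0] at h5
  have h6 := key 6 1 8 9 (by decide) (by decide) (by decide) (by decide) (hd 6)
  rw [H.adj_comm 6 1] at h6
  have h7 := key 7 2 5 9 (by decide) (by decide) (by decide) (by decide) (hd 7)
  rw [H.adj_comm 7 2] at h7
  rw [H.adj_comm 7 5] at h7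
  have h8 := key 8 3 5 6 (by decide) (by decide) (by decide) (by decide) (hd 8)
  rw [H.adj_comm 8 3] at h8
  rw [H.adj_comm 8 5] at h8
  rw [H.adj_comm 8 6] at h8
  have h9 := key 9 4 6 7 (by decide) (by decide) (by decide) (by decide) (hd 9)
  rw [H.adj_comm 9 4] at h9
  rw [H.adj_comm 9 6] at h9
  rw [H.adj_comm 9 7] at h9
  have := petersen_two_factor_cut _ _ _ h0 _ _ h1 _ _ h2 _ _ h3 _ h4 _ _ h5 _ _ h6 _ h7 h8 h9
  simp only [decide_eq_false_iff_not] at this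
  rcases this with ⟨a, b, c, d, e⟩ | ⟨a, b, c, d, e⟩ | ⟨a, b, c, d, e⟩ | ⟨a, b, c, d, e⟩ |
    ⟨a, b, c, d, e⟩ | ⟨a, b, c, d, e⟩
  -- In each case the set is one of the two pentagons, and `hm` lists its five boundary edges, which
  -- are the edges of the matching.
  · refine hcut {0, 3, 4, 5, 8} (by decide) (by decide) fun x hx y hy hxy => ?_
    have hm : (x, y) ∈ ([(0, 1), (3, 2), (5, 7), (8, 6), (4, 9)] : List (Fin 10 × Fin 10)) := by
      revert x y; decide +kernel
    simp only [List.mem_cons, Prod.mk.injEq, List.not_mem_nil, or_false] at hm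
    rcases hm with ⟨rfl, rfl⟩ | ⟨rfl, rfl⟩ | ⟨rfl, rfl⟩ | ⟨rfl, rfl⟩ | ⟨rfl, rfl⟩ <;>
      first | assumption | (rw [H.adj_comm]; assumption)
  · refine hcut {0, 4, 5, 7, 9} (by decide) (by decide) fun x hx y hy hxy => ?_
    have hm : (x, y) ∈ ([(0, 1), (4, 3), (9, 6), (5, 8), (7, 2)] : List (Fin 10 × Fin 10)) := by
      revert x y; decide +kernel
    simp only [List.mem_cons, Prod.mk.injEq, List.not_mem_nil, or_false] at hm
    rcases hm with ⟨rfl, rfl⟩ | ⟨rfl, rfl⟩ | ⟨rfl, rfl⟩ | ⟨rfl, rfl⟩ | ⟨rfl, rfl⟩ <;>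
      first | assumption | (rw [H.adj_comm]; assumption)
  · refine hcut {0, 1, 4, 6, 9} (by decide) (by decide) fun x hx y hy hxy => ?_
    have hm : (x, y) ∈ ([(1, 2), (4, 3), (9, 7), (6, 8), (0, 5)] : List (Fin 10 × Fin 10)) := by
      revert x y; decide +kernel
    simp only [List.mem_cons, Prod.mk.injEq, List.not_mem_nil, or_false] at hm
    rcases hm with ⟨rfl, rfl⟩ | ⟨rfl, rfl⟩ | ⟨rfl, rfl⟩ | ⟨rfl, rfl⟩ | ⟨rfl, rfl⟩ <;>
      first | assumption | (rw [H.adj_comm]; assumption)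
  · refine hcut {0, 1, 5, 6, 8} (by decide) (by decide) fun x hx y hy hxy => ?_
    have hm : (x, y) ∈ ([(1, 2), (0, 4), (5, 7), (6, 9), (8, 3)] : List (Fin 10 × Fin 10)) := by
      revert x y; decide +kernel
    simp only [List.mem_cons, Prod.mk.injEq, List.not_mem_nil, or_false] at hm
    rcases hm with ⟨rfl, rfl⟩ | ⟨rfl, rfl⟩ | ⟨rfl, rfl⟩ | ⟨rfl, rfl⟩ | ⟨rfl, rfl⟩ <;>
      first | assumption | (rw [H.adj_comm]; assumption)
  · refine hcut {0, 1, 2, 5, 7} (by decide) (by decide) fun x hx y hy hxy => ?_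
    have hm : (x, y) ∈ ([(2, 3), (0, 4), (7, 9), (5, 8), (1, 6)] : List (Fin 10 × Fin 10)) := by
      revert x y; decide +kernel
    simp only [List.mem_cons, Prod.mk.injEq, List.not_mem_nil, or_false] at hm
    rcases hm with ⟨rfl, rfl⟩ | ⟨rfl, rfl⟩ | ⟨rfl, rfl⟩ | ⟨rfl, rfl⟩ | ⟨rfl, rfl⟩ <;>
      assumption
  · refine hcut {0, 1, 2, 3, 4} (by decide) (by decide) fun x hx y hy hxy => ?_
    have hm : (x, y) ∈ ([(0, 5), (1, 6), (2, 7), (3, 8), (4, 9)] : List (Fin 10 × Fin 10)) := by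
      revert x y; decide +kernel
    simp only [List.mem_cons, Prod.mk.injEq, List.not_mem_nil, or_false] at hm
    rcases hm with ⟨rfl, rfl⟩ | ⟨rfl, rfl⟩ | ⟨rfl, rfl⟩ | ⟨rfl, rfl⟩ | ⟨rfl, rfl⟩ <;>
      assumption

/-! ### Contractions and their cuts. -/

namespace SimpleGraph

variable {V W : Type*}

/-- The simple graph obtained by identifying vertices along `f` and dropping loops. -/
def contract (f : V → W) (H : SimpleGraph V) : SimpleGraph W where
  Adj u v := u ≠ v ∧ ∃ x y, H.Adj x y ∧ f x = u ∧ f y = v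
  symm := ⟨fun _ _ ⟨hne, x, y, h, hx, hy⟩ => ⟨hne.symm, y, x, h.symm, hy, hx⟩⟩
  loopless := ⟨fun _ h => h.1 rfl⟩

/-- Contracting along `f` creates no parallel edges. -/
def ContractsInjectively (f : V → W) (H : SimpleGraph V) : Prop :=
  ∀ x y x' y', H.Adj x y → H.Adj x' y' → f x ≠ f y → f x = f x' → f y = f y' → x = x' ∧ y = y'

lemma outDarts_contract (f : V → W) (H : SimpleGraph V) (S : Set W) :
    (contract f H).outDarts S = Prod.map f f '' H.outDarts (f ⁻¹' S) := by
  ext ⟨u, v⟩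
  simp only [outDarts, Set.mem_ofPred_eq, contract, Set.mem_image, Prod.exists, Prod.map_apply,
    Prod.mk.injEq, Set.mem_preimage]
  constructor
  · rintro ⟨⟨_, x, y, h, rfl, rfl⟩, hu, hv⟩
    exact ⟨x, y, ⟨h, hu, hv⟩, rfl, rfl⟩
  · rintro ⟨x, y, ⟨h, hu, hv⟩, rfl, rfl⟩
    exact ⟨⟨fun e => hv (e ▸ hu), x, y, h, rfl, rfl⟩, hu, hv⟩

lemma outDarts_contract_eq_empty_iff (f : V → W) (H : SimpleGraph V) (S : Set W) :
    (contract f H).outDarts S = ∅ ↔ H.outDarts (f ⁻¹' S) = ∅ := by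
  rw [outDarts_contract, Set.image_eq_empty]

lemma ContractsInjectively.ncard_outDarts {f : V → W} {H : SimpleGraph V}
    (h : ContractsInjectively f H) (S : Set W) :
    ((contract f H).outDarts S).ncard = (H.outDarts (f ⁻¹' S)).ncard := by
  rw [outDarts_contract, Set.InjOn.ncard_image]
  rintro ⟨x, y⟩ ⟨hxy, hx, hy⟩ ⟨x', y'⟩ ⟨hxy', hx', hy'⟩ he
  simp only [Prod.map_apply, Prod.mk.injEq] at he
  have := h x y x' y' hxy hxy' (fun e => hy (by simpa [← e] using hx)) he.1 he.2
  exact Prod.ext this.1 this.2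

/-- The degree of `w` is the size of the cut around its fibre, so `even_ncard_outDarts` applies. -/
lemma ContractsInjectively.even_ncard_neighborSet [Finite V] {f : V → W} {H : SimpleGraph V}
    (h : ContractsInjectively f H) (w : W)
    (he : ∀ x, f x = w → Even (H.neighborSet x).ncard) :
    Even ((contract f H).neighborSet w).ncard := by
  rw [← ncard_outDarts_singleton, h.ncard_outDarts]
  exact even_ncard_outDarts _ _ he

end SimpleGraph

/-! ### The two contractions of a subgraph of an inflated graph. -/

section Inflate

variable {V : Type*} {G : SimpleGraph V} {t : V → V → PVert} {H : SimpleGraph (V × PVert)}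

lemma inflate_adj_of_fst_ne {x y : V × PVert} (h : (inflate G t).Adj x y) (hne : x.1 ≠ y.1) :
    G.Adj x.1 y.1 ∧ x.2 = t x.1 y.1 ∧ y.2 = t y.1 x.1 :=
  h.resolve_left fun h' => hne h'.1

lemma contract_fst_le (hH : H ≤ inflate G t) : contract Prod.fst H ≤ G := by
  rintro u v ⟨hne, x, y, h, rfl, rfl⟩
  exact (inflate_adj_of_fst_ne (hH h) hne).1

/-- Two copies of `P` are joined by at most one edge, whose ends are prescribed by `t`. -/
lemma contractsInjectively_fst (hH : H ≤ inflate G t) : ContractsInjectively Prod.fst H := by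
  rintro ⟨x, p⟩ ⟨y, q⟩ ⟨x', p'⟩ ⟨y', q'⟩ h h' hne hx hy
  obtain ⟨-, h1, h2⟩ := inflate_adj_of_fst_ne (hH h) hne
  dsimp only at *
  subst hx hy
  obtain ⟨-, h1', h2'⟩ := inflate_adj_of_fst_ne (hH h') hne
  dsimp only at *
  simp [h1, h1', h2, h2']

open Classical in
/-- Collapses everything outside the fibre of `v` to the vertex `0` of the Petersen graph. -/
noncomputable def collapse (v : V) (x : V × PVert) : Fin 10 := if x.1 = v then x.2 else 0

lemma collapse_mk (v : V) (p : PVert) : collapse v (v, p) = p := by simp [collapse]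

lemma collapse_eq_zero_iff {v : V} {x : V × PVert} : collapse v x = 0 ↔ x.1 ≠ v := by
  unfold collapse
  split_ifs with h
  · simp [h, x.2.2]
  · simp [h]

lemma eq_mk_of_collapse_eq {v : V} {x : V × PVert} {p : PVert} (h : collapse v x = p) :
    x = (v, p) := by
  have h1 : x.1 = v := by
    by_contra hne
    exact p.2 (h.symm.trans (collapse_eq_zero_iff.2 hne))
  obtain ⟨u, q⟩ := x
  obtain rfl : u = v := h1
  rw [collapse_mk] at h
  rw [Subtype.ext h]

lemma eq_of_collapse_eq {v : V} {x y : V × PVert} (h : collapse v x = collapse v y)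
    (h0 : collapse v y ≠ 0) : x = y := by
  exact (eq_mk_of_collapse_eq (p := ⟨_, h0⟩) h).trans (eq_mk_of_collapse_eq (p := ⟨_, h0⟩) rfl).symm

lemma fst_eq_of_collapse_ne {v : V} {x : V × PVert} (h : collapse v x ≠ 0) : x.1 = v := by
  by_contra hne
  exact h (collapse_eq_zero_iff.2 hne)

/-- Edges that leave the copy of `v` start at ports, which are neighbours of `0` in the Petersen
graph. -/
lemma contract_collapse_le (ht : IsAttachment G t) (hH : H ≤ inflate G t) (v : V) :
    contract (collapse v) H ≤ petersen := by
  have key : ∀ x y, H.Adj x y → x.1 = v → petersen.Adj (collapse v x) (collapse v y) := by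
    rintro ⟨w, p⟩ ⟨u, q⟩ h rfl
    by_cases hne : w = u
    · subst hne
      rcases hH h with ⟨-, h⟩ | ⟨h, -⟩
      · rw [collapse_mk, collapse_mk]
        exact h
      · exact absurd rfl h.ne
    · obtain ⟨h1, h2, h3⟩ := inflate_adj_of_fst_ne (hH h) hne
      rw [(collapse_eq_zero_iff (v := w) (x := (u, q))).2 (Ne.symm hne), collapse_mk]
      dsimp only at h1 h2
      rw [h2]
      exact ((ht w).1 u h1).symm
  rintro p q ⟨hne, x, y, h, rfl, rfl⟩
  by_cases hx : x.1 = v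
  · exact key x y h hx
  · by_cases hy : y.1 = v
    · exact (key y x h.symm hy).symm
    · exact absurd ((collapse_eq_zero_iff.2 hx).trans (collapse_eq_zero_iff.2 hy).symm) hne

/-- Distinct neighbours of `v` use distinct ports, so at most one edge leaves the copy of `v` at any
given vertex. -/
lemma contractsInjectively_collapse (ht : IsAttachment G t) (hH : H ≤ inflate G t) (v : V) :
    ContractsInjectively (collapse v) H := by
  have key : ∀ x y y', H.Adj x y → H.Adj x y' → x.1 = v → y.1 ≠ v → y'.1 ≠ v → y = y' := by
    rintro ⟨w, p⟩ ⟨u, q⟩ ⟨u', q'⟩ h h' rfl hu hu'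
    obtain ⟨h1, h2, h3⟩ := inflate_adj_of_fst_ne (hH h) hu.symm
    obtain ⟨h1', h2', h3'⟩ := inflate_adj_of_fst_ne (hH h') hu'.symm
    dsimp only at *
    obtain rfl := (ht w).2 h1 h1' (h2.symm.trans h2')
    rw [h3, h3']
  intro x y x' y' h h' hne hx hy
  by_cases hx0 : collapse v x = 0
  · have hy0 : collapse v y ≠ 0 := fun h0 => hne (hx0.trans h0.symm)
    have hyy : y = y' := eq_of_collapse_eq hy (hy ▸ hy0)
    subst hyy
    exact ⟨key y x x' h.symm h'.symm (fst_eq_of_collapse_ne hy0) (collapse_eq_zero_iff.1 hx0)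
      (collapse_eq_zero_iff.1 (hx.symm.trans hx0)), rfl⟩
  · have hxx : x = x' := eq_of_collapse_eq hx (hx ▸ hx0)
    subst hxx
    refine ⟨rfl, ?_⟩
    by_cases hy0 : collapse v y = 0
    · exact key x y y' h h' (fst_eq_of_collapse_ne hx0) (collapse_eq_zero_iff.1 hy0)
        (collapse_eq_zero_iff.1 (hy.symm.trans hy0))
    · exact eq_of_collapse_eq hy (hy ▸ hy0)

lemma card_pVert : Nat.card PVert = 9 := by
  rw [Nat.card_eq_fintype_card]
  rfl

lemma ncard_preimage_fst (S : Set V) :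
    ((Prod.fst : V × PVert → V) ⁻¹' S).ncard = S.ncard * 9 := by
  have : (Prod.fst : V × PVert → V) ⁻¹' S = S ×ˢ Set.univ := by
    ext; simp
  rw [this, Set.ncard_prod, Set.ncard_univ, card_pVert]

lemma preimage_collapse_eq {v : V} {S : Set (Fin 10)} (h0 : (0 : Fin 10) ∉ S) :
    collapse v ⁻¹' S = (Prod.mk v) '' (Subtype.val ⁻¹' S : Set PVert) := by
  ext x
  simp only [Set.mem_preimage, Set.mem_image]
  constructor
  · intro h
    have hx : collapse v x ≠ 0 := fun e => h0 (e ▸ h)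
    exact ⟨⟨_, hx⟩, h, (eq_mk_of_collapse_eq rfl).symm⟩
  · rintro ⟨p, hp, rfl⟩
    rwa [collapse_mk]

lemma ncard_preimage_collapse {v : V} {S : Set (Fin 10)} (h0 : (0 : Fin 10) ∉ S) :
    (collapse v ⁻¹' S).ncard = S.ncard := by
  rw [preimage_collapse_eq h0, Set.ncard_image_of_injective _ (Prod.mk_right_injective v),
    ← Set.ncard_image_of_injective _ Subtype.val_injective]
  congr 1
  ext x
  simp only [Set.mem_image, Set.mem_preimage, Subtype.exists, exists_and_right, exists_eq_right]
  exact ⟨fun h => h.2, fun h => ⟨fun e => h0 (e ▸ h), h⟩⟩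

/-- Fibres have nine vertices, so a set and its preimage have sizes of the same parity. -/
lemma isSolid_contract_fst (hs : H.IsSolid) (hH : H ≤ inflate G t) :
    (contract Prod.fst H).IsSolid := by
  intro S
  rw [(contractsInjectively_fst hH).ncard_outDarts, outDarts_contract_eq_empty_iff]
  refine ⟨(hs _).1, fun h => ?_⟩
  have := (hs _).2 h
  rw [ncard_preimage_fst, Nat.even_mul] at this
  exact this.resolve_right (by decide)

/-- A set that avoids `0` has as many elements as its preimage. A set that contains `0` is handled
through its complement, since 10 is even. -/
lemma isSolid_contract_collapse (hs : H.IsSolid) (ht : IsAttachment G t) (hH : H ≤ inflate G t)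
    (v : V) : (contract (collapse v) H).IsSolid := by
  have key : ∀ S : Set (Fin 10), (0 : Fin 10) ∉ S →
      (contract (collapse v) H).outDarts S = ∅ → Even S.ncard := by
    intro S h0 h
    rw [outDarts_contract_eq_empty_iff] at h
    rw [← ncard_preimage_collapse (v := v) h0]
    exact (hs _).2 h
  intro S
  refine ⟨?_, fun h => ?_⟩
  · rw [(contractsInjectively_collapse ht hH v).ncard_outDarts]
    exact (hs _).1
  · by_cases h0 : (0 : Fin 10) ∈ S
    · have h1 := key Sᶜ (by simpa using h0) (outDarts_compl_eq_empty h)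
      have h2 := Set.ncard_add_ncard_compl S
      rw [Nat.card_eq_fintype_card, Fintype.card_fin] at h2
      have h3 : Even (S.ncard + Sᶜ.ncard) := by rw [h2]; decide
      exact (Nat.even_add.1 h3).2 h1
    · exact key S h0 h

/-- Otherwise the collapse onto the copy of `v` would be a connected spanning subgraph of the
Petersen graph with even degrees. -/
lemma exists_odd_neighborSet_of_isSolid [Finite V] (hs : H.IsSolid) (ht : IsAttachment G t)
    (hH : H ≤ inflate G t) (v : V) : ∃ p, ¬ Even (H.neighborSet (v, p)).ncard := by
  by_contra! hev
  have hle := contract_collapse_le ht hH v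
  refine petersen_not_even_of_cutConnected hle (fun p => ?_)
    ((isSolid_contract_collapse hs ht hH v).cutConnected_of_le_petersen hle)
  have hev' : ∀ x : V × PVert, x.1 = v → Even (H.neighborSet x).ncard := by
    rintro ⟨_, p⟩ rfl
    exact hev p
  by_cases hp : p = 0
  · subst hp
    -- The degree of `0` is the number of edges that leave the copy of `v`, so its parity follows
    -- from the degrees inside the copy.
    rw [← ncard_outDarts_singleton, ← ncard_outDarts_compl,
      (contractsInjectively_collapse ht hH v).ncard_outDarts]
    exact even_ncard_outDarts _ _ fun x hx => hev' x (fst_eq_of_collapse_ne hx)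
  · exact (contractsInjectively_collapse ht hH v).even_ncard_neighborSet p
      fun x hx => hev' x (fst_eq_of_collapse_ne (hx ▸ hp))

lemma encard_neighborSet_le_three (ht : IsAttachment G t) (v : V) :
    (G.neighborSet v).encard ≤ 3 := by
  have h := (ht v).2.encard_image
  rw [← h, ← Subtype.val_injective.encard_image]
  refine (Set.encard_le_encard (t := petersen.neighborSet 0) ?_).trans ?_
  · rintro _ ⟨_, ⟨u, hu, rfl⟩, rfl⟩
    exact (ht v).1 u hu
  · rw [← Set.Finite.cast_ncard_eq (Set.toFinite _), petersen_neighborSet_ncard]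
    rfl

lemma ncard_outDarts_fiber_le [Finite V] (ht : IsAttachment G t) (hH : H ≤ inflate G t) (v : V) :
    (H.outDarts (Prod.fst ⁻¹' {v})).ncard ≤ 3 := by
  rw [← (contractsInjectively_fst hH).ncard_outDarts, ncard_outDarts_singleton]
  have hsub : (contract Prod.fst H).neighborSet v ⊆ G.neighborSet v :=
    fun u hu => contract_fst_le hH hu
  have h := (Set.encard_le_encard hsub).trans (encard_neighborSet_le_three ht v)
  rw [← Set.Finite.cast_ncard_eq (Set.toFinite _)] at h
  exact_mod_cast h

/-- If the fibre of `v` is split by `T` such that no edge inside the fibre crosses, then one part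
is empty. -/
lemma fiber_subset_or_disjoint [Finite V] (hs : H.IsSolid) (ht : IsAttachment G t)
    (hH : H ≤ inflate G t) (v : V) (T : Set (V × PVert))
    (hT : ∀ p q, H.Adj (v, p) (v, q) → (v, p) ∈ T → (v, q) ∈ T) :
    (∀ p, (v, p) ∈ T) ∨ ∀ p, (v, p) ∉ T := by
  set F : Set (V × PVert) := Prod.fst ⁻¹' {v} with hF
  have hsub : ∀ A B : Set (V × PVert), A ∪ B = F → A ∩ B = ∅ →
      (∀ p q, H.Adj (v, p) (v, q) → (v, p) ∈ A → (v, q) ∈ A) →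
      H.outDarts A ⊆ H.outDarts F ∧ Disjoint (H.outDarts A) (H.outDarts B) := by
    intro A B hAB hdis hA
    have hAF : ∀ x ∈ A, x.1 = v := fun x hx => by
      have : x ∈ F := hAB ▸ Or.inl hx
      simpa [hF] using this
    refine ⟨?_, ?_⟩
    · rintro ⟨⟨x, p⟩, ⟨y, q⟩⟩ ⟨h, hx, hy⟩
      have hx' := hAF _ hx
      dsimp only at hx' hx hy h
      subst hx'
      refine ⟨h, by simp [hF], ?_⟩
      intro hyF
      simp only [hF, Set.mem_preimage, Set.mem_singleton_iff] at hyF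
      subst hyF
      exact hy (hA p q h hx)
    · rw [Set.disjoint_left]
      rintro ⟨x, y⟩ ⟨h, hx, hy⟩ ⟨-, hx', -⟩
      have : x ∈ A ∩ B := ⟨hx, hx'⟩
      rw [hdis] at this
      exact this
  have hT' : ∀ p q, H.Adj (v, p) (v, q) → (v, p) ∈ F \ T → (v, q) ∈ F \ T := by
    rintro p q h ⟨-, hp⟩
    exact ⟨by simp [hF], fun hq => hp (hT q p h.symm hq)⟩
  have hTT : ∀ p q, H.Adj (v, p) (v, q) → (v, p) ∈ F ∩ T → (v, q) ∈ F ∩ T := by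
    rintro p q h ⟨-, hp⟩
    exact ⟨by simp [hF], hT p q h hp⟩
  obtain ⟨hA, hd⟩ := hsub (F ∩ T) (F \ T) (Set.inter_union_sdiff F T)
    (Set.disjoint_iff_inter_eq_empty.1 Set.disjoint_sdiff_inter.symm) hTT
  obtain ⟨hB, -⟩ := hsub (F \ T) (F ∩ T) (Set.sdiff_union_inter F T)
    (Set.disjoint_iff_inter_eq_empty.1 Set.disjoint_sdiff_inter) hT'
  have hle : (H.outDarts (F ∩ T)).ncard + (H.outDarts (F \ T)).ncard ≤ 3 := by
    rw [← Set.ncard_union_eq hd (Set.toFinite _) (Set.toFinite _)]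
    exact (Set.ncard_le_ncard (Set.union_subset hA hB) (Set.toFinite _)).trans
      (ncard_outDarts_fiber_le ht hH v)
  have hcc := (isSolid_contract_collapse hs ht hH v).cutConnected_of_le_petersen
    (contract_collapse_le ht hH v)
  -- A part with empty cut stays a union of components in the collapse, where it misses `0`; as the
  -- collapse is connected, the part is empty.
  have hend : ∀ A : Set (V × PVert), A ⊆ F → H.outDarts A = ∅ → A = ∅ := by
    intro A hAF hA
    have hpre : collapse v ⁻¹' (collapse v '' A) = A := by
      refine Set.Subset.antisymm ?_ (Set.subset_preimage_image _ _)
      rintro x ⟨y, hy, hxy⟩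
      have h0 : collapse v y ≠ 0 := fun e => collapse_eq_zero_iff.1 e (by simpa [hF] using hAF hy)
      rwa [eq_of_collapse_eq hxy.symm (hxy ▸ h0)]
    rw [← hpre, ← outDarts_contract_eq_empty_iff] at hA
    rcases hcc _ hA with h | h
    · simpa using h
    · have : (0 : Fin 10) ∈ collapse v '' A := h ▸ Set.mem_univ _
      obtain ⟨y, hy, hy0⟩ := this
      exact absurd (by simpa [hF] using hAF hy) (collapse_eq_zero_iff.1 hy0)
  -- The cuts of the two parts share the at most three edges that leave the fibre, and neither cut
  -- has exactly one edge; so one of them is empty.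
  have h1 := (hs (F ∩ T)).1
  have h2 := (hs (F \ T)).1
  have h3 : (H.outDarts (F ∩ T)).ncard = 0 ∨ (H.outDarts (F \ T)).ncard = 0 := by omega
  rw [Set.ncard_eq_zero, Set.ncard_eq_zero] at h3
  rcases h3 with h3 | h3
  · right
    intro p hp
    have : (v, p) ∈ F ∩ T := ⟨by simp [hF], hp⟩
    rw [hend _ Set.inter_subset_left h3] at this
    exact this
  · left
    intro p
    by_contra hp
    have : (v, p) ∈ F \ T := ⟨by simp [hF], hp⟩
    rw [hend _ Set.sdiff_subset h3] at this
    exact this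

/-- A union of components does not split any fibre, so it is the preimage of a union of components
of the contraction. -/
lemma SimpleGraph.IsSolid.cutConnected_of_le_inflate [Finite V] (hs : H.IsSolid)
    (ht : IsAttachment G t) (hH : H ≤ inflate G t)
    (hc : (contract Prod.fst H).CutConnected) : H.CutConnected := by
  intro S hS
  have hfib := fun v => fiber_subset_or_disjoint hs ht hH v S
    fun p q h hp => outDarts_eq_empty_iff.1 hS _ _ h hp
  have hpre : Prod.fst ⁻¹' (Prod.fst '' S) = S := by
    refine Set.Subset.antisymm ?_ (Set.subset_preimage_image _ _)
    rintro ⟨v, p⟩ ⟨⟨_, q⟩, hq, rfl⟩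
    exact (hfib _).resolve_right (fun h => h q hq) p
  rw [← hpre, ← outDarts_contract_eq_empty_iff] at hS
  rcases hc _ hS with h | h
  · left; simpa using h
  · right; rw [← hpre, h]; rfl

end Inflate

/-! ### The iterated Petersen graph -/

lemma finite_iterVert : ∀ k, Finite (IterVert k)
  | 0 => inferInstanceAs (Finite (Fin 10))
  | k + 1 => by
    have := finite_iterVert k
    exact inferInstanceAs (Finite (IterVert k × PVert))

instance (k : ℕ) : Finite (IterVert k) := finite_iterVert k

lemma SimpleGraph.IsSolid.cutConnected_of_isIteratedPetersen : ∀ {k : ℕ}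
    {Q H : SimpleGraph (IterVert k)}, H.IsSolid → IsIteratedPetersen k Q → H ≤ Q → H.CutConnected
  | 0, Q, H, hs, hQ, hle => by
    have hQ' : Q = petersen := hQ
    subst hQ'
    exact hs.cutConnected_of_le_petersen hle
  | k + 1, Q, H, hs, ⟨G, t, hG, ht, hQ⟩, hle => by
    subst hQ
    exact hs.cutConnected_of_le_inflate ht hle
      ((isSolid_contract_fst hs hle).cutConnected_of_isIteratedPetersen hG (contract_fst_le hle))

/-- The vertex of the Petersen graph from which a vertex of an iterated Petersen graph arises. -/
def rootVertex : (k : ℕ) → IterVert k → Fin 10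
  | 0, v => v
  | k + 1, x => rootVertex k x.1

/-- Contracting repeatedly preserves even degrees and ends in the Petersen graph. Only cuts along
root fibres matter there, so `D` may miss many vertices; this allows it to be the image of a circuit
of a frame. -/
lemma not_even_of_rootVertex : ∀ {k : ℕ} {Q D : SimpleGraph (IterVert k)},
    IsIteratedPetersen k Q → D ≤ Q → (∀ v, Even (D.neighborSet v).ncard) →
    (∀ S : Set (Fin 10), D.outDarts (rootVertex k ⁻¹' S) = ∅ → S = ∅ ∨ S = Set.univ) → False
  | 0, Q, D, hQ, hle, he, hc => by
    have hQ' : Q = petersen := hQ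
    subst hQ'
    exact petersen_not_even_of_cutConnected hle he hc
  | k + 1, Q, D, ⟨G, t, hG, ht, hQ⟩, hle, he, hc => by
    subst hQ
    refine not_even_of_rootVertex hG (contract_fst_le hle)
      (fun v => (contractsInjectively_fst hle).even_ncard_neighborSet v fun x _ => he x)
      fun S hS => hc S ?_
    exact (outDarts_contract_eq_empty_iff Prod.fst D _).1 hS

/-! ### Connectivity of multigraphs -/

namespace Graph

variable {α β : Type*}

/-- Phrasing connectedness by closed sets makes it directly comparable with empty edge cuts of the
subdivision. -/
lemma isConnected_iff_forall_closed {K : Graph α β} : K.IsConnected ↔ V(K).Nonempty ∧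
    ∀ S : Set α, (∀ e x y, K.IsLink e x y → x ∈ S → y ∈ S) →
      ∀ x ∈ V(K), ∀ y ∈ V(K), x ∈ S → y ∈ S := by
  constructor
  · intro h
    have hc : K.toSimpleGraph.Connected := h
    refine ⟨Set.nonempty_coe_sort.1 hc.nonempty, fun S hS x hx y hy hxS => ?_⟩
    obtain ⟨p⟩ := hc.preconnected ⟨x, hx⟩ ⟨y, hy⟩
    have key : ∀ (u v : V(K)) (p : K.toSimpleGraph.Walk u v), (u : α) ∈ S → (v : α) ∈ S := by
      intro u v p
      induction p with
      | nil => exact id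
      | cons h _ ih =>
        obtain ⟨-, e, he⟩ := h
        exact fun hu => ih (hS e _ _ he hu)
    exact key _ _ p hxS
  · rintro ⟨hne, h⟩
    have := hne.to_subtype
    refine (SimpleGraph.connected_iff _).2 ⟨?_, this⟩
    rintro ⟨x, hx⟩ ⟨y, hy⟩
    refine (h {z | ∃ hz : z ∈ V(K), K.toSimpleGraph.Reachable ⟨x, hx⟩ ⟨z, hz⟩} ?_
      x hx y hy ⟨hx, SimpleGraph.Reachable.refl _⟩).2
    · rintro e u v huv ⟨hu, hr⟩
      refine ⟨huv.right_mem, ?_⟩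
      by_cases huv' : u = v
      · subst huv'
        exact hr
      · refine hr.trans (SimpleGraph.Adj.reachable ⟨?_, e, huv⟩)
        exact fun h => huv' (congrArg Subtype.val h)

lemma exists_isComponentOf (G : Graph α β) {x : α} (hx : x ∈ V(G)) :
    ∃ K : Graph α β, K.IsComponentOf G ∧ x ∈ V(K) := by
  set R : Set α := {y | Relation.ReflTransGen G.Adj x y} with hR
  have hRV : R ⊆ V(G) := by
    intro y hy
    rcases Relation.ReflTransGen.cases_tail hy with h | ⟨z, -, h⟩
    · exact h ▸ hx
    · exact h.right_mem
  have hcl : ∀ e y z, G.IsLink e y z → y ∈ R → z ∈ R := fun e y z h hy =>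
    Relation.ReflTransGen.tail hy ⟨e, h⟩
  have hxR : x ∈ R := Relation.ReflTransGen.refl
  refine ⟨G.induce R, ⟨IsClosedSubgraph.mk' (induce_le hRV) ?_, ?_⟩, hxR⟩
  · rintro e y ⟨z, h⟩ hy
    exact ⟨y, z, h, hy, hcl e y z h hy⟩
  · rw [isConnected_iff_forall_closed]
    refine ⟨⟨x, hxR⟩, fun S hS y hy z hz hyS => ?_⟩
    have h1 : ∀ w, Relation.ReflTransGen G.Adj x w → (w ∈ S ↔ x ∈ S) := by
      intro w hw
      induction hw with
      | refl => rfl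
      | tail hb hbc ih =>
        obtain ⟨e, he⟩ := hbc
        rw [← ih]
        have hc := hcl e _ _ he hb
        exact ⟨hS e _ _ ⟨he.symm, hc, hb⟩, hS e _ _ ⟨he, hb, hc⟩⟩
    exact (h1 z hz).2 ((h1 y hy).1 hyS)

end Graph

namespace SimpleGraph

variable {V : Type*} {H : SimpleGraph V}

lemma Walk.mem_iff_of_mem_support {u v : V} (p : H.Walk u v) (S : Set V)
    (h : ∀ x y, s(x, y) ∈ p.edges → x ∈ S → y ∈ S) : ∀ w ∈ p.support, w ∈ S ↔ u ∈ S := by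
  induction p with
  | nil => simp
  | @cons a b c hab q ih =>
    have hq := ih fun x y hxy => h x y (by simp [hxy])
    intro w hw
    rw [Walk.support_cons, List.mem_cons] at hw
    rcases hw with rfl | hw
    · rfl
    · rw [hq w hw]
      exact ⟨h b a (by simp [Sym2.eq_swap]), h a b (by simp)⟩

/-- Before and after its only crossing of the cut, the walk stays on one side. -/
lemma Walk.not_mem_iff_of_crosses_once {u v : V} (p : H.Walk u v) (hp : p.edges.Nodup) (S : Set V)
    {a b : V} (ha : a ∈ S) (hb : b ∉ S) (hab : s(a, b) ∈ p.edges)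
    (h : ∀ x y, s(x, y) ∈ p.edges → s(x, y) ≠ s(a, b) → x ∈ S → y ∈ S) :
    ¬ (u ∈ S ↔ v ∈ S) := by
  induction p with
  | nil => simp at hab
  | @cons x y z hxy q ih =>
    rw [Walk.edges_cons, List.nodup_cons] at hp
    have hq : ∀ x y, s(x, y) ∈ q.edges → s(x, y) ≠ s(a, b) → x ∈ S → y ∈ S :=
      fun x y hxy => h x y (by simp [hxy])
    by_cases hab' : s(x, y) = s(a, b)
    · have h1 := q.mem_iff_of_mem_support S
        (fun x' y' hxy' => hq x' y' hxy' fun e => hp.1 (by rwa [hab', ← e])) z q.end_mem_support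
      rw [h1]
      rcases Sym2.eq_iff.1 hab' with ⟨rfl, rfl⟩ | ⟨rfl, rfl⟩ <;> tauto
    · have h1 := ih hp.2 (by simpa [Ne.symm hab'] using hab) hq
      have h2 : x ∈ S ↔ y ∈ S := ⟨h x y (by simp) hab',
        h y x (by simp [Sym2.eq_swap]) (by rwa [Sym2.eq_swap])⟩
      rwa [h2]

lemma even_ncard_of_outDarts_eq_empty [Finite V]
    (hH : ∀ c : H.ConnectedComponent, Even c.supp.ncard)
    {S : Set V} (hS : H.outDarts S = ∅) : Even S.ncard := by
  classical
  have := Fintype.ofFinite V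
  rw [outDarts_eq_empty_iff] at hS
  have hcl : ∀ x y, H.Reachable x y → x ∈ S → y ∈ S := by
    rintro x y ⟨p⟩ hx
    exact (p.mem_iff_of_mem_support S (fun a b hab => hS a b (p.adj_of_mem_edges hab)) y
      p.end_mem_support).2 hx
  rw [Set.ncard_eq_toFinset_card',
    Finset.card_eq_sum_card_fiberwise (f := H.connectedComponentMk) (t := Finset.univ) (by simp)]
  refine Finset.even_sum _ fun c _ => ?_
  by_cases hc : ∃ x ∈ S, H.connectedComponentMk x = c
  · obtain ⟨x, hx, rfl⟩ := hc
    have h := hH (H.connectedComponentMk x)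
    rw [Set.ncard_eq_toFinset_card'] at h
    refine (congrArg (fun s : Finset V => Even s.card) ?_).mpr h
    ext y
    simp only [Finset.mem_filter, Set.mem_toFinset, ConnectedComponent.mem_supp_iff,
      and_iff_right_iff_imp]
    exact fun hy => hcl x y (ConnectedComponent.exact hy).symm hx
  · convert Even.zero
    rw [Finset.card_eq_zero, Finset.filter_eq_empty_iff]
    intro x hx hxc
    exact hc ⟨x, by simpa using hx, hxc⟩

end SimpleGraph

/-! ### Subdivisions -/

namespace Subdivision

variable {V α β : Type*} {H : SimpleGraph V} {F : Graph α β} (σ : Subdivision H F)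

lemma isTrail (e : E(F)) : (σ.walk e).IsTrail := by
  by_cases h : σ.src e = σ.tgt e
  · obtain ⟨h', hc⟩ := σ.isCycle e h
    have := hc.isTrail
    rwa [Walk.isTrail_copy] at this
  · exact (σ.isPath e h).isTrail

lemma exists_mem_edges (e : E(F)) : ∃ a ∈ (σ.walk e).edges, σ.branch (σ.src e) ∈ a := by
  have hnil : ¬ (σ.walk e).Nil := by
    by_cases h : σ.src e = σ.tgt e
    · obtain ⟨h', hc⟩ := σ.isCycle e h
      have := hc.not_nil
      rwa [Walk.nil_copy] at this
    · intro hn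
      exact h (σ.branch_injective hn.eq)
  obtain ⟨w, hw, q, hq⟩ := Walk.not_nil_iff.1 hnil
  exact ⟨s(σ.branch (σ.src e), w), by rw [hq]; simp, by simp⟩

lemma finite_edgeSet (σ : Subdivision H F) [Finite V] : Finite E(F) := by
  choose f hf hf' using σ.exists_mem_edges
  refine Finite.of_injective f fun e e' h => ?_
  by_contra hne
  exact σ.edges_disjoint e e' hne (hf e) (h ▸ hf e')

/-- The union of the walks that replace the edges in `A`. -/
def union (A : Set β) : SimpleGraph V where
  Adj x y := ∃ e : E(F), (e : β) ∈ A ∧ s(x, y) ∈ (σ.walk e).edges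
  symm := ⟨fun _ _ ⟨e, he, h⟩ => ⟨e, he, by rwa [Sym2.eq_swap]⟩⟩
  loopless := ⟨fun _ ⟨e, _, h⟩ => ((σ.walk e).adj_of_mem_edges h).ne rfl⟩

lemma union_le (A : Set β) : σ.union A ≤ H := fun _ _ ⟨e, _, h⟩ => (σ.walk e).adj_of_mem_edges h

lemma union_edgeSet : σ.union E(F) = H := by
  refine le_antisymm (σ.union_le _) fun x y h => ?_
  obtain ⟨e, he⟩ := σ.cover_edges s(x, y) h
  exact ⟨e, e.2, he⟩

lemma mem_iff_of_union_outDarts {A : Set β} {S : Set V} (hS : (σ.union A).outDarts S = ∅)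
    {e : E(F)} (he : (e : β) ∈ A) :
    ∀ w ∈ (σ.walk e).support, w ∈ S ↔ σ.branch (σ.src e) ∈ S :=
  (σ.walk e).mem_iff_of_mem_support S fun x y hxy =>
    outDarts_eq_empty_iff.1 hS x y ⟨e, he, hxy⟩

lemma eq_of_mem_support_of_not_branch {v : V} (hv : v ∉ Set.range σ.branch) {e e' : E(F)}
    (h : v ∈ (σ.walk e).support) (h' : v ∈ (σ.walk e').support) : e = e' := by
  by_contra hne
  exact hv (σ.support_inter e e' hne v h h')

open Classical in
-- The walks are pairwise edge-disjoint trails, so every edge at `v` is counted exactly once.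
lemma ncard_neighborSet_union [Finite V] [Fintype E(F)] (A : Set β) (v : V) :
    ((σ.union A).neighborSet v).ncard =
      ∑ e ∈ Finset.univ.filter (fun e : E(F) => (e : β) ∈ A), (σ.walk e).edges.countP (v ∈ ·) := by
  have hinj : Function.Injective fun w : V => s(v, w) := fun a b h => Sym2.congr_right.1 h
  rw [← Set.ncard_image_of_injective _ hinj]
  have himg : (fun w : V => s(v, w)) '' (σ.union A).neighborSet v =
      (((Finset.univ.filter fun e : E(F) => (e : β) ∈ A).biUnion
        fun e => ((σ.walk e).edges.filter (v ∈ ·)).toFinset : Finset (Sym2 V)) : Set (Sym2 V)) := by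
    ext a
    simp only [Set.mem_image, mem_neighborSet, Finset.coe_biUnion, Finset.coe_filter,
      Finset.mem_univ, true_and, Set.mem_iUnion, List.coe_toFinset, Set.mem_ofPred_eq,
      List.mem_filter, decide_eq_true_eq, exists_prop]
    constructor
    · rintro ⟨w, ⟨e, he, hw⟩, rfl⟩
      exact ⟨e, he, hw, by simp⟩
    · rintro ⟨e, he, ha, hva⟩
      obtain ⟨w, rfl⟩ := hva
      exact ⟨w, ⟨e, he, ha⟩, rfl⟩
  rw [himg, Set.ncard_coe_finset, Finset.card_biUnion]
  · refine Finset.sum_congr rfl fun e _ => ?_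
    rw [List.toFinset_card_of_nodup ((σ.isTrail e).edges_nodup.filter _),
      List.countP_eq_length_filter]
  · intro e _ e' _ hne
    rw [Function.onFun, Finset.disjoint_left]
    intro a ha ha'
    simp only [List.mem_toFinset, List.mem_filter] at ha ha'
    exact σ.edges_disjoint e e' hne ha.1 ha'.1

/-- A trail uses an even number of edges at every vertex, except at its two ends if these differ. -/
lemma odd_countP_iff [DecidableEq V] (e : E(F)) (v : V) :
    Odd ((σ.walk e).edges.countP (v ∈ ·)) ↔
      σ.src e ≠ σ.tgt e ∧ (v = σ.branch (σ.src e) ∨ v = σ.branch (σ.tgt e)) := by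
  rw [← Nat.not_even_iff_odd, (σ.isTrail e).even_countP_edges_iff v,
    σ.branch_injective.ne_iff]
  tauto

open Classical in
lemma even_ncard_neighborSet_union_iff [Finite V] [Fintype E(F)] (A : Set β) (v : V) :
    Even ((σ.union A).neighborSet v).ncard ↔
      Even {e : E(F) | (e : β) ∈ A ∧ σ.src e ≠ σ.tgt e ∧
        (v = σ.branch (σ.src e) ∨ v = σ.branch (σ.tgt e))}.ncard := by
  rw [ncard_neighborSet_union, Finset.even_sum_iff_even_card_odd, ← Set.ncard_coe_finset]
  simp only [odd_countP_iff, Finset.filter_filter]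
  simp

lemma even_ncard_neighborSet_union_of_not_branch [Finite V] (A : Set β) {v : V}
    (hv : v ∉ Set.range σ.branch) : Even ((σ.union A).neighborSet v).ncard := by
  have := σ.finite_edgeSet
  have := Fintype.ofFinite E(F)
  rw [even_ncard_neighborSet_union_iff]
  rw [Set.eq_empty_of_forall_notMem (s := {e : E(F) | _})]
  · simp
  · rintro e ⟨-, -, rfl | rfl⟩ <;> exact hv ⟨_, rfl⟩

lemma isNonloopAt_iff (e : E(F)) (x : V(F)) : F.IsNonloopAt e x ↔
    σ.src e ≠ σ.tgt e ∧ (x = σ.src e ∨ x = σ.tgt e) := by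
  have hl := σ.isLink e
  constructor
  · rintro ⟨y, hyx, h⟩
    have := h.isLink_iff_sym2_eq.1 hl
    rcases Sym2.eq_iff.1 this with ⟨h1, h2⟩ | ⟨h1, h2⟩
    · refine ⟨fun he => hyx ?_, Or.inl (Subtype.ext h1)⟩
      rw [h1, h2, he]
    · refine ⟨fun he => hyx ?_, Or.inr (Subtype.ext h1)⟩
      rw [h1, h2, he]
  · rintro ⟨hne, rfl | rfl⟩
    · exact ⟨_, fun h => hne (Subtype.ext h.symm), hl⟩
    · exact ⟨_, fun h => hne (Subtype.ext h), hl.symm⟩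

/-- Loops count twice in the degree 2, so the number of nonloop edges of the circuit at any of its
vertices is 0 or 2. Vertices other than branch vertices are passed through. -/
lemma even_ncard_neighborSet_union_of_circuit [Finite V] {C : Graph α β} (hC : C ≤ F)
    (hreg : C.IsRegularOfDeg 2) (v : V) : Even ((σ.union E(C)).neighborSet v).ncard := by
  by_cases hv : v ∈ Set.range σ.branch
  swap
  · exact σ.even_ncard_neighborSet_union_of_not_branch _ hv
  obtain ⟨x, rfl⟩ := hv
  have := σ.finite_edgeSet
  have := Fintype.ofFinite E(F)
  rw [even_ncard_neighborSet_union_iff]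
  have himg : Subtype.val '' {e : E(F) | (e : β) ∈ E(C) ∧ σ.src e ≠ σ.tgt e ∧
        (σ.branch x = σ.branch (σ.src e) ∨ σ.branch x = σ.branch (σ.tgt e))} =
      C.incidenceSet x \ C.loopSet x := by
    ext e
    simp only [σ.branch_injective.eq_iff, ← σ.isNonloopAt_iff]
    simp only [Set.mem_image, Set.mem_ofPred_eq, Set.mem_sdiff, Graph.mem_incidenceSet,
      Graph.mem_loopSet, ← Graph.isNonloopAt_iff_inc_not_isLoopAt]
    constructor
    · rintro ⟨e, ⟨he, h⟩, rfl⟩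
      exact (hC.isNonloopAt_congr he).2 h
    · intro h
      have h' := h.mono hC
      exact ⟨⟨e, h'.edge_mem⟩, ⟨h.edge_mem, h'⟩, rfl⟩
  rw [← Set.ncard_image_of_injective _ Subtype.val_injective, himg]
  by_cases hx : (x : α) ∈ V(C)
  · have hd := hreg x hx
    unfold Graph.vertexDegree at hd
    have hfin : (C.incidenceSet x).Finite := by
      refine Set.finite_of_encard_le_coe (k := 2) ?_
      exact le_self_add.trans hd.le
    have hsub := C.loopSet_subset_incidenceSet x
    rw [← hfin.cast_ncard_eq, ← (hfin.subset hsub).cast_ncard_eq] at hd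
    have hd' : (C.incidenceSet (x : α)).ncard + (C.loopSet (x : α)).ncard = 2 := by
      exact_mod_cast hd
    have h2 := Set.ncard_sdiff_add_ncard_of_subset hsub hfin
    rw [Nat.even_iff]
    omega
  · rw [Set.eq_empty_of_forall_notMem (s := C.incidenceSet x \ C.loopSet x)]
    · simp
    · rintro e ⟨⟨y, he⟩, -⟩
      exact hx he.left_mem

lemma branch_mem_support_of_inc {e : E(F)} {x : V(F)} (h : F.Inc e x) :
    σ.branch x ∈ (σ.walk e).support := by
  rcases h.eq_or_eq_of_isLink (σ.isLink e) with h | h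
  · rw [Subtype.ext h]
    exact Walk.start_mem_support _
  · rw [Subtype.ext h]
    exact Walk.end_mem_support _

lemma branch_mem_iff_of_isConnected {C : Graph α β} (hC : C ≤ F) (hcon : C.IsConnected)
    {S : Set V} (hS : (σ.union E(C)).outDarts S = ∅) {x y : V(F)} (hx : (x : α) ∈ V(C))
    (hy : (y : α) ∈ V(C)) (hxS : σ.branch x ∈ S) : σ.branch y ∈ S := by
  have h := (Graph.isConnected_iff_forall_closed.1 hcon).2
    {z | ∃ hz : z ∈ V(F), σ.branch ⟨z, hz⟩ ∈ S} ?_ x hx y hy ⟨x.2, hxS⟩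
  · exact h.2
  · rintro e u v huv ⟨hu, huS⟩
    have huv' := huv.mono hC
    refine ⟨huv'.right_mem, ?_⟩
    have h1 := σ.mem_iff_of_union_outDarts hS (e := ⟨e, huv'.edge_mem⟩) huv.edge_mem
    rw [h1 _ (σ.branch_mem_support_of_inc (x := ⟨v, huv'.right_mem⟩) huv'.inc_right)]
    exact (h1 _ (σ.branch_mem_support_of_inc (x := ⟨u, hu⟩) huv'.inc_left)).1 huS

lemma isConnected_of_cutConnected (σ : Subdivision H F) [Nonempty V] (hH : H.CutConnected) :
    F.IsConnected := by
  rw [Graph.isConnected_iff_forall_closed]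
  constructor
  · obtain ⟨v⟩ := ‹Nonempty V›
    rcases σ.cover_vertices v with ⟨x, -⟩ | ⟨e, -⟩
    · exact ⟨x, x.2⟩
    · exact ⟨_, (σ.src e).2⟩
  · intro S hS x hx y hy hxS
    have hst : ∀ e : E(F), ((σ.src e : α) ∈ S ↔ (σ.tgt e : α) ∈ S) := fun e =>
      ⟨hS e _ _ (σ.isLink e), hS e _ _ (σ.isLink e).symm⟩
    have hbr : ∀ (e : E(F)) (z : V(F)), σ.branch z ∈ (σ.walk e).support →
        ((z : α) ∈ S ↔ (σ.src e : α) ∈ S) := by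
      intro e z hz
      rcases σ.branch_mem_support e z hz with rfl | rfl
      · rfl
      · exact (hst e).symm
    -- A closed set of vertices of `F`, together with the walks that start in it, is closed in `H`,
    -- because distinct walks meet only in branch vertices.
    have hcut : H.outDarts {v | (∃ z : V(F), (z : α) ∈ S ∧ σ.branch z = v) ∨
        ∃ e, (σ.src e : α) ∈ S ∧ v ∈ (σ.walk e).support} = ∅ := by
      rw [outDarts_eq_empty_iff]
      intro a b hab ha
      obtain ⟨e', he'⟩ := σ.cover_edges s(a, b) hab
      have ha' := Walk.fst_mem_support_of_mem_edges _ he'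
      refine Or.inr ⟨e', ?_, Walk.snd_mem_support_of_mem_edges _ he'⟩
      rcases ha with ⟨z, hz, rfl⟩ | ⟨e, he, hae⟩
      · exact (hbr e' z ha').1 hz
      · by_cases hee : e = e'
        · exact hee ▸ he
        · obtain ⟨z, rfl⟩ := σ.support_inter e e' hee a hae ha'
          exact (hbr e' z ha').1 ((hbr e z hae).2 he)
    rcases hH _ hcut with h | h
    · exact absurd (show σ.branch ⟨x, hx⟩ ∈ (∅ : Set V) from h ▸ Or.inl ⟨_, hxS, rfl⟩) (by simp)
    · have hy' := h.symm ▸ Set.mem_univ (σ.branch ⟨y, hy⟩)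
      rcases hy' with ⟨z, hz, hzy⟩ | ⟨e, he, hye⟩
      · rw [σ.branch_injective hzy] at hz
        exact hz
      · exact (hbr e ⟨y, hy⟩ hye).2 he

end Subdivision

/-! ### Solidity of subdivided frames, and their position relative to the copies of `P`. -/

namespace Subdivision

variable {V α β : Type*} {H : SimpleGraph V} {F : Graph α β}

/-- Suppose a cut consists of one edge, on the walk of `e` in the component `K`. If `K` is a
circuit, its image has even degrees and crosses the cut evenly. If `K` is 2-connected, then `K - e`
is connected and its image does not cross, so the ends of `e` lie on the same side, although the
walk of `e` crosses once. -/
lemma isSolid (σ : Subdivision H F) [Finite V]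
    (hF : ∀ K : Graph α β, K.IsComponentOf F →
      (K.IsCircuitGraph ∧ Even V(K).ncard) ∨ (K.IsTwoConnected ∧ K.IsCubic))
    (hH : ∀ c : H.ConnectedComponent, Even c.supp.ncard) : H.IsSolid := by
  intro S
  refine ⟨fun h1 => ?_, fun h => even_ncard_of_outDarts_eq_empty hH h⟩
  obtain ⟨⟨a, b⟩, hab⟩ := Set.ncard_eq_one.1 h1
  have habm : (a, b) ∈ H.outDarts S := hab ▸ Set.mem_singleton _
  obtain ⟨hadj, ha, hb⟩ := habm
  have huniq : ∀ x y, H.Adj x y → x ∈ S → y ∉ S → x = a ∧ y = b := by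
    intro x y hxy hx hy
    have : (x, y) ∈ H.outDarts S := ⟨hxy, hx, hy⟩
    rw [hab] at this
    exact Prod.mk.inj this
  obtain ⟨e, he⟩ := σ.cover_edges s(a, b) hadj
  obtain ⟨K, hK, hxK⟩ := F.exists_isComponentOf (σ.src e).2
  have heK : (e : β) ∈ E(K) := hK.1.closed (σ.isLink e).inc_left hxK
  rcases hF K hK with ⟨hcirc, -⟩ | ⟨h2, -⟩
  · have hev := even_ncard_outDarts (σ.union E(K)) S fun v _ =>
      σ.even_ncard_neighborSet_union_of_circuit hK.1.le hcirc.2.2 v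
    have : (σ.union E(K)).outDarts S = {(a, b)} := by
      refine Set.Subset.antisymm ?_ ?_
      · rintro ⟨x, y⟩ ⟨hxy, hx, hy⟩
        obtain ⟨rfl, rfl⟩ := huniq x y (σ.union_le _ hxy) hx hy
        rfl
      · rintro _ rfl
        exact ⟨⟨e, heK, he⟩, ha, hb⟩
    rw [this, Set.ncard_singleton] at hev
    exact absurd hev (by decide)
  · have hcon := (Graph.isConnected_iff_forall_closed.1 (h2.2.2.2 e heK)).2
      {z | ∃ hz : z ∈ V(F), σ.branch ⟨z, hz⟩ ∈ S} ?_
    · have hlK : K.IsLink e (σ.src e) (σ.tgt e) := (hK.1.isLink_congr hxK).2 (σ.isLink e)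
      have hmem : ∀ x ∈ V(K), x ∈ V(K.deleteEdges {(e : β)}) := fun x hx => hx
      refine (σ.walk e).not_mem_iff_of_crosses_once (σ.isTrail e).edges_nodup S ha hb he ?_ ⟨?_, ?_⟩
      · intro x y hxy hne hx
        by_contra hy
        obtain ⟨rfl, rfl⟩ := huniq x y ((σ.walk e).adj_of_mem_edges hxy) hx hy
        exact hne rfl
      · intro h
        exact (hcon _ (hmem _ hlK.left_mem) _ (hmem _ hlK.right_mem) ⟨Subtype.prop _, h⟩).2
      · intro h
        exact (hcon _ (hmem _ hlK.right_mem) _ (hmem _ hlK.left_mem) ⟨Subtype.prop _, h⟩).2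
    · rintro e' x y hxy ⟨hx, hxS⟩
      rw [Graph.deleteEdges_isLink] at hxy
      obtain ⟨hxy, hne⟩ := hxy
      have hxy' := hxy.mono hK.1.le
      refine ⟨hxy'.right_mem, ?_⟩
      have hne' : (⟨e', hxy'.edge_mem⟩ : E(F)) ≠ e := fun h => hne (congrArg Subtype.val h)
      have h1 := (σ.walk ⟨e', hxy'.edge_mem⟩).mem_iff_of_mem_support S ?_
      · rw [h1 _ (σ.branch_mem_support_of_inc (x := ⟨y, hxy'.right_mem⟩) hxy'.inc_right)]
        exact (h1 _ (σ.branch_mem_support_of_inc (x := ⟨x, hx⟩) hxy'.inc_left)).1 hxS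
      · intro u v huv hu
        by_contra hv
        obtain ⟨rfl, rfl⟩ := huniq u v (Walk.adj_of_mem_edges _ huv) hu hv
        exact σ.edges_disjoint _ _ hne' huv he

/-- If the walk of `e` met a third copy of `P`, it would have no branch vertex there; as `H` does
not split the copy, the walk would contain all of it. All degrees in the copy would then be even,
against `exists_odd_neighborSet_of_isSolid`. -/
lemma fst_branch_eq_or_adj {V : Type*} [Finite V] {G : SimpleGraph V} {t : V → V → PVert}
    {H : SimpleGraph (V × PVert)} (σ : Subdivision H F) (hs : H.IsSolid) (ht : IsAttachment G t)
    (hH : H ≤ inflate G t) (e : E(F)) :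
    (σ.branch (σ.src e)).1 = (σ.branch (σ.tgt e)).1 ∨
      G.Adj (σ.branch (σ.src e)).1 (σ.branch (σ.tgt e)).1 := by
  have key : ∀ w ∈ (σ.walk e).support,
      w.1 = (σ.branch (σ.src e)).1 ∨ w.1 = (σ.branch (σ.tgt e)).1 := by
    by_contra! hcon
    obtain ⟨⟨y, q⟩, hw, hws, hwt⟩ := hcon
    dsimp only at hws hwt
    have hnb : ∀ p, (y, p) ∈ (σ.walk e).support → (y, p) ∉ Set.range σ.branch := by
      rintro p hp ⟨z, hz⟩
      rcases σ.branch_mem_support e z (hz ▸ hp) with rfl | rfl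
      · exact hws (congrArg Prod.fst hz).symm
      · exact hwt (congrArg Prod.fst hz).symm
    have hall : ∀ p, (y, p) ∈ {x | x ∈ (σ.walk e).support} := by
      refine (fiber_subset_or_disjoint hs ht hH y {x | x ∈ (σ.walk e).support} ?_).resolve_right
        fun h => h q hw
      intro p p' hadj hp
      obtain ⟨e', he'⟩ := σ.cover_edges s((y, p), (y, p')) hadj
      obtain rfl := σ.eq_of_mem_support_of_not_branch (hnb p hp) hp
        (Walk.fst_mem_support_of_mem_edges _ he')
      exact Walk.snd_mem_support_of_mem_edges _ he'
    obtain ⟨p, hp⟩ := exists_odd_neighborSet_of_isSolid hs ht hH y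
    refine hp ?_
    have := σ.even_ncard_neighborSet_union_of_not_branch E(F) (hnb p (hall p))
    rwa [σ.union_edgeSet] at this
  by_cases hne : (σ.branch (σ.tgt e)).1 = (σ.branch (σ.src e)).1
  · exact Or.inl hne.symm
  · right
    -- Where the walk leaves the first copy it must enter the last one, so the two copies are
    -- adjacent.
    obtain ⟨d, hd, h1, h2⟩ := (σ.walk e).exists_boundary_dart
      {x | x.1 = (σ.branch (σ.src e)).1} rfl hne
    have h3 := (key _ (Walk.dart_snd_mem_support_of_mem_darts _ hd)).resolve_left h2
    have h1' : d.fst.1 = (σ.branch (σ.src e)).1 := h1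
    have := (inflate_adj_of_fst_ne (hH d.adj) (fun h => h2 (h.symm.trans h1'))).1
    rwa [h1', h3] at this

end Subdivision

lemma Graph.le_distFrom {α β : Type*} {F C : Graph α β} (f : V(F) → ℕ)
    (hf : ∀ x y : V(F), F.Adj x y → f y ≤ f x + 1) (hC : ∀ c : V(F), (c : α) ∈ V(C) → f c = 0)
    (v : V(F)) : (f v : ℕ∞) ≤ F.distFrom C v := by
  refine le_iInf fun c => le_iInf fun hc => le_iInf fun p => ?_
  have key : ∀ (x y : V(F)) (p : F.toSimpleGraph.Walk x y), f y ≤ f x + p.length := by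
    intro x y p
    induction p with
    | nil => simp
    | cons h p ih =>
      have := hf _ _ h.2
      rw [SimpleGraph.Walk.length_cons]
      omega
  have := key c v p
  rw [hC c hc, zero_add] at this
  exact_mod_cast this

/-! ### Structure of the frames of iterated Petersen graphs, and the lower bound in terms of
potentials. -/

section Frame

variable {α β : Type*} {k : ℕ} {Q : SimpleGraph (IterVert k)} {F C : Graph α β}
  {H : SimpleGraph (IterVert k)}

/-- Otherwise the image of the circuit in the Petersen graph would be a connected spanning subgraph
with even degrees. -/
lemma Subdivision.exists_rootVertex_ne (σ : Subdivision H F) (hQ : IsIteratedPetersen k Q)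
    (hH : H ≤ Q) (hC : C ≤ F) (hcirc : C.IsCircuitGraph) :
    ∃ z, ∀ x : V(F), (x : α) ∈ V(C) → rootVertex k (σ.branch x) ≠ z := by
  by_contra! hcon
  refine not_even_of_rootVertex hQ ((σ.union_le E(C)).trans hH)
    (σ.even_ncard_neighborSet_union_of_circuit hC hcirc.2.2) fun S hS => ?_
  rw [or_iff_not_imp_left, ← Ne, ← Set.nonempty_iff_ne_empty]
  rintro ⟨s, hs⟩
  rw [Set.eq_univ_iff_forall]
  intro z
  obtain ⟨x, hx, hxs⟩ := hcon s
  obtain ⟨y, hy, hyz⟩ := hcon z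
  have := σ.branch_mem_iff_of_isConnected hC hcirc.2.1 hS hx hy (by simpa [hxs] using hs)
  simpa [hyz] using this

lemma nonempty_iterVert : ∀ k, Nonempty (IterVert k)
  | 0 => inferInstanceAs (Nonempty (Fin 10))
  | k + 1 => by
    obtain ⟨v⟩ := nonempty_iterVert k
    exact ⟨((v, ⟨1, by decide⟩) : IterVert k × PVert)⟩

instance (k : ℕ) : Nonempty (IterVert k) := nonempty_iterVert k

lemma rootVertex_surjective : ∀ k, Function.Surjective (rootVertex k)
  | 0 => fun z => ⟨z, rfl⟩
  | k + 1 => fun z => by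
    obtain ⟨v, hv⟩ := rootVertex_surjective k z
    exact ⟨((v, ⟨1, by decide⟩) : IterVert k × PVert), hv⟩

lemma IsFrame.exists_subdivision (hQ : IsIteratedPetersen k Q) (hF : IsFrame F Q) :
    ∃ H ≤ Q, H.IsSolid ∧ Nonempty (Subdivision H F) ∧ F.IsConnected := by
  obtain ⟨hcomp, H, hH, ⟨σ⟩, hev⟩ := hF
  have hs := σ.isSolid hcomp fun c => (hev c).2
  exact ⟨H, hH, hs, ⟨σ⟩,
    σ.isConnected_of_cutConnected (hs.cutConnected_of_isIteratedPetersen hQ hH)⟩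

/-- As `F` is connected, it is its own component. If it were a circuit, `H` would be connected with
even degrees, which `not_even_of_rootVertex` excludes. -/
lemma IsFrame.isCubic_and_isTwoConnected (hQ : IsIteratedPetersen k Q) (hF : IsFrame F Q) :
    F.IsCubic ∧ F.IsTwoConnected := by
  obtain ⟨H, hH, hs, ⟨σ⟩, hcon⟩ := hF.exists_subdivision hQ
  rcases hF.1 F ⟨Graph.IsClosedSubgraph.rfl, hcon⟩ with ⟨hcirc, -⟩ | h
  · exfalso
    refine not_even_of_rootVertex hQ hH (fun v => ?_) fun S hS => ?_
    · have := σ.even_ncard_neighborSet_union_of_circuit le_rfl hcirc.2.2 v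
      rwa [σ.union_edgeSet] at this
    · rcases hs.cutConnected_of_isIteratedPetersen hQ hH _ hS with h | h
      · left
        rwa [Set.preimage_eq_empty_iff, (rootVertex_surjective k).range_eq,
          Set.disjoint_univ] at h
      · right
        rw [Set.eq_univ_iff_forall]
        intro z
        obtain ⟨v, rfl⟩ := rootVertex_surjective k z
        exact (h ▸ Set.mem_univ v : v ∈ rootVertex k ⁻¹' S)
  · exact h.symm

end Frame

/-- A potential on `G` pulls back to `F` without growing along edges by more than 1, because ends of
an edge of `F` lie in equal or adjacent copies. It vanishes on a circuit that avoids the root fibre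
of `z`, so it bounds distances from that circuit. -/
lemma IsFrame.le_ell {α β : Type*} {k : ℕ} {G : SimpleGraph (IterVert k)}
    {t : IterVert k → IterVert k → PVert} {F : Graph α β} (hG : IsIteratedPetersen k G)
    (ht : IsAttachment G t) (hF : IsFrame F (inflate G t)) {L : ℕ}
    (hL : ∀ z, ∃ φ : IterVert k → ℕ, (∀ u v, G.Adj u v → φ v ≤ φ u + 1) ∧
      (∀ v, rootVertex k v ≠ z → φ v = 0) ∧ ∃ w, L ≤ φ w) : (L : ℕ∞) ≤ F.ell := by
  have hQ : IsIteratedPetersen (k + 1) (inflate G t) := ⟨G, t, hG, ht, rfl⟩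
  obtain ⟨H, hH, hs, ⟨σ⟩, -⟩ := hF.exists_subdivision hQ
  refine le_iInf fun C => le_iInf fun ⟨hC, hcirc⟩ => ?_
  obtain ⟨z, hz⟩ := σ.exists_rootVertex_ne hQ hH hC hcirc
  obtain ⟨φ, hφ, hφ0, w, hw⟩ := hL z
  -- The copy of `w` contains a vertex of odd degree, necessarily a branch vertex, so the value at
  -- `w` is attained on `F`.
  obtain ⟨p, hp⟩ := exists_odd_neighborSet_of_isSolid hs ht hH w
  have hb : (w, p) ∈ Set.range σ.branch := by
    by_contra hb
    have := σ.even_ncard_neighborSet_union_of_not_branch E(F) hb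
    rw [σ.union_edgeSet] at this
    exact hp this
  obtain ⟨b, hb⟩ := hb
  refine le_trans ?_ (le_iSup _ b)
  refine le_trans ?_ (Graph.le_distFrom (fun x => φ (σ.branch x).1) ?_ ?_ b)
  · rw [hb]
    exact_mod_cast hw
  · rintro x y ⟨e, he⟩
    have h1 := σ.isLink ⟨e, he.edge_mem⟩
    have h2 := σ.fst_branch_eq_or_adj hs ht hH ⟨e, he.edge_mem⟩
    rcases Sym2.eq_iff.1 (h1.isLink_iff_sym2_eq.1 he) with ⟨hx, hy⟩ | ⟨hx, hy⟩
    · rw [Subtype.ext hx, Subtype.ext hy] at h2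
      rcases h2 with h2 | h2
      · simp [h2]
      · exact hφ _ _ h2
    · rw [Subtype.ext hx, Subtype.ext hy] at h2
      rcases h2 with h2 | h2
      · simp [h2]
      · exact hφ _ _ h2.symm
  · exact fun c hc => hφ0 _ (hz c hc)

/-! ### Potentials that bound distances in iterated Petersen graphs from below -/

/-- Three minus the distance in `P` from the 2-valent vertex `q` to `p`. -/
def proximity (q p : PVert) : ℕ :=
  if p = q then 3 else if petersen.Adj q p then 2 else if petersen.Adj 0 p then 0 else 1

lemma proximity_le : ∀ q p, proximity q p ≤ 3 := by decide

lemma proximity_le_add_one : ∀ q p p' : PVert, petersen.Adj 0 q → petersen.Adj p p' →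
    proximity q p ≤ proximity q p' + 1 := by
  decide +kernel

lemma proximity_self (q : PVert) : proximity q q = 3 := by simp [proximity]

/-- Two neighbours of `0` are nonadjacent and have only `0` in common as a neighbour, so distinct
ports have distance 3 in `P`. -/
lemma proximity_eq_zero : ∀ q p : PVert, petersen.Adj 0 q → petersen.Adj 0 p → p ≠ q →
    proximity q p = 0 := by
  decide

section Potential

variable {V : Type*}

open Classical in
/-- The proximity of `p` to those 2-valent vertices in the copy of `v` that lead to smaller values
of `φ`. -/
noncomputable def descent (G : SimpleGraph V) (t : V → V → PVert) (φ : V → ℕ) (v : V)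
    (p : PVert) : ℕ :=
  Finset.univ.sup fun q => if ∃ u, G.Adj v u ∧ t v u = q ∧ φ u < φ v then proximity q p else 0

open Classical in
/-- The potential on the inflated graph that a potential on the original graph induces. -/
noncomputable def liftPotential (G : SimpleGraph V) (t : V → V → PVert) (φ : V → ℕ)
    (x : V × PVert) : ℕ :=
  if φ x.1 = 0 then 0 else 4 * φ x.1 - descent G t φ x.1 x.2

variable {G : SimpleGraph V} {t : V → V → PVert} {φ : V → ℕ}

lemma descent_le (v : V) (p : PVert) : descent G t φ v p ≤ 3 := by
  refine Finset.sup_le fun q _ => ?_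
  split_ifs
  · exact proximity_le q p
  · exact Nat.zero_le _

lemma descent_le_add_one (ht : IsAttachment G t) (v : V) {p p' : PVert}
    (h : petersen.Adj p p') : descent G t φ v p ≤ descent G t φ v p' + 1 := by
  refine Finset.sup_le fun q _ => ?_
  split_ifs with hq
  · obtain ⟨u, hu, rfl, hlt⟩ := hq
    refine (proximity_le_add_one _ p p' ((ht v).1 u hu) h).trans (Nat.add_le_add_right ?_ 1)
    unfold descent
    refine le_trans ?_ (Finset.le_sup (Finset.mem_univ (t v u)))
    rw [if_pos ⟨u, hu, rfl, hlt⟩]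
  · exact Nat.zero_le _

/-- At a port only this port itself can contribute, the other ones having proximity 0. -/
lemma descent_attachment (ht : IsAttachment G t) {v u : V} (hvu : G.Adj v u) :
    descent G t φ v (t v u) = if φ u < φ v then 3 else 0 := by
  split_ifs with hlt
  · refine le_antisymm (descent_le _ _) ?_
    unfold descent
    refine le_trans ?_ (Finset.le_sup (Finset.mem_univ (t v u)))
    rw [if_pos ⟨u, hvu, rfl, hlt⟩, proximity_self]
  · refine Nat.le_zero.1 (Finset.sup_le fun q _ => ?_)
    split_ifs with hq
    · obtain ⟨w, hw, rfl, hwlt⟩ := hq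
      refine (proximity_eq_zero _ _ ((ht v).1 w hw) ((ht v).1 u hvu) fun h => ?_).le
      obtain rfl := (ht v).2 hvu hw h
      exact hlt hwlt
    · exact le_rfl

/-- Inside a copy the descent changes by at most 1 along an edge. On an edge between copies where
`φ` drops from `m` to `m - 1`, the lifted values are `4 * m - 3` and `4 * (m - 1)`, again differing
by 1. -/
lemma liftPotential_le_add_one (ht : IsAttachment G t)
    (hφ : ∀ u v, G.Adj u v → φ v ≤ φ u + 1) (x y : V × PVert) (h : (inflate G t).Adj x y) :
    liftPotential G t φ y ≤ liftPotential G t φ x + 1 := by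
  obtain ⟨v, p⟩ := x
  obtain ⟨w, q⟩ := y
  unfold liftPotential
  rcases h with ⟨h1, h2⟩ | ⟨h1, h2, h3⟩
  · dsimp only at h1 h2 ⊢
    subst h1
    have h4 := descent_le_add_one (φ := φ) ht v (p := p) (p' := q) h2
    have h5 := descent_le (G := G) (t := t) (φ := φ) v p
    split_ifs <;> omega
  · dsimp only at h1 h2 h3 ⊢
    subst h2 h3
    rw [descent_attachment ht h1, descent_attachment ht h1.symm]
    have h4 := hφ _ _ h1
    have h5 := hφ _ _ h1.symm
    split_ifs <;> omega

/-- At the port from `v` to `u` the descent is 0 unless `φ u < φ v`; in that case `φ v ≥ L + 1`,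
which makes up for the loss of 3. -/
lemma le_liftPotential (ht : IsAttachment G t) {L : ℕ} {v u : V} (h : G.Adj v u)
    (hv : L ≤ φ v) (hu : L ≤ φ u) : 4 * L ≤ liftPotential G t φ (v, t v u) := by
  unfold liftPotential
  dsimp only
  rw [descent_attachment ht h]
  split_ifs <;> omega

end Potential

lemma exists_potential_of_inflate_petersen {t : Fin 10 → Fin 10 → PVert}
    (ht : IsAttachment petersen t) (z : Fin 10) :
    ∃ φ : Fin 10 × PVert → ℕ, (∀ u v, (inflate petersen t).Adj u v → φ v ≤ φ u + 1) ∧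
      (∀ v, v.1 ≠ z → φ v = 0) ∧
      ∃ x y, (inflate petersen t).Adj x y ∧ 2 ≤ φ x ∧ 2 ≤ φ y := by
  -- In the copy of `z` ports get 1 and all other vertices get 2; `2` and `3` are adjacent and not
  -- ports.
  refine ⟨fun v => if v.1 ≠ z then 0 else if petersen.Adj 0 v.2 then 1 else 2, ?_, ?_,
    (z, ⟨2, by decide⟩), (z, ⟨3, by decide⟩), ?_, ?_, ?_⟩
  · rintro ⟨u, p⟩ ⟨v, q⟩ (⟨h1, h2⟩ | ⟨h1, h2, h3⟩)
    · dsimp only at h1 ⊢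
      subst h1
      split_ifs <;> omega
    · dsimp only at h1 h2 h3 ⊢
      have h4 := (ht v).1 u h1.symm
      rw [← h3] at h4
      have h5 := h1.ne
      simp only [h4, if_true]
      split_ifs <;> omega
  · rintro ⟨v, p⟩ hv
    exact if_pos hv
  · exact Or.inl ⟨rfl, (by decide : petersen.Adj 2 3)⟩
  · simp +decide
  · simp +decide

/-- Two adjacent vertices of large value are carried along, because `le_liftPotential` needs them to
gain the full factor 4. -/
lemma exists_potential : ∀ {k : ℕ} {G : SimpleGraph (IterVert (k + 1))},
    IsIteratedPetersen (k + 1) G → ∀ z, ∃ φ : IterVert (k + 1) → ℕ,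
      (∀ u v, G.Adj u v → φ v ≤ φ u + 1) ∧ (∀ v, rootVertex (k + 1) v ≠ z → φ v = 0) ∧
      ∃ x y, G.Adj x y ∧ 2 * 4 ^ k ≤ φ x ∧ 2 * 4 ^ k ≤ φ y
  | 0, G, ⟨G', t, hG', ht, hG⟩, z => by
    have h : G' = petersen := hG'
    subst h
    subst hG
    exact exists_potential_of_inflate_petersen ht z
  | k + 1, G, ⟨G', t, hG', ht, hG⟩, z => by
    subst hG
    obtain ⟨φ, h1, h2, x, y, hxy, hx, hy⟩ := exists_potential hG' z
    refine ⟨liftPotential G' t φ, liftPotential_le_add_one ht h1, fun v hv => ?_,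
      (x, t x y), (y, t y x), Or.inr ⟨hxy, rfl, rfl⟩, ?_, ?_⟩
    · unfold liftPotential
      exact if_pos (h2 _ hv)
    · rw [pow_succ']
      exact (by omega : _ = 4 * (2 * 4 ^ k)).le.trans (le_liftPotential ht hxy hx hy)
    · rw [pow_succ']
      exact (by omega : _ = 4 * (2 * 4 ^ k)).le.trans (le_liftPotential ht hxy.symm hy hx)

lemma IsFrame.le_ell_of_isIteratedPetersen {α β : Type*} : ∀ {k : ℕ} {Q : SimpleGraph (IterVert k)}
    {F : Graph α β}, IsIteratedPetersen k Q → IsFrame F Q →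
    ((if k ≤ 1 then k else 2 ^ (2 * k - 3) : ℕ) : ℕ∞) ≤ F.ell
  | 0, _, _, _, _ => by simp
  | 1, Q, F, ⟨G, t, hG, ht, hQ⟩, hF => by
    subst hQ
    have h : G = petersen := hG
    subst h
    -- For `k = 1` the graph `G` is the Petersen graph itself, and the indicator function of `z`
    -- suffices.
    refine hF.le_ell hG ht fun z => ⟨fun v => if rootVertex 0 v = z then 1 else 0, fun u v _ => ?_,
      fun v hv => if_neg hv, z, (if_pos rfl).ge⟩
    dsimp only
    split_ifs <;> omega
  | k + 2, Q, F, ⟨G, t, hG, ht, hQ⟩, hF => by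
    subst hQ
    refine hF.le_ell hG ht fun z => ?_
    obtain ⟨φ, h1, h2, x, -, -, hx, -⟩ := exists_potential hG z
    refine ⟨φ, h1, h2, x, le_trans (le_of_eq ?_) hx⟩
    rw [if_neg (by omega), show 2 * (k + 2) - 3 = 2 * k + 1 by omega, pow_succ', pow_mul]
    norm_num

/-! ### Iterated Petersen graphs are 3-regular and 2-connected -/

namespace SimpleGraph

variable {V : Type*}

/-- Deleting any vertex leaves a connected graph, in terms of sets closed under adjacency. -/
def VertexConnected (G : SimpleGraph V) : Prop :=
  ∀ v, ∀ S : Set V, v ∉ S → (∀ x y, G.Adj x y → y ≠ v → x ∈ S → y ∈ S) → S = ∅ ∨ S = {v}ᶜ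

/-- Connectedness statements are checked with explicit paths given as lists. -/
lemma mem_iff_mem_of_isChain {R : V → V → Prop} {S : Set V} : ∀ {l : List V}, l.IsChain R →
    (∀ x ∈ l, ∀ y ∈ l, R x y → (x ∈ S ↔ y ∈ S)) → ∀ x ∈ l, ∀ y ∈ l, x ∈ S ↔ y ∈ S
  | [], _, _ => by simp
  | [a], _, _ => by simp
  | a :: b :: l, hl, h => by
    rw [List.isChain_cons_cons] at hl
    have ih := mem_iff_mem_of_isChain hl.2 fun x hx y hy =>
      h x (List.mem_cons_of_mem _ hx) y (List.mem_cons_of_mem _ hy)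
    have hab := h a (by simp) b (by simp) hl.1
    have key : ∀ x ∈ a :: b :: l, x ∈ S ↔ b ∈ S := by
      intro x hx
      rcases List.mem_cons.1 hx with rfl | hx
      · exact hab
      · exact ih x hx b (by simp)
    exact fun x hx y hy => (key x hx).trans (key y hy).symm

/-- Deleting the vertex `x` already leaves a connected graph, and `x` keeps a neighbour other than
`y`. For `x = y` no edge is excluded, which gives plain connectedness. -/
lemma VertexConnected.of_edge_closed {G : SimpleGraph V} (h : G.VertexConnected)
    (h3 : ∀ v, (G.neighborSet v).ncard = 3) {x y : V} {S : Set V}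
    (hS : ∀ a b, G.Adj a b → s(a, b) ≠ s(x, y) → a ∈ S → b ∈ S) : S = ∅ ∨ S = Set.univ := by
  obtain ⟨w, hw, hwy⟩ : ∃ w, G.Adj x w ∧ w ≠ y := by
    obtain ⟨w, hw, hwy⟩ := Set.exists_ne_of_one_lt_ncard (s := G.neighborSet x)
      (by rw [h3]; norm_num) y
    exact ⟨w, hw, hwy⟩
  have hne : s(x, w) ≠ s(x, y) := fun e => hwy (Sym2.congr_right.1 e)
  have hcl : ∀ a b, G.Adj a b → b ≠ x → a ∈ S \ {x} → b ∈ S \ {x} := by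
    rintro a b hab hb ⟨ha, hax⟩
    refine ⟨hS a b hab ?_ ha, hb⟩
    intro e
    rcases Sym2.eq_iff.1 e with ⟨rfl, -⟩ | ⟨-, rfl⟩
    · exact hax rfl
    · exact hb rfl
  rcases h x (S \ {x}) (by simp) hcl with h0 | h1
  · left
    rw [Set.eq_empty_iff_forall_notMem] at h0 ⊢
    intro a ha
    by_cases hax : a = x
    · subst hax
      exact h0 w ⟨hS a w hw hne ha, hw.ne'⟩
    · exact h0 a ⟨ha, hax⟩
  · right
    have hall : ∀ a, a ≠ x → a ∈ S := fun a ha => (h1.symm ▸ (ha : a ∈ ({x} : Set V)ᶜ) :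
      a ∈ S \ {x}).1
    rw [Set.eq_univ_iff_forall]
    intro a
    by_cases hax : a = x
    · subst hax
      exact hS w a hw.symm (by rwa [Sym2.eq_swap]) (hall w hw.ne')
    · exact hall a hax

end SimpleGraph

/-- A path of the Petersen graph through all vertices but `v`. -/
def petersenPath : Fin 10 → List (Fin 10) :=
  ![[1, 2, 3, 4, 9, 7, 5, 8, 6],
    [0, 4, 3, 2, 7, 5, 8, 6, 9],
    [0, 1, 6, 9, 7, 5, 8, 3, 4],
    [0, 1, 2, 7, 5, 8, 6, 9, 4],
    [0, 1, 2, 3, 8, 6, 9, 7, 5],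
    [0, 1, 2, 7, 9, 6, 8, 3, 4],
    [0, 1, 2, 3, 4, 9, 7, 5, 8],
    [0, 1, 2, 3, 4, 9, 6, 8, 5],
    [0, 1, 6, 9, 4, 3, 2, 7, 5],
    [0, 1, 6, 8, 5, 7, 2, 3, 4]]

/-- A path of the Petersen graph through all vertices but `0` and `p`. -/
def petersenMinusPath : Fin 10 → List (Fin 10) :=
  ![[], [2, 3, 4, 9, 7, 5, 8, 6],
    [1, 6, 9, 7, 5, 8, 3, 4],
    [1, 2, 7, 5, 8, 6, 9, 4],
    [1, 2, 3, 8, 6, 9, 7, 5],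
    [1, 2, 7, 9, 6, 8, 3, 4],
    [1, 2, 3, 4, 9, 7, 5, 8],
    [1, 2, 3, 4, 9, 6, 8, 5],
    [1, 6, 9, 4, 3, 2, 7, 5],
    [1, 6, 8, 5, 7, 2, 3, 4]]

lemma petersenPath_isChain : ∀ v, (petersenPath v).IsChain petersen.Adj := by decide +kernel

lemma mem_petersenPath_iff : ∀ v w, w ∈ petersenPath v ↔ w ≠ v := by decide +kernel

lemma petersenMinusPath_isChain : ∀ v, (petersenMinusPath v).IsChain petersen.Adj := by
  decide +kernel

lemma mem_petersenMinusPath_iff :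
    ∀ p w, p ≠ 0 → (w ∈ petersenMinusPath p ↔ w ≠ 0 ∧ w ≠ p) := by decide +kernel

lemma petersen_vertexConnected : petersen.VertexConnected := by
  intro v S hv hS
  have key := mem_iff_mem_of_isChain (S := S) (petersenPath_isChain v) fun x hx y hy h =>
    ⟨hS x y h ((mem_petersenPath_iff v y).1 hy), hS y x h.symm ((mem_petersenPath_iff v x).1 hx)⟩
  rcases S.eq_empty_or_nonempty with h | ⟨x, hx⟩
  · exact Or.inl h
  · right
    have hxv : x ≠ v := fun e => hv (e ▸ hx)
    ext y
    simp only [Set.mem_compl_iff, Set.mem_singleton_iff]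
    constructor
    · rintro hy rfl
      exact hv hy
    · intro hy
      exact (key x ((mem_petersenPath_iff v x).2 hxv) y ((mem_petersenPath_iff v y).2 hy)).1 hx

section Inflate

variable {V : Type*} {G : SimpleGraph V} {t : V → V → PVert}

/-- Three neighbours are mapped injectively to three ports, so every port is used. -/
lemma IsAttachment.exists_adj_eq (ht : IsAttachment G t) (h3 : ∀ v, (G.neighborSet v).ncard = 3)
    (v : V) {q : PVert} (hq : petersen.Adj 0 q) : ∃ u, G.Adj v u ∧ t v u = q := by
  have himg : (Subtype.val ∘ t v) '' G.neighborSet v = petersen.neighborSet 0 := by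
    refine Set.eq_of_subset_of_ncard_le ?_ ?_
    · rintro _ ⟨u, hu, rfl⟩
      exact (ht v).1 u hu
    · rw [petersen_neighborSet_ncard,
        Set.InjOn.ncard_image (Subtype.val_injective.comp_injOn (ht v).2), h3]
  have : (q : Fin 10) ∈ petersen.neighborSet 0 := hq
  rw [← himg] at this
  obtain ⟨u, hu, h⟩ := this
  exact ⟨u, hu, Subtype.ext h⟩

lemma contract_collapse_inflate (ht : IsAttachment G t) (h3 : ∀ v, (G.neighborSet v).ncard = 3)
    (v : V) : contract (collapse v) (inflate G t) = petersen := by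
  refine le_antisymm (contract_collapse_le ht le_rfl v) ?_
  have key : ∀ q, petersen.Adj 0 q → (contract (collapse v) (inflate G t)).Adj 0 q := by
    intro q hq
    obtain ⟨u, hu, hqu⟩ := ht.exists_adj_eq h3 v (q := ⟨q, hq.ne'⟩) hq
    refine ⟨hq.ne, (u, t u v), (v, t v u), Or.inr ⟨hu.symm, rfl, rfl⟩,
      collapse_eq_zero_iff.2 hu.ne', ?_⟩
    rw [collapse_mk, hqu]
  intro p q hpq
  by_cases hp : p = 0
  · subst hp
    exact key q hpq
  · by_cases hq : q = 0
    · subst hq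
      exact (key p hpq.symm).symm
    · exact ⟨hpq.ne, (v, ⟨p, hp⟩), (v, ⟨q, hq⟩), Or.inl ⟨rfl, hpq⟩, collapse_mk _ _,
        collapse_mk _ _⟩

lemma ncard_neighborSet_contract_collapse {H : SimpleGraph (V × PVert)} (ht : IsAttachment G t)
    (hH : H ≤ inflate G t) (v : V) (p : PVert) :
    ((contract (collapse v) H).neighborSet p).ncard = (H.neighborSet (v, p)).ncard := by
  have hpre : collapse v ⁻¹' {(p : Fin 10)} = {(v, p)} := by
    ext x
    exact ⟨fun h => eq_mk_of_collapse_eq h, fun h => by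
      rw [Set.mem_singleton_iff.1 h]
      exact collapse_mk v p⟩
  rw [← ncard_outDarts_singleton, ← ncard_outDarts_singleton,
    (contractsInjectively_collapse ht hH v).ncard_outDarts, hpre]

lemma inflate_ncard_neighborSet (ht : IsAttachment G t) (h3 : ∀ v, (G.neighborSet v).ncard = 3)
    (x : V × PVert) : ((inflate G t).neighborSet x).ncard = 3 := by
  obtain ⟨v, p⟩ := x
  rw [← ncard_neighborSet_contract_collapse ht le_rfl v p, contract_collapse_inflate ht h3,
    petersen_neighborSet_ncard]

lemma exists_port_ne : ∀ p : PVert, ∃ q : PVert, petersen.Adj 0 q ∧ q ≠ p := by decide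

/-- The other copies are connected, the copy of `v` stays connected without `p`, and it keeps a port
`q ≠ p` that joins it to a neighbouring copy. The other copies hang together because `G` minus `v`
is connected. -/
lemma inflate_vertexConnected (ht : IsAttachment G t) (h3 : ∀ v, (G.neighborSet v).ncard = 3)
    (hG : G.VertexConnected) : (inflate G t).VertexConnected := by
  rintro ⟨v, p⟩ S hv hS
  have hS' : ∀ x y, (inflate G t).Adj x y → x ≠ (v, p) → y ≠ (v, p) → (x ∈ S ↔ y ∈ S) :=
    fun x y h hx hy => ⟨hS x y h hy, hS y x h.symm hx⟩
  have hfib : ∀ u, u ≠ v → ∀ q q', (u, q) ∈ S → (u, q') ∈ S := by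
    intro u hu q q' hq
    have := mem_iff_mem_of_isChain (S := {a | ∃ h : a ≠ 0, (u, (⟨a, h⟩ : PVert)) ∈ S})
      (petersenPath_isChain 0) ?_ q ((mem_petersenPath_iff 0 q).2 q.2) q'
      ((mem_petersenPath_iff 0 q').2 q'.2)
    · exact (this.1 ⟨q.2, hq⟩).2
    · intro a ha b hb hab
      rw [mem_petersenPath_iff] at ha hb
      have := hS' (u, ⟨a, ha⟩) (u, ⟨b, hb⟩) (Or.inl ⟨rfl, hab⟩) (fun e => hu (congrArg Prod.fst e))
        (fun e => hu (congrArg Prod.fst e))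
      exact ⟨fun ⟨_, h⟩ => ⟨hb, this.1 h⟩, fun ⟨_, h⟩ => ⟨ha, this.2 h⟩⟩
  have hfibv : ∀ q q', q ≠ p → q' ≠ p → (v, q) ∈ S → (v, q') ∈ S := by
    intro q q' hqp hqp' hq
    have hmem := fun w => mem_petersenMinusPath_iff p w p.2
    have := mem_iff_mem_of_isChain (S := {a | ∃ h : a ≠ 0, (v, (⟨a, h⟩ : PVert)) ∈ S})
      (petersenMinusPath_isChain p) ?_ q ((hmem q).2 ⟨q.2, fun e => hqp (Subtype.ext e)⟩) q'
      ((hmem q').2 ⟨q'.2, fun e => hqp' (Subtype.ext e)⟩)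
    · exact (this.1 ⟨q.2, hq⟩).2
    · intro a ha b hb hab
      rw [hmem] at ha hb
      have := hS' (v, ⟨a, ha.1⟩) (v, ⟨b, hb.1⟩) (Or.inl ⟨rfl, hab⟩)
        (fun e => ha.2 (congrArg (fun x : V × PVert => (x.2 : Fin 10)) e))
        (fun e => hb.2 (congrArg (fun x : V × PVert => (x.2 : Fin 10)) e))
      exact ⟨fun ⟨_, h⟩ => ⟨hb.1, this.1 h⟩, fun ⟨_, h⟩ => ⟨ha.1, this.2 h⟩⟩
  obtain ⟨q, hq, hqp⟩ := exists_port_ne p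
  obtain ⟨u, hu, rfl⟩ := ht.exists_adj_eq h3 v hq
  have hvu := hS' (v, t v u) (u, t u v) (Or.inr ⟨hu, rfl, rfl⟩)
    (fun e => hqp (congrArg Prod.snd e)) (fun e => hu.ne' (congrArg Prod.fst e))
  have hcl : ∀ a b, G.Adj a b → b ≠ v → a ∈ {w | w ≠ v ∧ ∀ q, (w, q) ∈ S} →
      b ∈ {w | w ≠ v ∧ ∀ q, (w, q) ∈ S} := by
    rintro a b hab hb ⟨ha, haS⟩
    refine ⟨hb, fun q => hfib b hb (t b a) q ?_⟩
    exact (hS' (a, t a b) (b, t b a) (Or.inr ⟨hab, rfl, rfl⟩) (fun e => ha (congrArg Prod.fst e))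
      (fun e => hb (congrArg Prod.fst e))).1 (haS _)
  rcases hG v {w | w ≠ v ∧ ∀ q, (w, q) ∈ S} (fun h => h.1 rfl) hcl with h | h
  · left
    have hw : ∀ w, w ≠ v → ∀ q, (w, q) ∉ S := by
      intro w hw q hq
      have : w ∈ {w | w ≠ v ∧ ∀ q, (w, q) ∈ S} := ⟨hw, fun q' => hfib w hw q q' hq⟩
      rw [h] at this
      exact this
    rw [Set.eq_empty_iff_forall_notMem]
    rintro ⟨w, q⟩ hwq
    by_cases hwv : w = v
    · subst hwv
      have hqp' : q ≠ p := fun e => hv (e ▸ hwq)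
      exact hw u hu.ne' _ (hvu.1 (hfibv q _ hqp' hqp hwq))
    · exact hw w hwv q hwq
  · right
    have hw : ∀ w, w ≠ v → ∀ q, (w, q) ∈ S := by
      intro w hw
      have : w ∈ ({v} : Set V)ᶜ := hw
      rw [← h] at this
      exact this.2
    ext ⟨w, q⟩
    simp only [Set.mem_compl_iff, Set.mem_singleton_iff]
    constructor
    · intro h e
      exact hv (e ▸ h)
    · intro hne
      by_cases hwv : w = v
      · subst hwv
        exact hfibv _ q hqp (fun e => hne (e ▸ rfl)) (hvu.2 (hw u hu.ne' _))
      · exact hw w hwv q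

end Inflate

lemma IsIteratedPetersen.ncard_neighborSet : ∀ {k : ℕ} {Q : SimpleGraph (IterVert k)},
    IsIteratedPetersen k Q → ∀ v, (Q.neighborSet v).ncard = 3
  | 0, Q, hQ => by
    have h : Q = petersen := hQ
    subst h
    exact petersen_neighborSet_ncard
  | k + 1, Q, ⟨G, t, hG, ht, hQ⟩ => by
    subst hQ
    exact inflate_ncard_neighborSet ht hG.ncard_neighborSet

lemma IsIteratedPetersen.vertexConnected : ∀ {k : ℕ} {Q : SimpleGraph (IterVert k)},
    IsIteratedPetersen k Q → Q.VertexConnected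
  | 0, Q, hQ => by
    have h : Q = petersen := hQ
    subst h
    exact petersen_vertexConnected
  | k + 1, Q, ⟨G, t, hG, ht, hQ⟩ => by
    subst hQ
    exact inflate_vertexConnected ht hG.ncard_neighborSet hG.vertexConnected

lemma even_card_iterVert : ∀ k, Even (Nat.card (IterVert k))
  | 0 => by
    have : Nat.card (IterVert 0) = 10 := (Nat.card_eq_fintype_card (α := Fin 10)).trans (by simp)
    rw [this]
    decide
  | k + 1 => by
    have : Nat.card (IterVert (k + 1)) = Nat.card (IterVert k) * Nat.card PVert := Nat.card_prod _ _
    rw [this]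
    exact (even_card_iterVert k).mul_right _

/-! ### Simple graphs as multigraphs -/

namespace SimpleGraph

variable {V : Type}

/-- The multigraph on the vertex set `S` with the edges of `D` inside `S`. -/
def liftGraph (D : SimpleGraph V) (S : Set V) : Graph (ULift.{u} V) (ULift.{v} (Sym2 V)) where
  vertexSet := ULift.down ⁻¹' S
  IsLink e x y := e.down = s(x.down, y.down) ∧ D.Adj x.down y.down ∧ x.down ∈ S ∧ y.down ∈ S
  isLink_symm := fun _ _ => ⟨fun _ _ ⟨h, h1, h2, h3⟩ => ⟨by rw [h, Sym2.eq_swap], h1.symm, h3, h2⟩⟩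
  eq_or_eq_of_isLink_of_isLink := by
    rintro e x y v w ⟨h, -⟩ ⟨h', -⟩
    rw [h] at h'
    rcases Sym2.eq_iff.1 h' with ⟨h, -⟩ | ⟨h, -⟩
    · exact Or.inl (ULift.ext _ _ h)
    · exact Or.inr (ULift.ext _ _ h)
  left_mem_of_isLink := fun _ _ _ h => h.2.2.1

lemma liftGraph_mono {D D' : SimpleGraph V} (h : D ≤ D') {S S' : Set V} (hS : S ⊆ S') :
    liftGraph.{u, v} D S ≤ liftGraph D' S' :=
  ⟨fun _ hx => hS hx, fun _ _ _ ⟨h1, h2, h3, h4⟩ => ⟨h1, h h2, hS h3, hS h4⟩⟩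

lemma vertexDegree_liftGraph {D : SimpleGraph V} {S : Set V} (hS : D.support ⊆ S)
    (x : ULift.{u} V) : (liftGraph.{u, v} D S).vertexDegree x = (D.neighborSet x.down).encard := by
  have hl : (liftGraph.{u, v} D S).loopSet x = ∅ := by
    rw [Set.eq_empty_iff_forall_notMem]
    rintro e ⟨-, h, -⟩
    exact h.ne rfl
  have hi : (liftGraph.{u, v} D S).incidenceSet x =
      (fun w => ULift.up s(x.down, w)) '' D.neighborSet x.down := by
    ext e
    constructor
    · rintro ⟨y, h1, h2, -⟩
      exact ⟨y.down, h2, ULift.ext _ _ h1.symm⟩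
    · rintro ⟨w, hw, rfl⟩
      exact ⟨⟨w⟩, rfl, hw, hS ⟨w, hw⟩, hS ⟨x.down, hw.symm⟩⟩
  have hinj : Function.Injective fun w => (ULift.up s(x.down, w) : ULift.{v} (Sym2 V)) :=
    fun a b h => Sym2.congr_right.1 (congrArg ULift.down h)
  rw [Graph.vertexDegree, hl, hi, hinj.encard_image, Set.encard_empty, add_zero]

lemma liftGraph_isConnected {D : SimpleGraph V} {S : Set V} (hne : S.Nonempty)
    (h : ∀ T : Set V, (∀ x y, D.Adj x y → x ∈ S → y ∈ S → x ∈ T → y ∈ T) →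
      ∀ x ∈ S, ∀ y ∈ S, x ∈ T → y ∈ T) : (liftGraph.{u, v} D S).IsConnected := by
  rw [Graph.isConnected_iff_forall_closed]
  obtain ⟨a, ha⟩ := hne
  refine ⟨⟨⟨a⟩, ha⟩, fun T hT x hx y hy hxT => ?_⟩
  exact h (ULift.up ⁻¹' T) (fun x y hxy hx hy hxT => hT ⟨s(x, y)⟩ ⟨x⟩ ⟨y⟩ ⟨rfl, hxy, hx, hy⟩ hxT)
    x.down hx y.down hy hxT

/-- A circuit, presented as a set of edges: all degrees are 0 or 2, and the vertices of degree 2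
are connected to each other. -/
structure IsCircuit (D : SimpleGraph V) : Prop where
  nonempty : D.support.Nonempty
  degree : ∀ v ∈ D.support, (D.neighborSet v).encard = 2
  connected : ∀ T : Set V, (∀ x y, D.Adj x y → x ∈ T → y ∈ T) →
    ∀ x ∈ D.support, ∀ y ∈ D.support, x ∈ T → y ∈ T

lemma IsCircuit.liftGraph_isCircuitGraph [Finite V] {D : SimpleGraph V} (h : D.IsCircuit) :
    (liftGraph.{u, v} D D.support).IsCircuitGraph :=
  ⟨Set.toFinite _, liftGraph_isConnected h.nonempty fun T hT => h.connected T
    fun x y hxy => hT x y hxy ⟨y, hxy⟩ ⟨x, hxy.symm⟩,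
    fun x hx => (vertexDegree_liftGraph subset_rfl x).trans (h.degree _ hx)⟩

/-- All vertices of `G` have distance at most `n` from the vertices incident with edges of `D`. -/
def CoversWithin (D G : SimpleGraph V) (n : ℕ) (v : V) : Prop :=
  ∃ c ∈ D.support, ∃ p : G.Walk c v, p.length ≤ n

lemma CoversWithin.step {D G : SimpleGraph V} {n : ℕ} {v w : V} (h : D.CoversWithin G n v)
    (hvw : G.Adj v w) : D.CoversWithin G (n + 1) w := by
  obtain ⟨c, hc, p, hp⟩ := h
  exact ⟨c, hc, p.concat hvw, by rw [Walk.length_concat]; omega⟩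

lemma CoversWithin.mono {D G : SimpleGraph V} {m n : ℕ} {v : V} (h : D.CoversWithin G m v)
    (hmn : m ≤ n) : D.CoversWithin G n v := by
  obtain ⟨c, hc, p, hp⟩ := h
  exact ⟨c, hc, p, hp.trans hmn⟩

lemma coversWithin_of_mem_support {D : SimpleGraph V} (G : SimpleGraph V) {v : V}
    (h : v ∈ D.support) : D.CoversWithin G 0 v :=
  ⟨v, h, Walk.nil, le_rfl⟩

lemma IsCircuit.ell_le [Finite V] {D G : SimpleGraph V} (hD : D.IsCircuit) (hle : D ≤ G) {n : ℕ}
    (h : ∀ v, D.CoversWithin G n v) : (liftGraph.{u, v} G Set.univ).ell ≤ n := by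
  refine (iInf₂_le (liftGraph D D.support)
    ⟨liftGraph_mono hle (Set.subset_univ _), hD.liftGraph_isCircuitGraph⟩).trans ?_
  refine iSup_le fun x => ?_
  obtain ⟨c, hc, p, hp⟩ := h x.1.down
  let φ : G →g (liftGraph.{u, v} G Set.univ).toSimpleGraph :=
    { toFun := fun v => ⟨⟨v⟩, Set.mem_univ v⟩
      map_rel' := fun {a b} hab => ⟨fun e => hab.ne
        (congrArg (fun z : V(liftGraph.{u, v} G Set.univ) => z.1.down) e), ⟨s(a, b)⟩, rfl, hab,
          Set.mem_univ _, Set.mem_univ _⟩ }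
  refine (iInf₂_le (φ c) hc).trans ?_
  refine ((p.map φ).edist_le).trans ?_
  rw [Walk.length_map]
  exact_mod_cast hp

lemma VertexConnected.liftGraph_isTwoConnected {G : SimpleGraph V} [Finite V] [Nonempty V]
    (h : G.VertexConnected) (h3 : ∀ v, (G.neighborSet v).ncard = 3) :
    (liftGraph.{u, v} G Set.univ).IsTwoConnected := by
  have hne : ∀ v, ∃ w, G.Adj v w := by
    intro v
    have : (G.neighborSet v).Nonempty := by
      rw [← Set.ncard_pos, h3]
      norm_num
    exact this
  obtain ⟨a⟩ := ‹Nonempty V›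
  obtain ⟨b, hab⟩ := hne a
  have hclosed : ∀ (x y : V) (T : Set V),
      (∀ a b, G.Adj a b → s(a, b) ≠ s(x, y) → a ∈ T → b ∈ T) → ∀ a b, a ∈ T → b ∈ T := by
    intro x y T hT a b ha
    rcases h.of_edge_closed h3 hT with rfl | rfl
    · exact ha.elim
    · exact Set.mem_univ b
  refine ⟨?_, ⟨⟨a⟩, Set.mem_univ _, ⟨b⟩, Set.mem_univ _, fun e => hab.ne (congrArg ULift.down e)⟩,
    ?_, ?_⟩
  · refine liftGraph_isConnected ⟨a, Set.mem_univ a⟩ fun T hT x _ y _ hx => ?_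
    exact hclosed a b T (fun c d hcd _ => hT c d hcd (Set.mem_univ _) (Set.mem_univ _)) x y hx
  · rintro ⟨x⟩ -
    rw [Graph.isConnected_iff_forall_closed]
    obtain ⟨y, hxy⟩ := hne x
    refine ⟨⟨⟨y⟩, Set.mem_univ _, fun e => hxy.ne' (congrArg ULift.down e)⟩, ?_⟩
    rintro T hT ⟨c⟩ ⟨-, hc⟩ ⟨d⟩ ⟨-, hd⟩ hcT
    have hcl : ∀ a b, G.Adj a b → b ≠ x → a ∈ {a | a ≠ x ∧ ULift.up a ∈ T} →
        b ∈ {a | a ≠ x ∧ ULift.up a ∈ T} := by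
      rintro a b hab hb ⟨ha, haT⟩
      refine ⟨hb, hT ⟨s(a, b)⟩ ⟨a⟩ ⟨b⟩ ?_ haT⟩
      rw [Graph.deleteVerts_isLink]
      exact ⟨⟨rfl, hab, Set.mem_univ _, Set.mem_univ _⟩, fun e => ha (congrArg ULift.down e),
        fun e => hb (congrArg ULift.down e)⟩
    have hc' : c ∈ {a | a ≠ x ∧ ULift.up a ∈ T} := ⟨fun e => hc (e ▸ rfl), hcT⟩
    rcases h x _ (fun h => h.1 rfl) hcl with h0 | h1
    · rw [h0] at hc'
      exact hc'.elim
    · have hd' : d ∈ ({x} : Set V)ᶜ := fun e => hd (Set.mem_singleton_iff.1 e ▸ rfl)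
      rw [← h1] at hd'
      exact hd'.2
  · rintro e ⟨x, y, he⟩
    rw [Graph.isConnected_iff_forall_closed]
    refine ⟨⟨⟨a⟩, Set.mem_univ _⟩, ?_⟩
    rintro T hT ⟨c⟩ - ⟨d⟩ - hcT
    refine hclosed x.down y.down (ULift.up ⁻¹' T) (fun a b hab hne ha => ?_) c d hcT
    refine hT ⟨s(a, b)⟩ ⟨a⟩ ⟨b⟩ ?_ ha
    rw [Graph.deleteEdges_isLink]
    refine ⟨⟨rfl, hab, Set.mem_univ _, Set.mem_univ _⟩, fun h => hne ?_⟩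
    rw [← he.1, ← Set.mem_singleton_iff.1 h]

lemma liftGraph_isCubic {G : SimpleGraph V} [Finite V] (h3 : ∀ v, (G.neighborSet v).ncard = 3) :
    (liftGraph.{u, v} G Set.univ).IsCubic := by
  intro x _
  rw [vertexDegree_liftGraph (Set.subset_univ _), ← Set.Finite.cast_ncard_eq (Set.toFinite _), h3]
  rfl

end SimpleGraph

lemma Graph.IsComponentOf.eq_of_isConnected {α β : Type*} {K F : Graph α β}
    (hK : K.IsComponentOf F) (hF : F.IsConnected) : K = F := by
  refine hK.1.isInducedSubgraph.ext_of_vertexSet (Set.Subset.antisymm hK.1.le.vertexSet_mono ?_)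
  obtain ⟨x, hx⟩ := (isConnected_iff_forall_closed.1 hK.2).1
  intro y hy
  exact (isConnected_iff_forall_closed.1 hF).2 V(K)
    (fun e a b hab ha => (hK.1.mem_iff_of_isLink hab).1 ha) x (hK.1.le.vertexSet_mono hx) y hy hx

lemma isFrame_of_isTwoConnected {V α β : Type*} [Finite V] {F : Graph α β} {G H : SimpleGraph V}
    (h2 : F.IsTwoConnected) (h3 : F.IsCubic) (hH : H ≤ G) (σ : Subdivision H F)
    (hc : H.CutConnected) (hV : Even (Nat.card V)) : IsFrame F G := by
  refine ⟨fun K hK => Or.inr (hK.eq_of_isConnected h2.1 ▸ ⟨h2, h3⟩), H, hH, ⟨σ⟩, fun c => ?_⟩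
  have huniv : c.supp = Set.univ := by
    refine (hc c.supp ?_).resolve_left c.nonempty_supp.ne_empty
    rw [outDarts_eq_empty_iff]
    intro x y hxy hx
    exact (c.mem_supp_congr_adj hxy).1 hx
  rw [huniv, Set.ncard_univ]
  exact ⟨Set.toFinite _, hV⟩

/-! ### Lifting circuits to the inflated graph -/

/-- A circuit of length 9 of the Petersen graph through the vertex `0` and its neighbours that does
not use the edge between `0` and its neighbour `s`. -/
def nineCycle (s : Fin 10) : List (Fin 10) :=
  if s = 1 then [0, 4, 3, 2, 1, 6, 9, 7, 5]
  else if s = 4 then [0, 1, 2, 3, 4, 9, 6, 8, 5]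
  else [0, 1, 2, 3, 8, 5, 7, 9, 4]

/-- The edges of `nineCycle s`. -/
def nineCycleGraph (s : Fin 10) : SimpleGraph (Fin 10) :=
  SimpleGraph.fromRel fun i j => (i, j) ∈ (nineCycle s).zip ((nineCycle s).rotate 1)

instance (s : Fin 10) : DecidableRel (nineCycleGraph s).Adj := fun i j => by
  unfold nineCycleGraph
  rw [SimpleGraph.fromRel_adj]
  infer_instance

lemma nineCycleGraph_adj_petersen : ∀ s, petersen.Adj 0 s → ∀ i j, (nineCycleGraph s).Adj i j →
    petersen.Adj i j := by
  decide +kernel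

lemma nineCycleGraph_adj_zero : ∀ s, petersen.Adj 0 s → ∀ q, (nineCycleGraph s).Adj 0 q ↔
    petersen.Adj 0 q ∧ q ≠ s := by
  decide +kernel

lemma nineCycleGraph_degree : ∀ s, petersen.Adj 0 s → ∀ i ∈ nineCycle s,
    ((nineCycleGraph s).neighborFinset i).card = 2 := by
  decide +kernel

lemma mem_nineCycle_of_adj : ∀ s, petersen.Adj 0 s → ∀ i j, (nineCycleGraph s).Adj i j →
    i ∈ nineCycle s := by
  decide +kernel

lemma nineCycle_tail_isChain : ∀ s, petersen.Adj 0 s →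
    (nineCycle s).tail.IsChain (nineCycleGraph s).Adj := by
  decide +kernel

lemma mem_nineCycle_tail_iff : ∀ s, ∀ i, i ∈ (nineCycle s).tail ↔ i ∈ nineCycle s ∧ i ≠ 0 := by
  decide +kernel

lemma mem_nineCycle_of_adj_zero : ∀ s, petersen.Adj 0 s → ∀ i, petersen.Adj 0 i →
    i ∈ nineCycle s := by
  decide +kernel

lemma exists_mem_nineCycle_adj : ∀ s, petersen.Adj 0 s → ∀ p : PVert, (p : Fin 10) ∈ nineCycle s ∨
    ∃ q : PVert, (q : Fin 10) ∈ nineCycle s ∧ petersen.Adj q p := by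
  decide +kernel

/-- Every vertex of `P` has distance at most 3 from each 2-valent vertex. -/
lemma exists_short_walk : ∀ q : PVert, petersen.Adj 0 q → ∀ p : PVert, p = q ∨
    petersenMinus.Adj q p ∨ (∃ a, petersenMinus.Adj q a ∧ petersenMinus.Adj a p) ∨
    ∃ a, petersenMinus.Adj q a ∧ ∃ b, petersenMinus.Adj a b ∧ petersenMinus.Adj b p := by
  have : DecidableRel petersenMinus.Adj := fun i j => inferInstanceAs (Decidable (petersen.Adj i j))
  have h : ∀ q : PVert, petersen.Adj 0 q → ∀ p : PVert, p = q ∨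
      petersen.Adj q p ∨ (∃ a : PVert, petersen.Adj q a ∧ petersen.Adj a p) ∨
      ∃ a : PVert, petersen.Adj q a ∧ ∃ b : PVert, petersen.Adj a b ∧ petersen.Adj b p := by
    decide +kernel
  exact h

lemma exists_port_adj : ∀ p : PVert, petersen.Adj 0 p ∨
    ∃ q : PVert, petersen.Adj 0 q ∧ petersen.Adj q p := by
  decide +kernel

section LiftCircuit

variable {V : Type} {G D : SimpleGraph V} {t : V → V → PVert}

/-- The circuit of the inflated graph that traverses the copies of the vertices of `D` along
circuits of length 9 of the Petersen graph. -/
def liftCircuit (G : SimpleGraph V) (t : V → V → PVert) (D : SimpleGraph V) :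
    SimpleGraph (V × PVert) where
  Adj x y := (x.1 = y.1 ∧ ∃ u, G.Adj x.1 u ∧ ¬ D.Adj x.1 u ∧ x.1 ∈ D.support ∧
      (nineCycleGraph (t x.1 u)).Adj x.2 y.2) ∨
    (D.Adj x.1 y.1 ∧ x.2 = t x.1 y.1 ∧ y.2 = t y.1 x.1)
  symm := ⟨by
    rintro x y (⟨h1, u, h2, h3, h4, h5⟩ | ⟨h1, h2, h3⟩)
    · exact Or.inl ⟨h1.symm, u, h1 ▸ h2, h1 ▸ h3, h1 ▸ h4, (h1 ▸ h5).symm⟩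
    · exact Or.inr ⟨h1.symm, h3, h2⟩⟩
  loopless := ⟨by
    rintro x (⟨_, _, _, _, _, h⟩ | ⟨h, _⟩)
    · exact h.ne rfl
    · exact h.ne rfl⟩

lemma liftCircuit_le (ht : IsAttachment G t) (hle : D ≤ G) :
    liftCircuit G t D ≤ inflate G t := by
  rintro x y (⟨h1, u, h2, h3, h4, h5⟩ | ⟨h1, h2, h3⟩)
  · exact Or.inl ⟨h1, nineCycleGraph_adj_petersen _ ((ht _).1 u h2) _ _ h5⟩
  · exact Or.inr ⟨hle h1, h2, h3⟩

/-- The vertex `u` ends the third edge at `v`; its port selects the 9-circuit used in the copy of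
`v`. -/
lemma exists_unique_adj_not_adj [Finite V] (h3 : ∀ v, (G.neighborSet v).ncard = 3) (hle : D ≤ G)
    (hD : D.IsCircuit) {v : V} (hv : v ∈ D.support) :
    ∃ u, G.Adj v u ∧ ∀ w, G.Adj v w → (D.Adj v w ↔ w ≠ u) := by
  have hsub : D.neighborSet v ⊆ G.neighborSet v := fun w hw => hle hw
  have h2 : (D.neighborSet v).ncard = 2 := by
    rw [Set.ncard, hD.degree v hv]
    rfl
  have h1 : (G.neighborSet v \ D.neighborSet v).ncard = 1 := by
    have := Set.ncard_sdiff_add_ncard_of_subset hsub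
    rw [h3, h2] at this
    omega
  obtain ⟨u, hu⟩ := Set.ncard_eq_one.1 h1
  have huu : u ∈ G.neighborSet v \ D.neighborSet v := hu ▸ Set.mem_singleton u
  refine ⟨u, huu.1, fun w hw => ⟨?_, fun hwu => ?_⟩⟩
  · rintro h rfl
    exact huu.2 h
  · by_contra hD
    have : w ∈ G.neighborSet v \ D.neighborSet v := ⟨hw, hD⟩
    rw [hu] at this
    exact hwu this

/-- Seen from one copy, the lifted circuit closes up through `0` to a 9-circuit. Its degrees can
therefore be read off in the Petersen graph. -/
lemma contract_collapse_liftCircuit (ht : IsAttachment G t)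
    (h3 : ∀ v, (G.neighborSet v).ncard = 3) (hle : D ≤ G) {v u : V}
    (hv : v ∈ D.support) (hvu : G.Adj v u) (hu : ∀ w, G.Adj v w → (D.Adj v w ↔ w ≠ u)) :
    contract (collapse v) (liftCircuit G t D) = nineCycleGraph (t v u) := by
  have hport := (ht v).1 u hvu
  apply le_antisymm
  · have key : ∀ x y, (liftCircuit G t D).Adj x y → x.1 = v →
        (nineCycleGraph (t v u)).Adj (collapse v x) (collapse v y) := by
      rintro ⟨w, p⟩ ⟨w', q⟩ h rfl
      rcases h with ⟨h1, u', h2, h3, h4, h5⟩ | ⟨h1, h2, h3⟩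
      · dsimp only at h1 h2 h3 h5
        subst h1
        rw [collapse_mk, collapse_mk]
        have : u' = u := by
          by_contra hne
          exact h3 ((hu u' h2).2 hne)
        exact this ▸ h5
      · dsimp only at h1 h2 h3
        rw [(collapse_eq_zero_iff (v := w) (x := (w', q))).2 h1.ne', collapse_mk]
        refine ((nineCycleGraph_adj_zero _ hport _).2 ?_).symm
        rw [h2]
        refine ⟨(ht w).1 w' (hle h1), fun e => ?_⟩
        exact (hu w' (hle h1)).1 h1 ((ht w).2 (hle h1) hvu (Subtype.ext e))
    rintro p q ⟨hne, x, y, h, rfl, rfl⟩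
    by_cases hx : x.1 = v
    · exact key x y h hx
    · by_cases hy : y.1 = v
      · exact (key y x h.symm hy).symm
      · exact absurd ((collapse_eq_zero_iff.2 hx).trans (collapse_eq_zero_iff.2 hy).symm) hne
  · have key : ∀ q, (nineCycleGraph (t v u)).Adj 0 q →
        (contract (collapse v) (liftCircuit G t D)).Adj 0 q := by
      intro q hq
      obtain ⟨hq0, hqu⟩ := (nineCycleGraph_adj_zero _ hport q).1 hq
      obtain ⟨w, hw, hwq⟩ := ht.exists_adj_eq h3 v (q := ⟨q, hq0.ne'⟩) hq0
      have hDw : D.Adj v w := (hu w hw).2 fun e => hqu (by rw [← e, hwq])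
      refine ⟨hq.ne, (w, t w v), (v, t v w), Or.inr ⟨hDw.symm, rfl, rfl⟩,
        collapse_eq_zero_iff.2 hw.ne', ?_⟩
      rw [collapse_mk, hwq]
    intro p q hpq
    by_cases hp : p = 0
    · subst hp
      exact key q hpq
    · by_cases hq : q = 0
      · subst hq
        exact (key p hpq.symm).symm
      · refine ⟨hpq.ne, (v, ⟨p, hp⟩), (v, ⟨q, hq⟩), Or.inl ⟨rfl, u, hvu, ?_, hv, hpq⟩,
          collapse_mk _ _, collapse_mk _ _⟩
        exact fun h => (hu u hvu).1 h rfl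

lemma fst_mem_support_of_liftCircuit {x : V × PVert} (hx : x ∈ (liftCircuit G t D).support) :
    x.1 ∈ D.support := by
  obtain ⟨y, ⟨_, _, _, _, h, _⟩ | ⟨h, _⟩⟩ := hx
  · exact h
  · exact ⟨_, h⟩

lemma mem_support_liftCircuit_iff [Finite V] (ht : IsAttachment G t)
    (h3 : ∀ v, (G.neighborSet v).ncard = 3) (hle : D ≤ G) {v u : V}
    (hv : v ∈ D.support) (hvu : G.Adj v u) (hu : ∀ w, G.Adj v w → (D.Adj v w ↔ w ≠ u))
    (p : PVert) : (v, p) ∈ (liftCircuit G t D).support ↔ (p : Fin 10) ∈ nineCycle (t v u) := by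
  have h1 := ncard_neighborSet_contract_collapse ht (liftCircuit_le ht hle) v p
  rw [contract_collapse_liftCircuit ht h3 hle hv hvu hu] at h1
  have hport := (ht v).1 u hvu
  constructor
  · intro ⟨y, hy⟩
    have : 0 < ((liftCircuit G t D).neighborSet (v, p)).ncard :=
      (Set.ncard_pos (Set.toFinite _)).2 ⟨y, hy⟩
    rw [← h1, Set.ncard_pos] at this
    obtain ⟨q, hq⟩ := this
    exact mem_nineCycle_of_adj _ hport _ q hq
  · intro hp
    have h2 := nineCycleGraph_degree _ hport _ hp
    have : 0 < ((liftCircuit G t D).neighborSet (v, p)).ncard := by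
      rw [← h1, Set.ncard_eq_toFinset_card']
      exact h2.symm ▸ Nat.succ_pos 1
    rw [Set.ncard_pos] at this
    exact this

/-- The 9-circuit visits all three neighbours of `0`, hence also the port of the edge that `D` does
not use. Distances thus start at 0 from every port of such a copy. -/
lemma attachment_mem_support_liftCircuit [Finite V] (ht : IsAttachment G t)
    (h3 : ∀ v, (G.neighborSet v).ncard = 3) (hle : D ≤ G) (hD : D.IsCircuit) {v w : V}
    (hv : v ∈ D.support) (hvw : G.Adj v w) : (v, t v w) ∈ (liftCircuit G t D).support := by
  obtain ⟨u, hvu, hu⟩ := exists_unique_adj_not_adj h3 hle hD hv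
  rw [mem_support_liftCircuit_iff ht h3 hle hv hvu hu]
  exact mem_nineCycle_of_adj_zero _ ((ht v).1 u hvu) _ ((ht v).1 w hvw)

/-- Within a copy the 9-circuit minus `0` is a path; the copies are linked in the way `D` links its
vertices. -/
lemma liftCircuit_isCircuit [Finite V] (ht : IsAttachment G t)
    (h3 : ∀ v, (G.neighborSet v).ncard = 3) (hle : D ≤ G) (hD : D.IsCircuit) :
    (liftCircuit G t D).IsCircuit := by
  refine ⟨?_, ?_, ?_⟩
  · obtain ⟨v, w, h⟩ := hD.nonempty
    exact ⟨(v, t v w), (w, t w v), Or.inr ⟨h, rfl, rfl⟩⟩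
  · rintro ⟨v, p⟩ hx
    have hv : v ∈ D.support := fst_mem_support_of_liftCircuit hx
    obtain ⟨u, hvu, hu⟩ := exists_unique_adj_not_adj h3 hle hD hv
    rw [mem_support_liftCircuit_iff ht h3 hle hv hvu hu] at hx
    rw [← Set.Finite.cast_ncard_eq (Set.toFinite _),
      ← ncard_neighborSet_contract_collapse ht (liftCircuit_le ht hle) v p,
      contract_collapse_liftCircuit ht h3 hle hv hvu hu, Set.ncard_eq_toFinset_card']
    have := nineCycleGraph_degree _ ((ht v).1 u hvu) _ hx
    exact congrArg Nat.cast this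
  · intro T hT
    have hTiff : ∀ x y, (liftCircuit G t D).Adj x y → (x ∈ T ↔ y ∈ T) := fun x y h =>
      ⟨hT x y h, hT y x h.symm⟩
    have hfib : ∀ v p q, (v, p) ∈ (liftCircuit G t D).support →
        (v, q) ∈ (liftCircuit G t D).support → (v, p) ∈ T → (v, q) ∈ T := by
      intro v p q hp hq hpT
      have hv : v ∈ D.support := fst_mem_support_of_liftCircuit hp
      obtain ⟨u, hvu, hu⟩ := exists_unique_adj_not_adj h3 hle hD hv
      rw [mem_support_liftCircuit_iff ht h3 hle hv hvu hu] at hp hq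
      have := mem_iff_mem_of_isChain (S := {a | ∃ h : a ≠ 0, (v, (⟨a, h⟩ : PVert)) ∈ T})
        (nineCycle_tail_isChain _ ((ht v).1 u hvu)) ?_ p
        ((mem_nineCycle_tail_iff _ _).2 ⟨hp, p.2⟩) q ((mem_nineCycle_tail_iff _ _).2 ⟨hq, q.2⟩)
      · exact (this.1 ⟨p.2, hpT⟩).2
      · intro a ha b hb hab
        rw [mem_nineCycle_tail_iff] at ha hb
        have := hTiff (v, ⟨a, ha.2⟩) (v, ⟨b, hb.2⟩)
          (Or.inl ⟨rfl, u, hvu, fun h => (hu u hvu).1 h rfl, hv, hab⟩)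
        exact ⟨fun ⟨_, h⟩ => ⟨hb.2, this.1 h⟩, fun ⟨_, h⟩ => ⟨ha.2, this.2 h⟩⟩
    have hcl := hD.connected {v | ∃ p, (v, p) ∈ (liftCircuit G t D).support ∧ (v, p) ∈ T} (by
      rintro v w hvw ⟨p, hp, hpT⟩
      have h1 : (liftCircuit G t D).Adj (v, t v w) (w, t w v) := Or.inr ⟨hvw, rfl, rfl⟩
      exact ⟨t w v, ⟨_, h1.symm⟩, hT _ _ h1 (hfib v p _ hp ⟨_, h1⟩ hpT)⟩)
    rintro ⟨v, p⟩ hp ⟨w, q⟩ hq hpT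
    obtain ⟨q', hq', hqT⟩ := hcl v (fst_mem_support_of_liftCircuit hp) w
      (fst_mem_support_of_liftCircuit hq) ⟨p, hp, hpT⟩
    exact hfib w q' q hq' hq hqT

lemma coversWithin_one_liftCircuit [Finite V] (ht : IsAttachment G t)
    (h3 : ∀ v, (G.neighborSet v).ncard = 3) (hle : D ≤ G) (hD : D.IsCircuit) {v : V}
    (hv : v ∈ D.support) (p : PVert) :
    (liftCircuit G t D).CoversWithin (inflate G t) 1 (v, p) := by
  obtain ⟨u, hvu, hu⟩ := exists_unique_adj_not_adj h3 hle hD hv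
  have hmem := mem_support_liftCircuit_iff ht h3 hle hv hvu hu
  rcases exists_mem_nineCycle_adj _ ((ht v).1 u hvu) p with h | ⟨q, hq, hqp⟩
  · exact (coversWithin_of_mem_support _ ((hmem p).2 h)).mono (Nat.zero_le 1)
  · exact (coversWithin_of_mem_support _ ((hmem q).2 hq)).step (Or.inl ⟨rfl, hqp⟩)

lemma SimpleGraph.Walk.exists_eq_concat {u v : V} (p : G.Walk u v) (hp : p.length ≠ 0) :
    ∃ (w : V) (q : G.Walk u w) (h : G.Adj w v), p = q.concat h := by
  cases p with
  | nil => exact absurd rfl hp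
  | cons h q => exact Walk.exists_cons_eq_concat h q

lemma SimpleGraph.CoversWithin.fiber {D' : SimpleGraph (V × PVert)} {n : ℕ} {v u : V}
    (ht : IsAttachment G t) (hvu : G.Adj v u) (h : D'.CoversWithin (inflate G t) n (v, t v u)) (p : PVert) :
    D'.CoversWithin (inflate G t) (n + 3) (v, p) := by
  have hadj : ∀ a b, petersenMinus.Adj a b → (inflate G t).Adj (v, a) (v, b) :=
    fun a b hab => Or.inl ⟨rfl, hab⟩
  rcases exists_short_walk _ ((ht v).1 u hvu) p with rfl | h1 | ⟨a, h1, h2⟩ | ⟨a, h1, b, h2, h3⟩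
  · exact h.mono (by omega)
  · exact (h.step (hadj _ _ h1)).mono (by omega)
  · exact ((h.step (hadj _ _ h1)).step (hadj _ _ h2)).mono (by omega)
  · exact ((h.step (hadj _ _ h1)).step (hadj _ _ h2)).step (hadj _ _ h3)

/-- Each edge of a path in `G` costs 1, and reaching any vertex of the copy entered costs at most 3
more. The bound `1 ≤ n` is for copies on the circuit, which have a vertex at distance 1 from it. -/
lemma coversWithin_liftCircuit [Finite V] (ht : IsAttachment G t)
    (h3 : ∀ v, (G.neighborSet v).ncard = 3) (hle : D ≤ G) (hD : D.IsCircuit) {n : ℕ} (hn : 1 ≤ n)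
    (hcov : ∀ v, D.CoversWithin G n v) (x : V × PVert) :
    (liftCircuit G t D).CoversWithin (inflate G t) (4 * n) x := by
  have hstep : ∀ {m : ℕ} {v w : V}, G.Adj v w →
      (liftCircuit G t D).CoversWithin (inflate G t) m (v, t v w) →
      (liftCircuit G t D).CoversWithin (inflate G t) (m + 1) (w, t w v) :=
    fun hvw h => h.step (Or.inr ⟨hvw, rfl, rfl⟩)
  have key : ∀ m v (c : V), c ∈ D.support → ∀ p : G.Walk c v, p.length = m → ∀ u, G.Adj v u →
      (liftCircuit G t D).CoversWithin (inflate G t) (4 * m) (v, t v u) := by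
    intro m
    induction m with
    | zero =>
      intro v c hc p hp u hvu
      obtain rfl := Walk.eq_of_length_eq_zero hp
      exact coversWithin_of_mem_support _ (attachment_mem_support_liftCircuit ht h3 hle hD hc hvu)
    | succ m ih =>
      intro v c hc p hp u hvu
      obtain ⟨w, q, hwv, rfl⟩ := p.exists_eq_concat (by omega)
      rw [Walk.length_concat] at hp
      exact (hstep hwv (ih w c hc q (by omega) v hwv)).fiber ht hwv.symm _
  obtain ⟨v, p⟩ := x
  obtain ⟨c, hc, w, hw⟩ := hcov v
  rcases Nat.eq_zero_or_pos w.length with h0 | hpos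
  · obtain rfl := Walk.eq_of_length_eq_zero h0
    exact (coversWithin_one_liftCircuit ht h3 hle hD hc p).mono (by omega)
  · obtain ⟨m, hm⟩ := Nat.exists_eq_succ_of_ne_zero hpos.ne'
    obtain ⟨v', q, hv', rfl⟩ := w.exists_eq_concat hpos.ne'
    rw [Walk.length_concat] at hm hw
    have := (hstep hv' (key m v' c hc q (by omega) v hv')).fiber ht hv'.symm p
    exact this.mono (by omega)

end LiftCircuit

lemma nineCycleGraph_isCircuit : (nineCycleGraph 1).IsCircuit := by
  have h01 : petersen.Adj 0 1 := by decide
  have hmem : ∀ i, i ∈ (nineCycleGraph 1).support ↔ i ∈ nineCycle 1 := by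
    refine fun i => ⟨fun ⟨j, hj⟩ => mem_nineCycle_of_adj 1 h01 i j hj, fun hi => ?_⟩
    have := nineCycleGraph_degree 1 h01 i hi
    obtain ⟨j, hj⟩ := Finset.card_pos.1 (this.symm ▸ Nat.succ_pos 1 :
      0 < ((nineCycleGraph 1).neighborFinset i).card)
    exact ⟨j, by simpa using hj⟩
  refine ⟨⟨0, (hmem 0).2 (by decide)⟩, fun v hv => ?_, fun T hT x hx y hy => ?_⟩
  · rw [← Set.Finite.cast_ncard_eq (Set.toFinite _), Set.ncard_eq_toFinset_card']
    exact congrArg Nat.cast (nineCycleGraph_degree 1 h01 v ((hmem v).1 hv))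
  · have hch : (nineCycle 1).IsChain (nineCycleGraph 1).Adj := by decide +kernel
    exact (mem_iff_mem_of_isChain hch (fun a _ b _ hab => ⟨hT a b hab, hT b a hab.symm⟩)
      x ((hmem x).1 hx) y ((hmem y).1 hy)).1

lemma nineCycleGraph_le : nineCycleGraph 1 ≤ petersen :=
  fun i j h => nineCycleGraph_adj_petersen 1 (by decide) i j h

/-- Every vertex of the Petersen graph lies on the circuit or has all its neighbours on it. -/
lemma petersen_mem_support_or (v : Fin 10) : v ∈ (nineCycleGraph 1).support ∨
    ∀ u, petersen.Adj v u → u ∈ (nineCycleGraph 1).support := by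
  have : ∀ v, (∃ w, (nineCycleGraph 1).Adj v w) ∨
      ∀ u, petersen.Adj v u → ∃ w, (nineCycleGraph 1).Adj u w := by
    decide +kernel
  exact this v

lemma exists_petersen_adj : ∀ v, ∃ u, petersen.Adj u v := by decide

lemma nineCycleGraph_coversWithin (v : Fin 10) :
    (nineCycleGraph 1).CoversWithin petersen 1 v := by
  rcases petersen_mem_support_or v with h | h
  · exact (coversWithin_of_mem_support _ h).mono (Nat.zero_le 1)
  · obtain ⟨u, hu⟩ := exists_petersen_adj v
    exact (coversWithin_of_mem_support _ (h u hu.symm)).step hu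

/-- The missed vertex of the Petersen graph has all its neighbours on the circuit, so its copy is
approached through all three ports, and every vertex of `P` is a port or adjacent to one. This gives
2 where the general step would give 4. -/
lemma coversWithin_two_of_inflate_petersen {t : Fin 10 → Fin 10 → PVert}
    (ht : IsAttachment petersen t) (x : Fin 10 × PVert) :
    (liftCircuit petersen t (nineCycleGraph 1)).CoversWithin (inflate petersen t) 2 x := by
  have h3 := petersen_neighborSet_ncard
  have hle := nineCycleGraph_le
  have hD := nineCycleGraph_isCircuit
  obtain ⟨v, p⟩ := x
  rcases petersen_mem_support_or v with h | h
  · exact (coversWithin_one_liftCircuit ht h3 hle hD h p).mono one_le_two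
  · have hport : ∀ q : PVert, petersen.Adj 0 q →
        (liftCircuit petersen t (nineCycleGraph 1)).CoversWithin (inflate petersen t) 1 (v, q) := by
      intro q hq
      obtain ⟨u, hvu, rfl⟩ := ht.exists_adj_eq h3 v hq
      exact (coversWithin_of_mem_support _
        (attachment_mem_support_liftCircuit ht h3 hle hD (h u hvu) hvu.symm)).step
        (Or.inr ⟨hvu.symm, rfl, rfl⟩)
    rcases exists_port_adj p with hp | ⟨q, hq, hqp⟩
    · exact (hport p hp).mono one_le_two
    · exact (hport q hq).step (Or.inl ⟨rfl, hqp⟩)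

lemma IsIteratedPetersen.exists_isCircuit_coversWithin : ∀ {k : ℕ}
    {Q : SimpleGraph (IterVert (k + 1))}, IsIteratedPetersen (k + 1) Q →
    ∃ D ≤ Q, D.IsCircuit ∧ ∀ v, D.CoversWithin Q (2 * 4 ^ k) v
  | 0, Q, ⟨G, t, hG, ht, hQ⟩ => by
    have h : G = petersen := hG
    subst h
    subst hQ
    exact ⟨liftCircuit petersen t (nineCycleGraph 1), liftCircuit_le ht nineCycleGraph_le,
      liftCircuit_isCircuit ht petersen_neighborSet_ncard nineCycleGraph_le
        nineCycleGraph_isCircuit, coversWithin_two_of_inflate_petersen ht⟩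
  | k + 1, Q, ⟨G, t, hG, ht, hQ⟩ => by
    subst hQ
    obtain ⟨D, hle, hD, hcov⟩ := hG.exists_isCircuit_coversWithin
    refine ⟨liftCircuit G t D, liftCircuit_le ht hle,
      liftCircuit_isCircuit ht hG.ncard_neighborSet hle hD, fun v => ?_⟩
    refine (coversWithin_liftCircuit ht hG.ncard_neighborSet hle hD ?_ hcov v).mono ?_
    · have := Nat.one_le_pow k 4 (by norm_num)
      omega
    · rw [pow_succ']
      omega

/-! ### An iterated Petersen graph is a frame of the next one -/

/-- The centre of a spanning subdivided claw of `P`. -/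
def clawCenter : PVert := ⟨2, by decide⟩

/-- The vertices of the leg of the claw that ends in the 2-valent vertex `q`. -/
def clawLeg (q : PVert) : List (Fin 10) :=
  if q.1 = 1 then [2, 1] else if q.1 = 4 then [2, 3, 4] else [2, 7, 9, 6, 8, 5]

/-- A spanning tree of `P` that subdivides a claw and whose leaves are the 2-valent vertices. -/
def claw : SimpleGraph PVert where
  Adj a b := petersen.Adj a b ∧ (a.1, b.1) ∉ [((1 : Fin 10), (6 : Fin 10)), (6, 1), (3, 8), (8, 3),
    (4, 9), (9, 4), (5, 7), (7, 5)]
  symm := ⟨by decide +kernel⟩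
  loopless := ⟨fun a h => h.1.ne rfl⟩

instance : DecidableRel claw.Adj := fun a b => by
  unfold claw
  infer_instance

lemma claw_le : claw ≤ petersenMinus := fun _ _ h => h.1

lemma clawLeg_inter : ∀ q q' : PVert, petersen.Adj 0 q → petersen.Adj 0 q' → q ≠ q' →
    ∀ a : PVert, (a : Fin 10) ∈ clawLeg q → (a : Fin 10) ∈ clawLeg q' → a = clawCenter := by
  decide +kernel

lemma exists_clawLeg_of_adj : ∀ a b, claw.Adj a b → ∃ q : PVert, petersen.Adj 0 q ∧
    (a : Fin 10) ∈ clawLeg q ∧ (b : Fin 10) ∈ clawLeg q := by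
  decide +kernel

lemma exists_mem_clawLeg :
    ∀ a : PVert, ∃ q : PVert, petersen.Adj 0 q ∧ (a : Fin 10) ∈ clawLeg q := by
  decide +kernel

lemma not_adj_clawCenter : ¬ petersen.Adj 0 clawCenter := by decide

set_option synthInstance.maxSize 1024 in
lemma exists_claw_walk (q : PVert) (hq : petersen.Adj 0 q) :
    ∃ w : claw.Walk clawCenter q, w.IsPath ∧ (∀ a, a ∈ w.support ↔ (a : Fin 10) ∈ clawLeg q) ∧
      ∀ a b, claw.Adj a b → (a : Fin 10) ∈ clawLeg q → (b : Fin 10) ∈ clawLeg q →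
        s(a, b) ∈ w.edges := by
  have h : q = ⟨1, by decide⟩ ∨ q = ⟨4, by decide⟩ ∨ q = ⟨5, by decide⟩ := by
    revert q; decide
  rcases h with rfl | rfl | rfl
  · have h1 : claw.Adj clawCenter ⟨1, by decide⟩ := by decide
    refine ⟨.cons h1 .nil, ?_, ?_, ?_⟩
    · simp only [Walk.isPath_def, Walk.support_cons, Walk.support_nil]; decide
    · simp only [Walk.support_cons, Walk.support_nil]; decide +kernel
    · simp only [Walk.edges_cons, Walk.edges_nil, List.mem_cons, List.not_mem_nil, or_false,
        Sym2.eq_iff]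
      decide +kernel
  · have h1 : claw.Adj clawCenter ⟨3, by decide⟩ := by decide
    have h2 : claw.Adj ⟨3, by decide⟩ ⟨4, by decide⟩ := by decide
    refine ⟨.cons h1 (.cons h2 .nil), ?_, ?_, ?_⟩
    · simp only [Walk.isPath_def, Walk.support_cons, Walk.support_nil]; decide
    · simp only [Walk.support_cons, Walk.support_nil]; decide +kernel
    · simp only [Walk.edges_cons, Walk.edges_nil, List.mem_cons, List.not_mem_nil, or_false,
        Sym2.eq_iff]
      decide +kernel
  · have h1 : claw.Adj clawCenter ⟨7, by decide⟩ := by decide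
    have h2 : claw.Adj ⟨7, by decide⟩ ⟨9, by decide⟩ := by decide
    have h3 : claw.Adj ⟨9, by decide⟩ ⟨6, by decide⟩ := by decide
    have h4 : claw.Adj ⟨6, by decide⟩ ⟨8, by decide⟩ := by decide
    have h5 : claw.Adj ⟨8, by decide⟩ ⟨5, by decide⟩ := by decide
    refine ⟨.cons h1 (.cons h2 (.cons h3 (.cons h4 (.cons h5 .nil)))), ?_, ?_, ?_⟩
    · simp only [Walk.isPath_def, Walk.support_cons, Walk.support_nil]; decide
    · simp only [Walk.support_cons, Walk.support_nil]; decide +kernel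
    · simp only [Walk.edges_cons, Walk.edges_nil, List.mem_cons, List.not_mem_nil, or_false,
        Sym2.eq_iff]
      decide +kernel

section ClawInflate

variable {V : Type} {G : SimpleGraph V} {t : V → V → PVert}

/-- The spanning subgraph of the inflated graph in which every copy of `P` is replaced by its
spanning subdivided claw. -/
def clawInflate (G : SimpleGraph V) (t : V → V → PVert) : SimpleGraph (V × PVert) where
  Adj x y := (x.1 = y.1 ∧ claw.Adj x.2 y.2) ∨
    (G.Adj x.1 y.1 ∧ x.2 = t x.1 y.1 ∧ y.2 = t y.1 x.1)
  symm := ⟨by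
    rintro x y (⟨h1, h2⟩ | ⟨h1, h2, h3⟩)
    · exact Or.inl ⟨h1.symm, h2.symm⟩
    · exact Or.inr ⟨h1.symm, h3, h2⟩⟩
  loopless := ⟨by
    rintro x (⟨_, h⟩ | ⟨h, _⟩)
    · exact h.ne rfl
    · exact h.ne rfl⟩

lemma clawInflate_le : clawInflate G t ≤ inflate G t := by
  rintro x y (⟨h1, h2⟩ | h)
  · exact Or.inl ⟨h1, claw_le h2⟩
  · exact Or.inr h

/-- The embedding of the claw as the copy that belongs to `v`. -/
def clawHom (G : SimpleGraph V) (t : V → V → PVert) (v : V) : claw →g clawInflate G t where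
  toFun p := (v, p)
  map_rel' h := Or.inl ⟨rfl, h⟩

lemma clawInflate_cutConnected (hG : G.CutConnected) : (clawInflate G t).CutConnected := by
  intro S hS
  rw [outDarts_eq_empty_iff] at hS
  have hfib : ∀ v p, (v, p) ∈ S ↔ (v, clawCenter) ∈ S := by
    intro v p
    have hport : ∀ q : PVert, petersen.Adj 0 q → ∀ a : PVert, (a : Fin 10) ∈ clawLeg q →
        ((v, a) ∈ S ↔ (v, clawCenter) ∈ S) := by
      intro q hq a ha
      obtain ⟨w, -, hw, -⟩ := exists_claw_walk q hq
      exact w.mem_iff_of_mem_support {a | (v, a) ∈ S}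
        (fun a b hab => hS (v, a) (v, b) (Or.inl ⟨rfl, w.adj_of_mem_edges hab⟩)) a ((hw a).2 ha)
    obtain ⟨q, hq, hp⟩ := exists_mem_clawLeg p
    exact hport q hq p hp
  have hcl : G.outDarts {v | (v, clawCenter) ∈ S} = ∅ := by
    rw [outDarts_eq_empty_iff]
    intro v u hvu hv
    have : (u, t u v) ∈ S :=
      hS (v, t v u) (u, t u v) (Or.inr ⟨hvu, rfl, rfl⟩) ((hfib v _).2 hv)
    exact (hfib u _).1 this
  rcases hG _ hcl with h | h
  · left
    rw [Set.eq_empty_iff_forall_notMem] at h ⊢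
    rintro ⟨v, p⟩ hv
    exact h v ((hfib v p).1 hv)
  · right
    rw [Set.eq_univ_iff_forall] at h ⊢
    rintro ⟨v, p⟩
    exact (hfib v p).2 (h v)

/-- The path runs along a leg of the claw at `x`, over the edge between the copies, and back along a
leg at `y`. -/
lemma exists_clawInflate_walk (ht : IsAttachment G t) {x y : V} (hxy : G.Adj x y) :
    ∃ w : (clawInflate G t).Walk (x, clawCenter) (y, clawCenter), w.IsPath ∧
      (∀ z, z ∈ w.support ↔ (z.1 = x ∧ (z.2 : Fin 10) ∈ clawLeg (t x y)) ∨
        (z.1 = y ∧ (z.2 : Fin 10) ∈ clawLeg (t y x))) ∧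
      (∀ a b, claw.Adj a b → (a : Fin 10) ∈ clawLeg (t x y) → (b : Fin 10) ∈ clawLeg (t x y) →
        s((x, a), (x, b)) ∈ w.edges) ∧
      (∀ a b, claw.Adj a b → (a : Fin 10) ∈ clawLeg (t y x) → (b : Fin 10) ∈ clawLeg (t y x) →
        s((y, a), (y, b)) ∈ w.edges) ∧
      s((x, t x y), (y, t y x)) ∈ w.edges := by
  obtain ⟨w, hw1, hw2, hw3⟩ := exists_claw_walk _ ((ht x).1 y hxy)
  obtain ⟨w', hw1', hw2', hw3'⟩ := exists_claw_walk _ ((ht y).1 x hxy.symm)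
  have hcross : (clawInflate G t).Adj (clawHom G t x (t x y)) (clawHom G t y (t y x)) :=
    Or.inr ⟨hxy, rfl, rfl⟩
  have hinj : ∀ v, Function.Injective (clawHom G t v) := fun v => Prod.mk_right_injective v
  have hs : ∀ (v : V) (q : PVert) (w : claw.Walk clawCenter q),
      ∀ z, z ∈ (w.map (clawHom G t v)).support ↔ z.1 = v ∧ z.2 ∈ w.support := by
    intro v q w z
    rw [Walk.support_map, List.mem_map]
    constructor
    · rintro ⟨a, ha, rfl⟩
      exact ⟨rfl, ha⟩
    · obtain ⟨u, a⟩ := z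
      rintro ⟨rfl, ha⟩
      exact ⟨a, ha, rfl⟩
  obtain ⟨p, hsup, hedge⟩ : ∃ p : (clawInflate G t).Walk (x, clawCenter) (y, clawCenter),
      p.support = (w.map (clawHom G t x)).support ++ (w'.map (clawHom G t y)).support.reverse ∧
      p.edges = w.edges.map (Sym2.map (clawHom G t x)) ++
        s((x, t x y), (y, t y x)) :: (w'.edges.map (Sym2.map (clawHom G t y))).reverse := by
    have h1 : ((w.map (clawHom G t x)).append
        (.cons hcross (w'.map (clawHom G t y)).reverse)).support =
        (w.map (clawHom G t x)).support ++ (w'.map (clawHom G t y)).support.reverse := by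
      rw [Walk.support_append, Walk.support_cons, List.tail_cons, Walk.support_reverse]
    have h2 : ((w.map (clawHom G t x)).append
        (.cons hcross (w'.map (clawHom G t y)).reverse)).edges =
        w.edges.map (Sym2.map (clawHom G t x)) ++
        s(clawHom G t x (t x y), clawHom G t y (t y x)) ::
          (w'.edges.map (Sym2.map (clawHom G t y))).reverse := by
      rw [Walk.edges_append, Walk.edges_cons, Walk.edges_reverse, Walk.edges_map, Walk.edges_map]
    exact ⟨_, h1, h2⟩
  refine ⟨p, ?_, ?_, ?_, ?_, ?_⟩
  · rw [Walk.isPath_def, hsup, List.nodup_append']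
    refine ⟨(hw1.map (hinj x)).support_nodup,
      List.nodup_reverse.2 (hw1'.map (hinj y)).support_nodup, ?_⟩
    intro z hz hz'
    rw [List.mem_reverse, hs] at hz'
    rw [hs] at hz
    exact hxy.ne (hz.1.symm.trans hz'.1)
  · intro z
    rw [hsup, List.mem_append, List.mem_reverse, hs, hs, hw2, hw2']
  · intro a b hab ha hb
    rw [hedge, List.mem_append]
    exact Or.inl (List.mem_map.2 ⟨s(a, b), hw3 a b hab ha hb, rfl⟩)
  · intro a b hab ha hb
    rw [hedge, List.mem_append, List.mem_cons, List.mem_reverse]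
    exact Or.inr (Or.inr (List.mem_map.2 ⟨s(a, b), hw3' a b hab ha hb, rfl⟩))
  · rw [hedge, List.mem_append, List.mem_cons]
    exact Or.inr (Or.inl rfl)

/-- The claw centres are the branch vertices. Each edge of `G` takes one leg from each end, and
different edges at a vertex take different legs. -/
lemma nonempty_subdivision_clawInflate (ht : IsAttachment G t)
    (h3 : ∀ v, (G.neighborSet v).ncard = 3) :
    Nonempty (Subdivision (clawInflate G t) (liftGraph.{u, v} G Set.univ)) := by
  set F := liftGraph.{u, v} G Set.univ with hF
  have hlink : ∀ e : E(F), ∃ x y : V(F), F.IsLink e x y := by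
    rintro ⟨e, x, y, h⟩
    exact ⟨⟨x, Set.mem_univ _⟩, ⟨y, Set.mem_univ _⟩, h⟩
  choose src tgt hl using hlink
  have hadj : ∀ e, G.Adj (src e).1.down (tgt e).1.down := fun e => (hl e).2.1
  have hdown : ∀ e, e.1.down = s((src e).1.down, (tgt e).1.down) := fun e => (hl e).1
  choose walk hpath hsupp hedge hedge' hcross using fun e => exists_clawInflate_walk ht (hadj e)
  -- This description does not depend on which end of `e` was chosen as source.
  have hsupp' : ∀ e z, z ∈ (walk e).support ↔ ∃ u, e.1.down = s(z.1, u) ∧ G.Adj z.1 u ∧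
      (z.2 : Fin 10) ∈ clawLeg (t z.1 u) := by
    intro e z
    rw [hsupp, hdown]
    constructor
    · rintro (⟨h1, h2⟩ | ⟨h1, h2⟩)
      · rw [← h1] at h2
        exact ⟨_, by rw [h1], h1 ▸ hadj e, h2⟩
      · rw [← h1] at h2
        exact ⟨_, by rw [h1, Sym2.eq_swap], h1 ▸ (hadj e).symm, h2⟩
    · rintro ⟨u, h1, h2, h4⟩
      rcases Sym2.eq_iff.1 h1 with ⟨h5, h6⟩ | ⟨h5, h6⟩
      · left
        rw [← h5, ← h6] at h4
        exact ⟨h5.symm, h4⟩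
      · right
        rw [← h5, ← h6] at h4
        exact ⟨h6.symm, h4⟩
  have hinter : ∀ e e', e ≠ e' → ∀ z, z ∈ (walk e).support → z ∈ (walk e').support →
      z.2 = clawCenter := by
    intro e e' hne z hz hz'
    obtain ⟨u, h1, h2, h4⟩ := (hsupp' e z).1 hz
    obtain ⟨u', h1', h2', h4'⟩ := (hsupp' e' z).1 hz'
    refine clawLeg_inter _ _ ((ht _).1 u h2) ((ht _).1 u' h2') (fun h => hne ?_) _ h4 h4'
    obtain rfl := (ht _).2 h2 h2' h
    exact Subtype.ext (ULift.ext _ _ (h1.trans h1'.symm))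
  have hE : ∀ a b, G.Adj a b → (⟨s(a, b)⟩ : ULift.{v} (Sym2 V)) ∈ E(F) := fun a b hab =>
    ⟨⟨a⟩, ⟨b⟩, rfl, hab, Set.mem_univ _, Set.mem_univ _⟩
  have hedge₁ : ∀ e x u, (src e).1.down = x → (tgt e).1.down = u → ∀ p q, claw.Adj p q →
      (p : Fin 10) ∈ clawLeg (t x u) → (q : Fin 10) ∈ clawLeg (t x u) →
      s((x, p), (x, q)) ∈ (walk e).edges := by
    rintro e _ _ rfl rfl
    exact hedge e
  have hedge₂ : ∀ e x u, (src e).1.down = x → (tgt e).1.down = u → ∀ p q, claw.Adj p q →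
      (p : Fin 10) ∈ clawLeg (t u x) → (q : Fin 10) ∈ clawLeg (t u x) →
      s((u, p), (u, q)) ∈ (walk e).edges := by
    rintro e _ _ rfl rfl
    exact hedge' e
  have hcross' : ∀ e x u, (src e).1.down = x → (tgt e).1.down = u →
      s((x, t x u), (u, t u x)) ∈ (walk e).edges := by
    rintro e _ _ rfl rfl
    exact hcross e
  have hne : ∀ e, src e ≠ tgt e := fun e h => (hadj e).ne (by rw [h])
  refine ⟨{ branch := fun x => (x.1.down, clawCenter), src := src, tgt := tgt, walk := walk,
            isLink := hl, isPath := fun e _ => hpath e, isCycle := fun e h => absurd h (hne e),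
            branch_injective := ?_, branch_mem_support := ?_, support_inter := ?_,
            edges_disjoint := ?_, cover_vertices := ?_, cover_edges := ?_ }⟩
  · intro x y h
    exact Subtype.ext (ULift.ext _ _ (congrArg Prod.fst h))
  · intro e x hx
    rcases (hsupp e _).1 hx with ⟨h, -⟩ | ⟨h, -⟩
    · exact Or.inl (Subtype.ext (ULift.ext _ _ h))
    · exact Or.inr (Subtype.ext (ULift.ext _ _ h))
  · intro e e' hne z hz hz'
    exact ⟨⟨⟨z.1⟩, Set.mem_univ _⟩, Prod.ext rfl (hinter e e' hne z hz hz').symm⟩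
  · intro e e' hne a ha ha'
    induction a using Sym2.ind with
    | _ x y =>
      have hx := hinter e e' hne x (Walk.fst_mem_support_of_mem_edges _ ha)
        (Walk.fst_mem_support_of_mem_edges _ ha')
      have hy := hinter e e' hne y (Walk.snd_mem_support_of_mem_edges _ ha)
        (Walk.snd_mem_support_of_mem_edges _ ha')
      -- A common edge would have two claw centres as its ends; these are not adjacent, since a
      -- centre is not a port.
      rcases (walk e).adj_of_mem_edges ha with ⟨-, h⟩ | ⟨h1, h2, -⟩
      · exact h.ne (hx.trans hy.symm)
      · have := (ht x.1).1 y.1 h1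
        rw [← h2, hx] at this
        exact not_adj_clawCenter this
  · rintro ⟨v, p⟩
    right
    obtain ⟨q, hq, hp⟩ := exists_mem_clawLeg p
    obtain ⟨u, hu, rfl⟩ := ht.exists_adj_eq h3 v hq
    exact ⟨⟨_, hE v u hu⟩, (hsupp' _ _).2 ⟨u, rfl, hu, hp⟩⟩
  · intro a ha
    induction a using Sym2.ind with
    | _ x y =>
      obtain ⟨x, p⟩ := x
      obtain ⟨y, q⟩ := y
      rcases ha with ⟨h1, h2⟩ | ⟨h1, h2, h4⟩
      · dsimp only at h1 h2
        subst h1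
        obtain ⟨r, hr, hp, hq⟩ := exists_clawLeg_of_adj p q h2
        obtain ⟨u, hu, rfl⟩ := ht.exists_adj_eq h3 x hr
        refine ⟨⟨_, hE x u hu⟩, ?_⟩
        have hd := hdown ⟨_, hE x u hu⟩
        rcases Sym2.eq_iff.1 hd with ⟨h5, h6⟩ | ⟨h5, h6⟩
        · exact hedge₁ ⟨_, hE x u hu⟩ x u h5.symm h6.symm p q h2 hp hq
        · exact hedge₂ ⟨_, hE x u hu⟩ u x h6.symm h5.symm p q h2 hp hq
      · dsimp only at h1 h2 h4
        subst h2 h4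
        refine ⟨⟨_, hE x y h1⟩, ?_⟩
        have hd := hdown ⟨_, hE x y h1⟩
        rcases Sym2.eq_iff.1 hd with ⟨h5, h6⟩ | ⟨h5, h6⟩
        · exact hcross' ⟨_, hE x y h1⟩ x y h5.symm h6.symm
        · rw [Sym2.eq_swap (a := (x, t x y)) (b := (y, t y x))]
          exact hcross' ⟨_, hE x y h1⟩ y x h6.symm h5.symm

end ClawInflate

lemma isFrame_liftGraph {k : ℕ} {G : SimpleGraph (IterVert k)}
    {t : IterVert k → IterVert k → PVert} (hG : IsIteratedPetersen k G) (ht : IsAttachment G t) :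
    IsFrame (liftGraph.{u, v} G Set.univ) (inflate G t) := by
  have h3 := hG.ncard_neighborSet
  have hcc : G.CutConnected := by
    intro S hS
    obtain ⟨a⟩ := nonempty_iterVert k
    -- The pair `s(a, a)` is not an edge, so nothing is deleted.
    exact hG.vertexConnected.of_edge_closed h3 (x := a) (y := a)
      fun x y hxy _ => outDarts_eq_empty_iff.1 hS x y hxy
  obtain ⟨σ⟩ := nonempty_subdivision_clawInflate.{u, v} ht h3
  refine isFrame_of_isTwoConnected (hG.vertexConnected.liftGraph_isTwoConnected h3)
    (liftGraph_isCubic h3) clawInflate_le σ (clawInflate_cutConnected hcc) ?_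
  rw [Nat.card_prod]
  exact (even_card_iterVert k).mul_right _

/-! ### A frame of the Petersen graph with two vertices -/

/-- A spanning subgraph of the Petersen graph that consists of three paths between `1` and `4`. -/
def thetaSubgraph : SimpleGraph (Fin 10) where
  Adj a b := petersen.Adj a b ∧ (a, b) ∉ [((0 : Fin 10), (5 : Fin 10)), (5, 0), (2, 7), (7, 2),
    (3, 8), (8, 3), (6, 9), (9, 6)]
  symm := ⟨by decide +kernel⟩
  loopless := ⟨fun a h => h.1.ne rfl⟩

instance : DecidableRel thetaSubgraph.Adj := fun a b => by
  unfold thetaSubgraph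
  infer_instance

lemma thetaSubgraph_le : thetaSubgraph ≤ petersen := fun _ _ h => h.1

/-- The vertices of the three paths of `thetaSubgraph`. -/
def thetaPath : Fin 3 → List (Fin 10) :=
  ![[1, 0, 4], [1, 2, 3, 4], [1, 6, 8, 5, 7, 9, 4]]

lemma thetaPath_inter : ∀ i j, i ≠ j → ∀ a, a ∈ thetaPath i → a ∈ thetaPath j → a = 1 ∨ a = 4 := by
  decide +kernel

lemma exists_mem_thetaPath : ∀ a, ∃ i, a ∈ thetaPath i := by decide +kernel

lemma exists_thetaPath_of_adj : ∀ a b, thetaSubgraph.Adj a b →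
    ∃ i, a ∈ thetaPath i ∧ b ∈ thetaPath i := by
  decide +kernel

lemma thetaSubgraph_not_adj : ¬ thetaSubgraph.Adj 1 4 := by decide

lemma thetaSubgraph_cutConnected : thetaSubgraph.CutConnected := by
  intro S hS
  rw [outDarts_eq_empty_iff] at hS
  have hch : [(0 : Fin 10), 1, 2, 3, 4, 9, 7, 5, 8, 6].IsChain thetaSubgraph.Adj := by
    decide +kernel
  have hmem : ∀ a, a ∈ [(0 : Fin 10), 1, 2, 3, 4, 9, 7, 5, 8, 6] := by decide
  have key := mem_iff_mem_of_isChain hch fun x _ y _ h => ⟨hS x y h, hS y x h.symm⟩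
  rcases S.eq_empty_or_nonempty with h | ⟨x, hx⟩
  · exact Or.inl h
  · right
    rw [Set.eq_univ_iff_forall]
    exact fun y => (key x (hmem x) y (hmem y)).1 hx

set_option synthInstance.maxSize 1024 in
lemma exists_theta_walk (i : Fin 3) : ∃ w : thetaSubgraph.Walk 1 4, w.IsPath ∧
    (∀ a, a ∈ w.support ↔ a ∈ thetaPath i) ∧
    ∀ a b, thetaSubgraph.Adj a b → a ∈ thetaPath i → b ∈ thetaPath i → s(a, b) ∈ w.edges := by
  have h : i = 0 ∨ i = 1 ∨ i = 2 := by
    revert i; decide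
  rcases h with rfl | rfl | rfl
  · have h1 : thetaSubgraph.Adj 1 0 := by decide
    have h2 : thetaSubgraph.Adj 0 4 := by decide
    refine ⟨.cons h1 (.cons h2 .nil), ?_, ?_, ?_⟩
    · simp only [Walk.isPath_def, Walk.support_cons, Walk.support_nil]; decide
    · simp only [Walk.support_cons, Walk.support_nil]; decide +kernel
    · simp only [Walk.edges_cons, Walk.edges_nil, List.mem_cons, List.not_mem_nil, or_false,
        Sym2.eq_iff]
      decide +kernel
  · have h1 : thetaSubgraph.Adj 1 2 := by decide
    have h2 : thetaSubgraph.Adj 2 3 := by decide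
    have h3 : thetaSubgraph.Adj 3 4 := by decide
    refine ⟨.cons h1 (.cons h2 (.cons h3 .nil)), ?_, ?_, ?_⟩
    · simp only [Walk.isPath_def, Walk.support_cons, Walk.support_nil]; decide
    · simp only [Walk.support_cons, Walk.support_nil]; decide +kernel
    · simp only [Walk.edges_cons, Walk.edges_nil, List.mem_cons, List.not_mem_nil, or_false,
        Sym2.eq_iff]
      decide +kernel
  · have h1 : thetaSubgraph.Adj 1 6 := by decide
    have h2 : thetaSubgraph.Adj 6 8 := by decide
    have h3 : thetaSubgraph.Adj 8 5 := by decide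
    have h4 : thetaSubgraph.Adj 5 7 := by decide
    have h5 : thetaSubgraph.Adj 7 9 := by decide
    have h6 : thetaSubgraph.Adj 9 4 := by decide
    refine ⟨.cons h1 (.cons h2 (.cons h3 (.cons h4 (.cons h5 (.cons h6 .nil))))), ?_, ?_, ?_⟩
    · simp only [Walk.isPath_def, Walk.support_cons, Walk.support_nil]; decide
    · simp only [Walk.support_cons, Walk.support_nil]; decide +kernel
    · simp only [Walk.edges_cons, Walk.edges_nil, List.mem_cons, List.not_mem_nil, or_false,
        Sym2.eq_iff]
      decide +kernel

namespace Graph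

variable {α β : Type*}

lemma banana_isConnected {a b : α} {A : Set β} (hA : A.Nonempty) :
    (banana a b A).IsConnected := by
  obtain ⟨e, he⟩ := hA
  rw [isConnected_iff_forall_closed]
  refine ⟨⟨a, Or.inl rfl⟩, fun S hS x hx y hy hxS => ?_⟩
  have h1 : a ∈ S → b ∈ S := hS e a b ⟨he, Or.inl ⟨rfl, rfl⟩⟩
  have h2 : b ∈ S → a ∈ S := hS e b a ⟨he, Or.inr ⟨rfl, rfl⟩⟩
  rcases hx with rfl | rfl <;> rcases hy with rfl | rfl <;> tauto

lemma vertexDegree_banana {a b : α} (hab : a ≠ b) {A : Set β} {x : α}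
    (hx : x ∈ V(banana a b A)) : (banana a b A).vertexDegree x = A.encard := by
  have hl : (banana a b A).loopSet x = ∅ := by
    rw [Set.eq_empty_iff_forall_notMem]
    intro e he
    rw [mem_loopSet, banana_isLoopAt] at he
    exact hab he.2.2
  have hi : (banana a b A).incidenceSet x = A := by
    ext e
    rw [mem_incidenceSet, banana_inc]
    exact and_iff_left hx
  rw [vertexDegree, hl, hi, Set.encard_empty, add_zero]

lemma banana_isTwoConnected {a b : α} (hab : a ≠ b) {A : Set β} (hA : A.Nontrivial) :
    (banana a b A).IsTwoConnected := by
  refine ⟨banana_isConnected hA.nonempty, ⟨a, Or.inl rfl, b, Or.inr rfl, hab⟩, ?_, ?_⟩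
  · intro v hv
    rw [isConnected_iff_forall_closed]
    constructor
    · rcases hv with rfl | rfl
      · exact ⟨b, Or.inr rfl, hab.symm⟩
      · exact ⟨a, Or.inl rfl, hab⟩
    · rintro S - x ⟨hx, hxv⟩ y ⟨hy, hyv⟩ hxS
      have : x = y := by
        simp only [Set.mem_singleton_iff] at hxv hyv
        rcases hv with rfl | rfl <;> rcases hx with rfl | rfl <;> rcases hy with rfl | rfl <;>
          first | rfl | exact absurd rfl hxv | exact absurd rfl hyv
      exact this ▸ hxS
  · intro e _
    obtain ⟨e', he', hne⟩ := hA.exists_ne e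
    rw [isConnected_iff_forall_closed]
    refine ⟨⟨a, Or.inl rfl⟩, fun S hS x hx y hy hxS => ?_⟩
    have h1 : a ∈ S → b ∈ S := hS e' a b (by
      rw [deleteEdges_isLink]; exact ⟨⟨he', Or.inl ⟨rfl, rfl⟩⟩, hne⟩)
    have h2 : b ∈ S → a ∈ S := hS e' b a (by
      rw [deleteEdges_isLink]; exact ⟨⟨he', Or.inr ⟨rfl, rfl⟩⟩, hne⟩)
    rcases hx with rfl | rfl <;> rcases hy with rfl | rfl <;> tauto

/-- Two of the parallel edges form a circuit through both vertices. -/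
lemma banana_ell {a b : α} (hab : a ≠ b) {A B : Set β} (hBA : B ⊆ A) (hB : B.encard = 2) :
    (banana a b A).ell = 0 := by
  have hne : B.Nonempty := by
    rw [← Set.encard_ne_zero, hB]
    exact two_ne_zero
  refine le_antisymm ((iInf₂_le (banana a b B) ⟨(IsSpanningSubgraph.banana_mono hBA).le,
    ?_, banana_isConnected hne, fun x hx => (vertexDegree_banana hab hx).trans hB⟩).trans ?_) zero_le
  · refine iSup_le fun x => (iInf₂_le x x.2).trans ?_
    rw [SimpleGraph.edist_self]
  · exact Set.toFinite {a, b}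

end Graph

section Theta

/-- The multigraph with two vertices and three parallel edges. -/
def thetaFrame : Graph (ULift.{u} (Fin 2)) (ULift.{v} (Fin 3)) :=
  Graph.banana ⟨0⟩ ⟨1⟩ Set.univ

lemma nonempty_subdivision_thetaFrame :
    Nonempty (Subdivision thetaSubgraph thetaFrame.{u, v}) := by
  choose walk hpath hsupp hedge using exists_theta_walk
  have h01 : (⟨0⟩ : ULift.{u} (Fin 2)) ≠ ⟨1⟩ := fun h => absurd (congrArg ULift.down h) (by decide)
  have hV : ∀ x : V(thetaFrame.{u, v}), x.1 = ⟨0⟩ ∨ x.1 = ⟨1⟩ := fun x => x.2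
  let b₀ : V(thetaFrame.{u, v}) := ⟨⟨0⟩, Or.inl rfl⟩
  let b₁ : V(thetaFrame.{u, v}) := ⟨⟨1⟩, Or.inr rfl⟩
  have hV' : ∀ x, x = b₀ ∨ x = b₁ := fun x => (hV x).imp Subtype.ext Subtype.ext
  have hne : b₀ ≠ b₁ := fun h => h01 (congrArg Subtype.val h)
  let branch : V(thetaFrame.{u, v}) → Fin 10 := fun x => if x.1.down = 0 then 1 else 4
  have hrange : ∀ a, a = 1 ∨ a = 4 → a ∈ Set.range branch := by
    rintro a (rfl | rfl)
    · exact ⟨b₀, rfl⟩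
    · exact ⟨b₁, rfl⟩
  have hE : ∀ i : Fin 3, (⟨i⟩ : ULift.{v} (Fin 3)) ∈ E(thetaFrame.{u, v}) := fun i => Set.mem_univ _
  have hinter : ∀ e e' : E(thetaFrame.{u, v}), e ≠ e' → ∀ a, a ∈ (walk e.1.down).support →
      a ∈ (walk e'.1.down).support → a = 1 ∨ a = 4 := by
    intro e e' hne a ha ha'
    exact thetaPath_inter e.1.down e'.1.down (fun h => hne (Subtype.ext (ULift.ext _ _ h))) a
      ((hsupp _ a).1 ha) ((hsupp _ a).1 ha')
  refine ⟨{ branch := branch, src := fun _ => b₀, tgt := fun _ => b₁,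
            walk := fun e => walk e.1.down, isLink := fun e => ⟨Set.mem_univ _, Or.inl ⟨rfl, rfl⟩⟩,
            isPath := fun e _ => hpath _, isCycle := fun e h => absurd h hne,
            branch_injective := ?_, branch_mem_support := fun e x _ => hV' x,
            support_inter := fun e e' hne a ha ha' => hrange a (hinter e e' hne a ha ha'),
            edges_disjoint := ?_, cover_vertices := ?_, cover_edges := ?_ }⟩
  · intro x y h
    rcases hV' x with rfl | rfl <;> rcases hV' y with rfl | rfl
    · rfl
    · exact absurd (show (1 : Fin 10) = 4 from h) (by decide)
    · exact absurd (show (4 : Fin 10) = 1 from h) (by decide)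
    · rfl
  · intro e e' hne a ha ha'
    induction a using Sym2.ind with
    | _ x y =>
      have hx := hinter e e' hne x (Walk.fst_mem_support_of_mem_edges _ ha)
        (Walk.fst_mem_support_of_mem_edges _ ha')
      have hy := hinter e e' hne y (Walk.snd_mem_support_of_mem_edges _ ha)
        (Walk.snd_mem_support_of_mem_edges _ ha')
      have hxy : thetaSubgraph.Adj x y := Walk.adj_of_mem_edges _ ha
      rcases hx with rfl | rfl <;> rcases hy with rfl | rfl
      · exact hxy.ne rfl
      · exact thetaSubgraph_not_adj hxy
      · exact thetaSubgraph_not_adj hxy.symm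
      · exact hxy.ne rfl
  · intro a
    obtain ⟨i, hi⟩ := exists_mem_thetaPath a
    exact Or.inr ⟨⟨⟨i⟩, hE i⟩, (hsupp i a).2 hi⟩
  · intro a ha
    induction a using Sym2.ind with
    | _ x y =>
      obtain ⟨i, hx, hy⟩ := exists_thetaPath_of_adj x y ha
      exact ⟨⟨⟨i⟩, hE i⟩, hedge i x y ha hx hy⟩

lemma isFrame_thetaFrame : IsFrame thetaFrame.{u, v} petersen ∧ thetaFrame.{u, v}.ell = 0 := by
  have h01 : (⟨0⟩ : ULift.{u} (Fin 2)) ≠ ⟨1⟩ := fun h => absurd (congrArg ULift.down h) (by decide)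
  have hne : (⟨0⟩ : ULift.{v} (Fin 3)) ≠ ⟨1⟩ := fun h => absurd (congrArg ULift.down h) (by decide)
  obtain ⟨σ⟩ := nonempty_subdivision_thetaFrame.{u, v}
  refine ⟨isFrame_of_isTwoConnected (Graph.banana_isTwoConnected h01 ⟨_, trivial, _, trivial, hne⟩)
    (fun x hx => (Graph.vertexDegree_banana h01 hx).trans ?_) thetaSubgraph_le σ
    thetaSubgraph_cutConnected ?_, Graph.banana_ell h01 (Set.subset_univ {⟨0⟩, ⟨1⟩})
    (Set.encard_pair hne)⟩
  · rw [← Set.Finite.cast_ncard_eq (Set.toFinite _), Set.ncard_univ, Nat.card_eq_fintype_card]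
    rfl
  · exact even_card_iterVert 0

end Theta

/-- Every iterated Petersen graph has a frame whose parameter `l` is at most the claimed value. -/
lemma IsIteratedPetersen.exists_isFrame_ell_le : ∀ {k : ℕ} {Q : SimpleGraph (IterVert k)},
    IsIteratedPetersen k Q → ∃ (α : Type u) (β : Type v) (F : Graph α β), IsFrame F Q ∧
      F.ell ≤ ((if k ≤ 1 then k else 2 ^ (2 * k - 3) : ℕ) : ℕ∞)
  | 0, Q, hQ => by
    have h : Q = petersen := hQ
    subst h
    exact ⟨_, _, thetaFrame, isFrame_thetaFrame.1, isFrame_thetaFrame.2.le.trans zero_le⟩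
  | 1, Q, ⟨G, t, hG, ht, hQ⟩ => by
    subst hQ
    refine ⟨_, _, liftGraph G Set.univ, isFrame_liftGraph hG ht, ?_⟩
    have h : G = petersen := hG
    subst h
    exact nineCycleGraph_isCircuit.ell_le nineCycleGraph_le nineCycleGraph_coversWithin
  | k + 2, Q, ⟨G, t, hG, ht, hQ⟩ => by
    subst hQ
    refine ⟨_, _, liftGraph G Set.univ, isFrame_liftGraph hG ht, ?_⟩
    obtain ⟨D, hle, hD, hcov⟩ := hG.exists_isCircuit_coversWithin
    refine (hD.ell_le hle hcov).trans (le_of_eq (congrArg Nat.cast ?_))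
    -- The frame is one inflation below, so its bound `2 * 4 ^ k` equals `2 ^ (2 * (k + 2) - 3)`.
    rw [if_neg (by omega), show 2 * (k + 2) - 3 = 2 * k + 1 by omega, pow_succ', pow_mul]
    norm_num

theorem theorem2 (k : ℕ) (Q : SimpleGraph (IterVert k)) (hQ : IsIteratedPetersen k Q) :
    (∀ (α : Type u) (β : Type v) (F : Graph α β), IsFrame F Q → F.IsCubic ∧ F.IsTwoConnected) ∧
    IsLeast {m : ℕ∞ | ∃ (α : Type u) (β : Type v) (F : Graph α β), IsFrame F Q ∧ F.ell = m}
      ((if k ≤ 1 then k else 2 ^ (2 * k - 3) : ℕ) : ℕ∞) := by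
  refine ⟨fun α β F hF => hF.isCubic_and_isTwoConnected hQ, ?_, ?_⟩
  · obtain ⟨α, β, F, hF, hle⟩ := hQ.exists_isFrame_ell_le
    exact ⟨α, β, F, hF, le_antisymm hle (hF.le_ell_of_isIteratedPetersen hQ)⟩
  · rintro m ⟨α, β, F, hF, rfl⟩
    exact hF.le_ell_of_isIteratedPetersen hQ
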